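/- For a partition $\alpha$ of $n\ge 1$ with $l(\alpha)$ parts, let $\mathcal C_\alpha\subseteq\mathfrak S_n$ be the conjugacy class of permutations with cycle type $\alpha$, and let $c_2(\alpha)$ be the number of minimal transitive ordered factorisations of an arbitrary fixed $\pi\in\mathcal C_\alpha$ into transpositions, i.e. of tuples $(\sigma_1,\dots,\sigma_j)$ of transpositions in $\mathfrak S_n$ with $\sigma_1\cdots\sigma_j=\pi$ such that the subgroup $\langle\sigma_1,\dots,\sigma_j\rangle$ acts transitively on $\{1,\dots,n\}$ and $j\geq 0$ is the least number of factors for which such a tuple exists. Put $\mu_2(\alpha)=n+l(\alpha)-2$. For $m\ge1$ let $$F_2^{(m)}(u,z;p_1,p_2,\dots)=\sum_{n\ge1}\ \sum_{\alpha\vdash n,\ l(\alpha)=m}c_2(\alpha)\,|\mathcal C_\alpha|\,p_\alpha\,\frac{u^{\mu_2(\alpha)}}{\mu_2(\alpha)!}\,\frac{z^n}{n!},\qquad p_\alpha=p_{\alpha_1}\cdots p_{\alpha_m},$$ and let $P_2^{(m)}(x_1,\dots,x_m)=\psi_m(F_2^{(m)})$, where $\psi_m$ is the linear operator (applied term by term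 to $F_2^{(m)}$) with $\psi_m(p_\alpha u^iz^j)=\sum_{\sigma\in\mathfrak S_m}x_1^{\alpha_{\sigma(1)}}\cdots x_m^{\alpha_{\sigma(m)}}$ for $\alpha$ with $m$ parts. Let $w(x)\in\mathbb Q[[x]]$ be the unique formal power series with $w=xe^{w}$, and let $w_i=w(x_i)$. For every $m\ge1$, $S_2^{(m)}$ denotes the symmetric polynomial in $m$ variables over $\mathbb Q$ such that $$\Big(\sum_{i=1}^m x_i\frac{\partial}{\partial x_i}\Big)^{3-m}P_2^{(m)}(x_1,\dots,x_m)=S_2^{(m)}(w_1,\dots,w_m)\prod_{i=1}^m x_i\frac{dw_i}{dx_i},$$ where a negative power of $\sum_i x_i\,\partial/\partial x_i$ means the inverse of the corresponding positive power on formal power series without constant term. **Lemma.** For every $m\ge 1$ there is exactly one symmetric polynomial $S_2^{(m)}$ with this property, and it is $S_2^{(m)}(w_1,\dots,w_m)=1$. -/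

import Mathlib

open scoped Nat

noncomputable section

namespace TransFact

/-! ### Minimal transitive ordered factorisations into `k`-cycles -/

/-- `σ = (σ₀, …, σ_{j-1})` is a transitive ordered factorisation of `π ∈ 𝔖ₙ` into `k`-cycles:
every factor is a `k`-cycle (all other points being fixed), the product of the factors is `π`, and
the subgroup generated by the factors acts transitively on the `n` symbols. -/
structure IsTransFactorisation (k : ℕ) {n j : ℕ} (π : Equiv.Perm (Fin n))
    (σ : Fin j → Equiv.Perm (Fin n)) : Prop where
  isCycle : ∀ i, (σ i).IsCycle
  card_support : ∀ i, (σ i).support.card = k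
  prod_eq : (List.ofFn σ).prod = π
  transitive : MulAction.IsPretransitive (Subgroup.closure (Set.range σ)) (Fin n)

/-- The least number of factors in a transitive ordered factorisation of `π` into `k`-cycles. -/
def minFactors (k : ℕ) {n : ℕ} (π : Equiv.Perm (Fin n)) : ℕ :=
  sInf {j | ∃ σ : Fin j → Equiv.Perm (Fin n), IsTransFactorisation k π σ}

/-- The number of minimal transitive ordered factorisations of `π` into `k`-cycles
(it is `0` if `π` has no transitive ordered factorisation into `k`-cycles at all). -/
def numMinFactorisations (k : ℕ) {n : ℕ} (π : Equiv.Perm (Fin n)) : ℕ :=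
  Nat.card {σ : Fin (minFactors k π) → Equiv.Perm (Fin n) // IsTransFactorisation k π σ}

/-- The conjugacy class `𝒞_α` of `𝔖ₙ`: the permutations with cycle distribution `α`
(fixed points are counted as parts equal to `1`). -/
def conjClass {n : ℕ} (α : n.Partition) : Set (Equiv.Perm (Fin n)) :=
  {π | π.partition.parts = α.parts}

theorem conjClass_nonempty {n : ℕ} (α : n.Partition) : (conjClass α).Nonempty := by
  have h : ∃ g : Equiv.Perm (Fin n), g.cycleType = α.parts.filter (fun i => 2 ≤ i) := by
    rw [Equiv.Perm.exists_with_cycleType_iff]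
    refine ⟨?_, fun a ha => (Multiset.mem_filter.1 ha).2⟩
    have h1 := congrArg Multiset.sum (Multiset.filter_add_not (fun i => 2 ≤ i) α.parts)
    rw [Multiset.sum_add] at h1
    have h2 := α.parts_sum
    simp only [Fintype.card_fin]
    omega
  obtain ⟨g, hg⟩ := h
  refine ⟨g, ?_⟩
  have hpos : ∀ s : Multiset ℕ, (∀ i ∈ s, 0 < i) →
      s = s.filter (fun i => 2 ≤ i) + Multiset.replicate (s.sum - (s.filter (2 ≤ ·)).sum) 1 := by
    intro s hs
    have e1 : s.filter (fun i => ¬ 2 ≤ i) =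
        Multiset.replicate (s.filter (fun i => ¬ 2 ≤ i)).card 1 := by
      rw [Multiset.eq_replicate_card]
      intro b hb
      have := hs b (Multiset.mem_filter.1 hb).1
      have := (Multiset.mem_filter.1 hb).2
      omega
    have e2 : s.sum = (s.filter (fun i => 2 ≤ i)).sum + (s.filter (fun i => ¬ 2 ≤ i)).card := by
      conv_lhs => rw [← Multiset.filter_add_not (fun i => 2 ≤ i) s, Multiset.sum_add, e1]
      simp
    rw [e2, Nat.add_sub_cancel_left, ← e1, Multiset.filter_add_not]
  show g.cycleType + Multiset.replicate (Fintype.card (Fin n) - g.support.card) 1 = α.parts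
  rw [← Equiv.Perm.sum_cycleType, hg, Fintype.card_fin]
  conv_rhs => rw [hpos α.parts (fun i hi => α.parts_pos hi), α.parts_sum]

/-- `c_k(α)`: the number of minimal transitive ordered factorisations into `k`-cycles of an
arbitrary but fixed `π ∈ 𝒞_α`. It does not depend on `π`, see `c_eq`. -/
def c (k : ℕ) {n : ℕ} (α : n.Partition) : ℕ :=
  numMinFactorisations k (conjClass_nonempty α).some

theorem isTransFactorisation_conj {k n j : ℕ} {π : Equiv.Perm (Fin n)}
    {σ : Fin j → Equiv.Perm (Fin n)} (g : Equiv.Perm (Fin n)) (h : IsTransFactorisation k π σ) :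
    IsTransFactorisation k (MulAut.conj g π) (fun i => MulAut.conj g (σ i)) where
  isCycle i := by simpa using (h.isCycle i).conj
  card_support i := by
    simpa [Equiv.Perm.support_conj] using h.card_support i
  prod_eq := by
    rw [← h.prod_eq, map_list_prod, List.map_ofFn]
    rfl
  transitive := by
    have := h.transitive
    refine ⟨fun x y => ?_⟩
    obtain ⟨⟨s, hs⟩, hxy⟩ := MulAction.exists_smul_eq
      (Subgroup.closure (Set.range σ)) (g⁻¹ x) (g⁻¹ y)
    refine ⟨⟨MulAut.conj g s, ?_⟩, ?_⟩
    · have e : Set.range (fun i => MulAut.conj g (σ i)) =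
          (MulAut.conj g).toMonoidHom '' Set.range σ := by
        rw [← Set.range_comp]; rfl
      rw [e, ← MonoidHom.map_closure]
      exact Subgroup.mem_map_of_mem _ hs
    · have hxy' : s (g⁻¹ x) = g⁻¹ y := hxy
      show (MulAut.conj g s) x = y
      simp only [MulAut.conj_apply, Equiv.Perm.mul_apply, hxy']
      simp

theorem isTransFactorisation_conj_iff {k n j : ℕ} {π : Equiv.Perm (Fin n)}
    {σ : Fin j → Equiv.Perm (Fin n)} (g : Equiv.Perm (Fin n)) :
    IsTransFactorisation k (MulAut.conj g π) (fun i => MulAut.conj g (σ i)) ↔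
      IsTransFactorisation k π σ := by
  refine ⟨fun h => ?_, isTransFactorisation_conj g⟩
  have := isTransFactorisation_conj g⁻¹ h
  simpa [mul_assoc] using this

theorem numMinFactorisations_conj (k : ℕ) {n : ℕ} (π g : Equiv.Perm (Fin n)) :
    numMinFactorisations k (MulAut.conj g π) = numMinFactorisations k π := by
  have key : ∀ j, (∃ σ : Fin j → Equiv.Perm (Fin n),
      IsTransFactorisation k (MulAut.conj g π) σ) ↔
      ∃ σ : Fin j → Equiv.Perm (Fin n), IsTransFactorisation k π σ := by
    refine fun j => ⟨fun ⟨σ, h⟩ => ⟨fun i => MulAut.conj g⁻¹ (σ i), ?_⟩,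
      fun ⟨σ, h⟩ => ⟨_, isTransFactorisation_conj g h⟩⟩
    have := isTransFactorisation_conj g⁻¹ h
    simpa [mul_assoc] using this
  have hmin : minFactors k (MulAut.conj g π) = minFactors k π := by
    unfold minFactors
    simp only [key]
  unfold numMinFactorisations
  rw [hmin]
  refine (Nat.card_congr ?_).symm
  exact Equiv.subtypeEquiv (Equiv.piCongrRight fun _ => (MulAut.conj g).toEquiv)
    (fun σ => (isTransFactorisation_conj_iff (σ := σ) g).symm)

theorem c_eq (k : ℕ) {n : ℕ} (α : n.Partition) {π : Equiv.Perm (Fin n)} (hπ : π ∈ conjClass α) :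
    numMinFactorisations k π = c k α := by
  have h : IsConj (conjClass_nonempty α).some π := by
    rw [Equiv.Perm.partition_eq_of_isConj, Nat.Partition.ext_iff]
    exact (conjClass_nonempty α).some_mem.trans hπ.symm
  obtain ⟨g, hg⟩ := isConj_iff.1 h
  rw [← hg]
  exact numMinFactorisations_conj k _ g

/-! ### The generating series `F_k^{(m)}` -/

/-- `μ_k(α) = (n + l(α) - 2) / (k - 1)` (used only when `n, l(α) ≥ 1` and the division is
exact). -/
def mu (k : ℕ) {n : ℕ} (α : n.Partition) : ℕ := (n + α.parts.card - 2) / (k - 1)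

/-- The indeterminates `u, p₁, p₂, …`; the symbol `p 0` is never used. -/
inductive Var : Type
  | u : Var
  | p (i : ℕ) : Var

/-- `p_α = p_{α₁} p_{α₂} ⋯`. -/
def pMonomial {n : ℕ} (α : n.Partition) : MvPolynomial Var ℚ :=
  (α.parts.map fun i => MvPolynomial.X (Var.p i)).prod

open Classical in
/-- `F_k^{(m)}`, a formal power series in `z` with coefficients in `ℚ[u, p₁, p₂, …]`:
the sum over `n ≥ 1` with `k - 1 ∣ n + m - 2` and over the partitions `α` of `n` with `m` parts of
`c_k(α) |𝒞_α| p_α (u ^ μ_k(α) / μ_k(α)!) (z ^ n / n!)`. -/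
def F (k m : ℕ) : PowerSeries (MvPolynomial Var ℚ) :=
  PowerSeries.mk fun n =>
    if 1 ≤ n ∧ k - 1 ∣ n + m - 2 then
      ∑ α : n.Partition with α.parts.card = m,
        ((c k α * (conjClass α).ncard : ℚ) / ((mu k α)! * n !)) •
          (pMonomial α * MvPolynomial.X Var.u ^ mu k α)
    else 0

/-! ### The symmetrisation operator `ψ_m` -/

/-- The multiset of parts of the partition `α` for which a monomial in `u, p₁, p₂, …` is of the
form `p_α u ^ i`. -/
def varParts (d : Var →₀ ℕ) : Multiset ℕ :=
  d.toMultiset.filterMap fun v => match v with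
    | Var.u => none
    | Var.p i => some i

/-- `∑_{σ ∈ 𝔖_m} x₁ ^ α_{σ(1)} ⋯ x_m ^ α_{σ(m)}`, where `α₁ ≥ α₂ ≥ ⋯ ≥ α_m` are the elements of
a multiset with `m` elements. -/
def symSum (m : ℕ) (s : Multiset ℕ) : MvPowerSeries (Fin m) ℚ :=
  ∑ σ : Equiv.Perm (Fin m),
    ∏ i : Fin m, MvPowerSeries.X i ^ (s.sort (· ≥ ·)).getD (σ i : ℕ) 0

open Classical in
/-- The action of `ψ_m` on polynomials in `u, p₁, p₂, …`: the linear map with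
`p_α u ^ i ↦ ∑_{σ ∈ 𝔖_m} x₁ ^ α_{σ(1)} ⋯ x_m ^ α_{σ(m)}` if `α` has `m` parts
(see `psiCoeff_pMonomial`). Monomials `p_α u ^ i` where `α` does not have `m` parts do not occur
in `F_k^{(m)}`; they are sent to `0`. -/
def psiCoeff (m : ℕ) : MvPolynomial Var ℚ →ₗ[ℚ] MvPowerSeries (Fin m) ℚ :=
  (MvPolynomial.basisMonomials Var ℚ).constr ℚ fun d =>
    if (varParts d).card = m then symSum m (varParts d) else 0

/-- `ψ_m` on formal power series in `z`: `∑ⱼ fⱼ z ^ j ↦ ∑ⱼ ψ_m(fⱼ)`. The sum over `j` is taken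
coefficientwise in `x₁, …, x_m`; for `F_k^{(m)}` it is finite in each coefficient, see
`psi_F_support`. -/
def psi (m : ℕ) (f : PowerSeries (MvPolynomial Var ℚ)) : MvPowerSeries (Fin m) ℚ :=
  fun β => ∑ᶠ j : ℕ, MvPowerSeries.coeff β (psiCoeff m (PowerSeries.coeff j f))

/-- The symmetrised generating series `P_k^{(m)}(x₁, …, x_m) = ψ_m(F_k^{(m)})`. -/
def P (k m : ℕ) : MvPowerSeries (Fin m) ℚ := psi m (F k m)

theorem psiCoeff_pMonomial {m n : ℕ} (α : n.Partition) (h : α.parts.card = m) (i : ℕ) :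
    psiCoeff m (pMonomial α * MvPolynomial.X Var.u ^ i) = symSum m α.parts := by
  classical
  have e : pMonomial α * MvPolynomial.X Var.u ^ i = MvPolynomial.basisMonomials Var ℚ
      (Multiset.toFinsupp (α.parts.map Var.p + Multiset.replicate i Var.u)) := by
    have key : ∀ s : Multiset Var, (MvPolynomial.monomial (Multiset.toFinsupp s) (1 : ℚ)) =
        (s.map MvPolynomial.X).prod := by
      intro s
      induction s using Multiset.induction_on with
      | empty => simp
      | cons a s ih =>
        rw [Multiset.map_cons, Multiset.prod_cons, ← ih, ← Multiset.singleton_add, map_add,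
          Multiset.toFinsupp_singleton, MvPolynomial.X, MvPolynomial.monomial_mul, one_mul]
    rw [MvPolynomial.coe_basisMonomials]
    show _ = MvPolynomial.monomial _ _
    rw [key]
    simp [pMonomial]
  have hv : varParts (Multiset.toFinsupp (α.parts.map Var.p + Multiset.replicate i Var.u)) =
      α.parts := by
    have h1 : ∀ s : Multiset ℕ, ((s.map Var.p).filterMap fun v => match v with
        | Var.u => none
        | Var.p i => some i) = s := by
      intro s
      rw [Multiset.filterMap_map]
      exact Multiset.filterMap_some s
    have h2 : ∀ i : ℕ, ((Multiset.replicate i Var.u).filterMap fun v => match v with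
        | Var.u => none
        | Var.p i => some i) = 0 := by
      intro i
      induction i with
      | zero => simp
      | succ i ih => rw [Multiset.replicate_succ, Multiset.filterMap_cons_none _ _ rfl, ih]
    rw [varParts, Multiset.toFinsupp_toMultiset, Multiset.filterMap_add, h1, h2, add_zero]
  rw [e, psiCoeff, Module.Basis.constr_basis, hv, if_pos h]

/-- The coefficient of `x ^ β` in `ψ_m(F_k^{(m)})` only receives a contribution from the
coefficient of `z ^ j` with `j = |β|`. -/
theorem psi_F_support (k m j : ℕ) (β : Fin m →₀ ℕ)
    (h : MvPowerSeries.coeff β (psiCoeff m (PowerSeries.coeff j (F k m))) ≠ 0) :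
    j = β.degree := by
  classical
  contrapose! h
  rw [F, PowerSeries.coeff_mk]
  split_ifs
  · rw [map_sum, map_sum]
    refine Finset.sum_eq_zero fun α hα => ?_
    have hm : α.parts.card = m := (Finset.mem_filter.1 hα).2
    rw [map_smul, psiCoeff_pMonomial α hm, symSum, map_smul, map_sum, Finset.sum_eq_zero, smul_zero]
    intro σ _
    set l := α.parts.sort (· ≥ ·) with hl
    have hlen : l.length = m := by rw [hl, Multiset.length_sort, hm]
    have e : (∏ i : Fin m, (MvPowerSeries.X i : MvPowerSeries (Fin m) ℚ) ^ l.getD (σ i : ℕ) 0) =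
        MvPowerSeries.monomial (∑ i : Fin m, Finsupp.single i (l.getD (σ i : ℕ) 0)) 1 := by
      have key : ∀ s : Finset (Fin m),
          (∏ i ∈ s, (MvPowerSeries.X i : MvPowerSeries (Fin m) ℚ) ^ l.getD (σ i : ℕ) 0) =
          MvPowerSeries.monomial (∑ i ∈ s, Finsupp.single i (l.getD (σ i : ℕ) 0)) 1 := by
        intro s
        induction s using Finset.induction_on with
        | empty => simp [MvPowerSeries.monomial_zero_one]
        | insert a s ha ih =>
          rw [Finset.prod_insert ha, Finset.sum_insert ha, ih, MvPowerSeries.X_pow_eq,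
            MvPowerSeries.monomial_mul_monomial, one_mul]
      exact key _
    rw [e, MvPowerSeries.coeff_monomial, if_neg]
    rintro rfl
    apply h
    rw [map_sum]
    simp only [Finsupp.degree_single]
    rw [Equiv.sum_comp σ (fun i : Fin m => l.getD (i : ℕ) 0)]
    subst hlen
    have h3 : l.sum = j := by
      rw [← α.parts_sum, ← Multiset.sum_coe, hl, Multiset.sort_eq]
    rw [← h3]
    conv_lhs => rw [← List.ofFn_get l, List.sum_ofFn]
    refine Finset.sum_congr rfl fun i _ => ?_
    simp
  · simp

/-! ### Integer powers of the operator `∑ xᵢ ∂/∂xᵢ` -/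

/-- The operator `∑ᵢ xᵢ ∂/∂xᵢ` on formal power series in `x₁, …, x_m`. -/
def euler {m : ℕ} (f : MvPowerSeries (Fin m) ℚ) : MvPowerSeries (Fin m) ℚ :=
  ∑ i : Fin m, MvPowerSeries.X i * MvPowerSeries.pderiv ℚ i f

/-- The `s`-th power of `∑ᵢ xᵢ ∂/∂xᵢ` for an integer `s`: it multiplies `x ^ β` by `|β| ^ s`.
For `s ≥ 0` this is the iterate (`eulerPow_natCast`); for `s < 0` it is the inverse of the iterate
on the series without constant term (`euler_iterate_eulerPow_neg`,
`eulerPow_neg_euler_iterate`). -/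
def eulerPow {m : ℕ} (s : ℤ) (f : MvPowerSeries (Fin m) ℚ) : MvPowerSeries (Fin m) ℚ :=
  fun β => (β.degree : ℚ) ^ s * MvPowerSeries.coeff β f

theorem coeff_eulerPow {m : ℕ} (s : ℤ) (f : MvPowerSeries (Fin m) ℚ) (β : Fin m →₀ ℕ) :
    MvPowerSeries.coeff β (eulerPow s f) = (β.degree : ℚ) ^ s * MvPowerSeries.coeff β f := rfl

theorem coeff_euler {m : ℕ} (f : MvPowerSeries (Fin m) ℚ) (β : Fin m →₀ ℕ) :
    MvPowerSeries.coeff β (euler f) = (β.degree : ℚ) * MvPowerSeries.coeff β f := by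
  classical
  rw [euler, map_sum, Finsupp.degree_eq_sum, Nat.cast_sum, Finset.sum_mul]
  refine Finset.sum_congr rfl fun i _ => ?_
  rw [MvPowerSeries.X, MvPowerSeries.coeff_monomial_mul]
  split_ifs with h
  · rw [MvPowerSeries.coeff_pderiv, tsub_add_cancel_of_le h, one_mul, mul_comm]
    have h1 : 1 ≤ β i := by simpa using h i
    simp [Nat.cast_sub h1]
  · have : β i = 0 := by
      by_contra h0
      exact h (by simpa [Finsupp.single_le_iff] using Nat.one_le_iff_ne_zero.2 h0)
    simp [this]

theorem coeff_euler_iterate {m : ℕ} (s : ℕ) (f : MvPowerSeries (Fin m) ℚ) (β : Fin m →₀ ℕ) :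
    MvPowerSeries.coeff β (euler^[s] f) = (β.degree : ℚ) ^ s * MvPowerSeries.coeff β f := by
  induction s with
  | zero => simp
  | succ s ih => rw [Function.iterate_succ_apply', coeff_euler, ih]; ring

theorem eulerPow_natCast {m : ℕ} (s : ℕ) (f : MvPowerSeries (Fin m) ℚ) :
    eulerPow (s : ℤ) f = euler^[s] f := by
  ext β
  rw [coeff_eulerPow, coeff_euler_iterate, zpow_natCast]

theorem euler_iterate_eulerPow_neg {m : ℕ} (s : ℕ) (f : MvPowerSeries (Fin m) ℚ)
    (hf : MvPowerSeries.constantCoeff f = 0) : euler^[s] (eulerPow (-(s : ℤ)) f) = f := by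
  ext β
  rw [coeff_euler_iterate, coeff_eulerPow]
  by_cases h : β = 0
  · subst h
    simp [hf]
  · have : (β.degree : ℚ) ≠ 0 := by simpa [Finsupp.degree_eq_zero_iff] using h
    rw [zpow_neg, zpow_natCast, mul_inv_cancel_left₀ (pow_ne_zero _ this)]

theorem eulerPow_neg_euler_iterate {m : ℕ} (s : ℕ) (f : MvPowerSeries (Fin m) ℚ)
    (hf : MvPowerSeries.constantCoeff f = 0) : eulerPow (-(s : ℤ)) (euler^[s] f) = f := by
  ext β
  rw [coeff_eulerPow, coeff_euler_iterate]
  by_cases h : β = 0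
  · subst h
    simp [hf]
  · have : (β.degree : ℚ) ≠ 0 := by simpa [Finsupp.degree_eq_zero_iff] using h
    rw [zpow_neg, zpow_natCast, inv_mul_cancel_left₀ (pow_ne_zero _ this)]

/-! ### The series `w` and the polynomials `S_k^{(m)}` -/

/-- The right-hand side `x exp(v(x) ^ (k - 1))` of the functional equation for `w`. -/
def rhs (k : ℕ) (v : PowerSeries ℚ) : PowerSeries ℚ :=
  PowerSeries.X * (PowerSeries.exp ℚ).subst (v ^ (k - 1))

/-- The formal power series `w(x)` that solves `w = x exp(w ^ (k - 1))`. For `k ≥ 2` there is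
exactly one solution, see `existsUnique_w`. -/
def w (k : ℕ) : PowerSeries ℚ := Classical.epsilon fun v => v = rhs k v

theorem constantCoeff_rhs (k : ℕ) (v : PowerSeries ℚ) :
    PowerSeries.constantCoeff (rhs k v) = 0 := by
  simp [rhs]

theorem rhs_congr {k : ℕ} (hk : 2 ≤ k) {a b : PowerSeries ℚ}
    (ha : PowerSeries.constantCoeff a = 0) (hb : PowerSeries.constantCoeff b = 0) {n : ℕ}
    (h : PowerSeries.X ^ n ∣ a - b) : PowerSeries.X ^ (n + 1) ∣ rhs k a - rhs k b := by
  have hk' : k - 1 ≠ 0 := by omega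
  have ha' : PowerSeries.HasSubst (a ^ (k - 1)) :=
    PowerSeries.HasSubst.of_constantCoeff_zero' (by rw [map_pow, ha, zero_pow hk'])
  have hb' : PowerSeries.HasSubst (b ^ (k - 1)) :=
    PowerSeries.HasSubst.of_constantCoeff_zero' (by rw [map_pow, hb, zero_pow hk'])
  rw [rhs, rhs, ← mul_sub, pow_succ']
  refine mul_dvd_mul_left _ (PowerSeries.X_pow_dvd_iff.2 fun e he => ?_)
  rw [map_sub, sub_eq_zero, PowerSeries.coeff_subst' ha', PowerSeries.coeff_subst' hb']
  refine finsum_congr fun d => ?_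
  congr 1
  have h2 : PowerSeries.X ^ n ∣ (a ^ (k - 1)) ^ d - (b ^ (k - 1)) ^ d := by
    rw [← pow_mul, ← pow_mul]
    exact h.trans (sub_dvd_pow_sub_pow a b _)
  have := PowerSeries.X_pow_dvd_iff.1 h2 e he
  rwa [map_sub, sub_eq_zero] at this

theorem existsUnique_w {k : ℕ} (hk : 2 ≤ k) : ∃! v : PowerSeries ℚ, v = rhs k v := by
  have hc : ∀ n, PowerSeries.constantCoeff ((rhs k)^[n] 0) = 0 := by
    intro n
    cases n with
    | zero => simp
    | succ n => rw [Function.iterate_succ_apply', constantCoeff_rhs]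
  have hstep : ∀ n, PowerSeries.X ^ n ∣ (rhs k)^[n + 1] 0 - (rhs k)^[n] 0 := by
    intro n
    induction n with
    | zero => simp
    | succ n ih =>
      rw [Function.iterate_succ_apply' (rhs k) (n + 1), Function.iterate_succ_apply' (rhs k) n]
      rw [Function.iterate_succ_apply' (rhs k) n] at ih
      exact rhs_congr hk (constantCoeff_rhs _ _) (hc n) ih
  have hstab : ∀ e d, PowerSeries.coeff e ((rhs k)^[e + 1 + d] 0) =
      PowerSeries.coeff e ((rhs k)^[e + 1] 0) := by
    intro e d
    induction d with
    | zero => rfl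
    | succ d ih =>
      have := PowerSeries.X_pow_dvd_iff.1 (hstep (e + 1 + d)) e (by omega)
      rw [map_sub, sub_eq_zero] at this
      rw [← ih, ← this]
      rfl
  refine ⟨PowerSeries.mk fun n => PowerSeries.coeff n ((rhs k)^[n + 1] 0), ?_, ?_⟩
  · set v := PowerSeries.mk fun n => PowerSeries.coeff n ((rhs k)^[n + 1] 0) with hv
    have hv0 : PowerSeries.constantCoeff v = 0 := by
      rw [← PowerSeries.coeff_zero_eq_constantCoeff_apply, hv, PowerSeries.coeff_mk,
        PowerSeries.coeff_zero_eq_constantCoeff_apply, hc]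
    have happ : ∀ n, PowerSeries.X ^ n ∣ v - (rhs k)^[n] 0 := by
      intro n
      refine PowerSeries.X_pow_dvd_iff.2 fun e he => ?_
      obtain ⟨d, rfl⟩ := Nat.exists_eq_add_of_lt he
      have := hstab e d
      rw [map_sub, sub_eq_zero, hv, PowerSeries.coeff_mk, ← this]
      have e2 : e + 1 + d = e + d + 1 := by omega
      rw [e2]
    ext n
    have := PowerSeries.X_pow_dvd_iff.1 (rhs_congr hk hv0 (hc n) (happ n)) n (by omega)
    rw [map_sub, sub_eq_zero, ← Function.iterate_succ_apply' (rhs k)] at this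
    rw [this, hv, PowerSeries.coeff_mk]
  · intro y hy
    have hy0 : PowerSeries.constantCoeff y = 0 := by rw [hy]; exact constantCoeff_rhs _ _
    have happ : ∀ n, PowerSeries.X ^ n ∣ y - (rhs k)^[n] 0 := by
      intro n
      induction n with
      | zero => simp
      | succ n ih =>
        rw [Function.iterate_succ_apply']
        rw [hy]
        exact rhs_congr hk hy0 (hc n) ih
    ext n
    have := PowerSeries.X_pow_dvd_iff.1 (happ (n + 1)) n (by omega)
    rw [map_sub, sub_eq_zero] at this
    rw [this, PowerSeries.coeff_mk]

theorem w_eq {k : ℕ} (hk : 2 ≤ k) : w k = rhs k (w k) :=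
  Classical.epsilon_spec (p := fun v => v = rhs k v) (existsUnique_w hk).exists

/-- `wᵢ = w(xᵢ)` as a formal power series in `x₁, …, x_m`. -/
def wAt (k : ℕ) {m : ℕ} (i : Fin m) : MvPowerSeries (Fin m) ℚ :=
  (w k).subst (MvPowerSeries.X i : MvPowerSeries (Fin m) ℚ)

/-- The defining property of the symmetric polynomial `S_k^{(m)}`:
`(∑ᵢ xᵢ ∂/∂xᵢ) ^ (3 - m) P_k^{(m)} = S_k^{(m)}(w₁, …, w_m) ∏ᵢ xᵢ dwᵢ/dxᵢ`. -/
structure IsS (k m : ℕ) (S : MvPolynomial (Fin m) ℚ) : Prop where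
  symmetric : S.IsSymmetric
  equation : eulerPow (3 - (m : ℤ)) (P k m) =
    MvPolynomial.aeval (fun i => wAt k i) S *
      ∏ i : Fin m, (MvPowerSeries.X i * MvPowerSeries.pderiv ℚ i (wAt k i))

end TransFact

end

/-!
The lemma is Hurwitz's formula in terms of generating series. The formula says that a permutation
of `n` points with cycles of lengths `α₁, …, α_m` has
`(n + m - 2)! n ^ (m - 3) ∏ αᵢ ^ αᵢ / (αᵢ - 1)!` minimal transitive factorisations into
transpositions (`numFact_eq`, `c_two_eq`). The class of these permutations has `n! / (∏ αᵢ · s)`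
elements, where `s` is the order of the group of symmetries of `α`; `ψ_m` supplies the factor `s`.
So the coefficient of `x ^ β` in `P` is `n ^ (m - 3) ∏ βᵢ ^ βᵢ / βᵢ!` with `n = |β|`, if all `βᵢ`
are positive (`coeff_P`), and `(∑ xᵢ ∂/∂xᵢ) ^ (3 - m)` removes the power of `n`. As
`x dw/dx = ∑ nⁿ / n! xⁿ` (`coeff_w`), this leaves `∏ xᵢ dwᵢ/dxᵢ`. Uniqueness holds because
this product is not zero and the series `wᵢ` are algebraically independent (`aeval_wAt_ne_zero`).

Hurwitz's formula is proved by induction on the number of factors. If the first transposition is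
removed from a connected factorisation on a set `A`, then what remains is a connected factorisation
on `A` or a shuffle of connected factorisations on the two parts of a partition of `A`
(`numFact_succ`). The new product arises by joining two cycles of the old one, or by cutting a
cycle. This recursion gives the lower bound `n + m - 2` for the number of factors
(`card_add_card_cycles_le`). If the bound is attained, then a join leaves a connected
factorisation, a cut leaves a shuffle, and both parts of the shuffle attain their bounds.

That the right-hand side of the formula satisfies the same recursion is `hurwitzWeight_cut_join`.
The sum over the distributions of the uncut cycles to the two parts is of the kind treated by
Hurwitz's generalisation of Abel's binomial theorem. By `hurwitzSum_neg_two_neg_two` it is a sum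
over single cycles, so that the recursion reduces to two identities for `g n = nⁿ / n!`: Abel's
identity for `∑ g r g (k - r) / (r (k - r))` (`abel_tree`) and an expression of `g (k + z)`
through the sums `∑ g r g (k - r) / (r + z)` and `∑ g r g (z - r) / (r + k)` (`treeCoeff_pair`).
-/

open scoped Nat

noncomputable section

namespace TransFact

/-! ### Hurwitz's generalisation of Abel's binomial theorem -/

section Abel

variable {ι : Type*} [DecidableEq ι]

theorem sum_powerset_sum_mem (X : Finset ι) (F : ι → Finset ι → ℚ) :
    ∑ S ∈ X.powerset, ∑ z ∈ S, F z S =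
      ∑ z ∈ X, ∑ S ∈ (X.erase z).powerset, F z (insert z S) := by
  rw [Finset.sum_comm' (t' := X) (s' := fun z => X.powerset.filter (z ∈ ·))]
  · refine Finset.sum_congr rfl fun z hz => ?_
    symm
    refine Finset.sum_bij' (fun S _ => insert z S) (fun S _ => S.erase z) ?_ ?_ ?_ ?_ ?_
    · intro S hS
      rw [Finset.mem_powerset] at hS
      simp only [Finset.mem_filter, Finset.mem_powerset, Finset.mem_insert_self, and_true]
      exact Finset.insert_subset hz (hS.trans (Finset.erase_subset _ _))
    · intro S hS
      simp only [Finset.mem_filter, Finset.mem_powerset] at hS ⊢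
      exact Finset.erase_subset_erase _ hS.1
    · intro S hS
      rw [Finset.mem_powerset] at hS
      exact Finset.erase_insert fun h => Finset.notMem_erase z X (hS h)
    · intro S hS
      exact Finset.insert_erase (Finset.mem_filter.1 hS).2
    · intros; rfl
  · intro S z
    simp only [Finset.mem_powerset, Finset.mem_filter]
    constructor
    · exact fun h => ⟨⟨h.1, h.2⟩, h.1 h.2⟩
    · exact fun h => ⟨h.1.1, h.1.2⟩

theorem erase_sdiff_eq_sdiff_insert (X S : Finset ι) (z : ι) :
    X \ insert z S = X.erase z \ S := by
  ext y; simp; tauto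

/-- The sum `∑ (a + x_S) ^ (|S| + p) (b + x_T) ^ (|T| + q)` over the partitions of `X` into two
sets `S` and `T`, where `x_S` is the sum of the weights `x i` for `i ∈ S`. The exponents may be
negative, so powers are taken with integer exponents; the bases are positive in all uses. -/
def hurwitzSum (p q : ℤ) (x : ι → ℚ) (X : Finset ι) (a b : ℚ) : ℚ :=
  ∑ S ∈ X.powerset, (a + ∑ i ∈ S, x i) ^ ((S.card : ℤ) + p) *
    (b + ∑ i ∈ X \ S, x i) ^ (((X \ S).card : ℤ) + q)

variable {x : ι → ℚ}

theorem hurwitzSum_comm (p q : ℤ) (x : ι → ℚ) (X : Finset ι) (a b : ℚ) :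
    hurwitzSum p q x X a b = hurwitzSum q p x X b a := by
  unfold hurwitzSum
  refine Finset.sum_bij' (fun S _ => X \ S) (fun S _ => X \ S) ?_ ?_ ?_ ?_ ?_
  · simp
  · simp
  · intro S hS; exact Finset.sdiff_sdiff_eq_self (Finset.mem_powerset.1 hS)
  · intro S hS; exact Finset.sdiff_sdiff_eq_self (Finset.mem_powerset.1 hS)
  · intro S hS
    rw [Finset.sdiff_sdiff_eq_self (Finset.mem_powerset.1 hS), mul_comm]

omit [DecidableEq ι] in
theorem add_sum_pos {S : Finset ι} (hx : ∀ i ∈ S, 0 < x i) {a : ℚ} (ha : 0 < a) :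
    0 < a + ∑ i ∈ S, x i :=
  add_pos_of_pos_of_nonneg ha (Finset.sum_nonneg fun i hi => (hx i hi).le)

/-- Splitting one factor `a + x_S` off the first power. -/
theorem hurwitzSum_succ_left (p q : ℤ) {X : Finset ι} (hx : ∀ i ∈ X, 0 < x i)
    {a : ℚ} (ha : 0 < a) (b : ℚ) :
    hurwitzSum (p + 1) q x X a b = a * hurwitzSum p q x X a b +
      ∑ z ∈ X, x z * hurwitzSum (p + 1) q x (X.erase z) (a + x z) b := by
  unfold hurwitzSum
  have h : ∀ S ∈ X.powerset, (a + ∑ i ∈ S, x i) ^ ((S.card : ℤ) + (p + 1)) *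
      (b + ∑ i ∈ X \ S, x i) ^ (((X \ S).card : ℤ) + q) =
      a * ((a + ∑ i ∈ S, x i) ^ ((S.card : ℤ) + p) *
        (b + ∑ i ∈ X \ S, x i) ^ (((X \ S).card : ℤ) + q)) +
      ∑ z ∈ S, x z * ((a + ∑ i ∈ S, x i) ^ ((S.card : ℤ) + p) *
        (b + ∑ i ∈ X \ S, x i) ^ (((X \ S).card : ℤ) + q)) := by
    intro S hS
    rw [← add_assoc, zpow_add_one₀
      (add_sum_pos (fun i hi => hx i (Finset.mem_powerset.1 hS hi)) ha).ne', ← Finset.sum_mul]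
    ring
  rw [Finset.sum_congr rfl h, Finset.sum_add_distrib, ← Finset.mul_sum,
    sum_powerset_sum_mem X (fun z S => x z * ((a + ∑ i ∈ S, x i) ^ ((S.card : ℤ) + p) *
        (b + ∑ i ∈ X \ S, x i) ^ (((X \ S).card : ℤ) + q)))]
  congr 1
  refine Finset.sum_congr rfl fun z hz => ?_
  rw [Finset.mul_sum]
  refine Finset.sum_congr rfl fun S hS => ?_
  have hzS : z ∉ S := fun h => Finset.notMem_erase z X (Finset.mem_powerset.1 hS h)
  rw [Finset.sum_insert hzS, Finset.card_insert_of_notMem hzS, erase_sdiff_eq_sdiff_insert]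
  have e : (((S.card + 1 : ℕ) : ℤ) + p) = (S.card : ℤ) + (p + 1) := by push_cast; ring
  rw [e, add_assoc a]

/-- The two factors `a + x_S` and `b + x_{X \ S}` add up to `a + b + x_X`. -/
theorem hurwitzSum_total (p q : ℤ) {X : Finset ι} (hx : ∀ i ∈ X, 0 < x i)
    {a b : ℚ} (ha : 0 < a) (hb : 0 < b) :
    (a + b + ∑ i ∈ X, x i) * hurwitzSum p q x X a b =
      hurwitzSum (p + 1) q x X a b + hurwitzSum p (q + 1) x X a b := by
  unfold hurwitzSum
  rw [Finset.mul_sum, ← Finset.sum_add_distrib]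
  refine Finset.sum_congr rfl fun S hS => ?_
  rw [← add_assoc, ← add_assoc,
    zpow_add_one₀ (add_sum_pos (fun i hi => hx i (Finset.mem_powerset.1 hS hi)) ha).ne',
    zpow_add_one₀ (add_sum_pos (fun i hi => hx i (Finset.sdiff_subset hi)) hb).ne',
    ← Finset.sum_sdiff (Finset.mem_powerset.1 hS)]
  ring

/-- The new element `y` is either in `T` or in `S`. -/
theorem hurwitzSum_insert (p q : ℤ) (X : Finset ι) {y : ι} (hy : y ∉ X) (a b : ℚ) :
    hurwitzSum p q x (insert y X) a b =
      hurwitzSum p (q + 1) x X a (b + x y) + hurwitzSum (p + 1) q x X (a + x y) b := by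
  unfold hurwitzSum
  rw [Finset.sum_powerset_insert hy]
  congr 1
  · refine Finset.sum_congr rfl fun S hS => ?_
    have hyS : y ∉ S := fun h => hy (Finset.mem_powerset.1 hS h)
    have hyT : y ∉ X \ S := fun h => hy (Finset.mem_sdiff.1 h).1
    rw [Finset.insert_sdiff_of_notMem _ hyS, Finset.sum_insert hyT,
      Finset.card_insert_of_notMem hyT]
    have e : (((X \ S).card + 1 : ℕ) : ℤ) + q = ((X \ S).card : ℤ) + (q + 1) := by push_cast; ring
    rw [e, add_assoc b]
  · refine Finset.sum_congr rfl fun S hS => ?_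
    have hyS : y ∉ S := fun h => hy (Finset.mem_powerset.1 hS h)
    have e : insert y X \ insert y S = X \ S := by
      rw [erase_sdiff_eq_sdiff_insert, Finset.erase_insert hy]
    have e' : (((S.card + 1 : ℕ) : ℤ) + p) = (S.card : ℤ) + (p + 1) := by push_cast; ring
    rw [e, Finset.sum_insert hyS, Finset.card_insert_of_notMem hyS, e', add_assoc a]

/-- The two statements are proved together by induction on `|X|`: the closed form for exponent
shifts `-1, 0`, and the fact that for shifts `0, 0` the sum depends on `a + b` only. -/
theorem hurwitzSum_closed_and_translation (N : ℕ) :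
    ∀ X : Finset ι, (∀ i ∈ X, 0 < x i) → X.card = N →
    (∀ a b : ℚ, 0 < a → 0 < b →
      a * hurwitzSum (-1) 0 x X a b = (a + b + ∑ i ∈ X, x i) ^ N) ∧
    ∀ a b a' b' : ℚ, 0 < a → 0 < b → 0 < a' → 0 < b' → a + b = a' + b' →
      hurwitzSum 0 0 x X a b = hurwitzSum 0 0 x X a' b' := by
  induction N using Nat.strong_induction_on with
  | _ N ih =>
    intro X hx hX
    have h1 : ∀ a b : ℚ, 0 < a → 0 < b →
        a * hurwitzSum (-1) 0 x X a b = (a + b + ∑ i ∈ X, x i) ^ N := by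
      intro a b ha hb
      rcases X.eq_empty_or_nonempty with rfl | ⟨y, hy⟩
      · simp at hX; subst hX
        simp [hurwitzSum, ha.ne']
      · obtain ⟨X, hyX, rfl⟩ : ∃ X', y ∉ X' ∧ X = insert y X' :=
          ⟨X.erase y, Finset.notMem_erase _ _, (Finset.insert_erase hy).symm⟩
        rw [Finset.card_insert_of_notMem hyX] at hX
        have hy0 : 0 < x y := hx y hy
        replace hx : ∀ i ∈ X, 0 < x i := fun i hi => hx i (Finset.mem_insert_of_mem hi)
        obtain ⟨i1, i2⟩ := ih X.card (by omega) X hx rfl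
        rw [hurwitzSum_insert _ _ _ hyX]
        -- The translation invariance for `X` cancels the two sums without a shift.
        have t := hurwitzSum_total (-1) 0 hx ha (add_pos hb hy0)
        rw [show (-1 : ℤ) + 1 = 0 by norm_num] at t ⊢
        have e := i1 a (b + x y) ha (add_pos hb hy0)
        have e2 := i2 (a + x y) b a (b + x y) (add_pos ha hy0) hb ha (add_pos hb hy0)
          (by ring)
        rw [Finset.sum_insert hyX, e2, ← hX, pow_succ]
        rw [show a + b + (x y + ∑ i ∈ X, x i) = a + (b + x y) + ∑ i ∈ X, x i by ring, ← e]
        linear_combination -a * t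
    refine ⟨h1, fun a b a' b' ha hb ha' hb' hab => ?_⟩
    have s := fun {a : ℚ} (ha : 0 < a) (b : ℚ) => hurwitzSum_succ_left (-1) 0 hx ha b
    rw [show (-1 : ℤ) + 1 = 0 by norm_num] at s
    rw [s ha, s ha', h1 a b ha hb, h1 a' b' ha' hb', hab]
    congr 1
    refine Finset.sum_congr rfl fun z hz => ?_
    have hz' := Finset.card_erase_lt_of_mem hz
    rw [(ih (X.erase z).card (by omega) _ (fun i hi => hx i (Finset.mem_of_mem_erase hi)) rfl).2
      (a + x z) b (a' + x z) b'
      (add_pos ha (hx z hz)) hb (add_pos ha' (hx z hz)) hb' (by linarith)]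

theorem hurwitzSum_neg_one_zero {X : Finset ι} (hx : ∀ i ∈ X, 0 < x i)
    {a b : ℚ} (ha : 0 < a) (hb : 0 < b) :
    hurwitzSum (-1) 0 x X a b = (a + b + ∑ i ∈ X, x i) ^ (X.card : ℤ) / a := by
  rw [eq_div_iff ha.ne', mul_comm,
    (hurwitzSum_closed_and_translation _ X hx rfl).1 a b ha hb, zpow_natCast]

theorem hurwitzSum_neg_one_neg_one {X : Finset ι} (hx : ∀ i ∈ X, 0 < x i)
    {a b : ℚ} (ha : 0 < a) (hb : 0 < b) :
    hurwitzSum (-1) (-1) x X a b =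
      (a + b + ∑ i ∈ X, x i) ^ ((X.card : ℤ) - 1) * (1 / a + 1 / b) := by
  have hn := add_sum_pos hx (add_pos ha hb)
  have t := hurwitzSum_total (-1) (-1) hx ha hb
  rw [show (-1 : ℤ) + 1 = 0 by norm_num, hurwitzSum_comm 0 (-1), hurwitzSum_neg_one_zero hx ha hb,
    hurwitzSum_neg_one_zero hx hb ha, add_comm b a] at t
  rw [zpow_sub_one₀ hn.ne']
  apply mul_left_cancel₀ hn.ne'
  rw [t]
  field_simp
  ring

theorem hurwitzSum_neg_two_neg_one {X : Finset ι} (hx : ∀ i ∈ X, 0 < x i)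
    {a b : ℚ} (ha : 0 < a) (hb : 0 < b) :
    a * hurwitzSum (-2) (-1) x X a b =
      (a + b + ∑ i ∈ X, x i) ^ ((X.card : ℤ) - 1) * (1 / a + 1 / b) -
      (a + b + ∑ i ∈ X, x i) ^ ((X.card : ℤ) - 2) *
        ∑ z ∈ X, x z * (1 / (a + x z) + 1 / b) := by
  have s := hurwitzSum_succ_left (-2) (-1) hx ha b
  rw [show (-2 : ℤ) + 1 = -1 by norm_num, hurwitzSum_neg_one_neg_one hx ha hb] at s
  rw [s, add_sub_assoc, left_eq_add, Finset.mul_sum, ← Finset.sum_sub_distrib]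
  refine Finset.sum_eq_zero fun z hz => ?_
  rw [hurwitzSum_neg_one_neg_one (fun i hi => hx i (Finset.mem_of_mem_erase hi))
      (add_pos ha (hx z hz)) hb, Finset.card_erase_of_mem hz,
    ← Finset.add_sum_erase X x hz, Nat.cast_sub (Finset.card_pos.2 ⟨z, hz⟩)]
  rw [show (X.card : ℤ) - (1 : ℕ) - 1 = X.card - 2 by push_cast; ring,
    show a + x z + b + ∑ i ∈ X.erase z, x i = a + b + (x z + ∑ i ∈ X.erase z, x i) by ring]
  ring

/-- The sum with both exponents lowered by `2`: only single elements of `X` contribute. The double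
sum that arises from lowering the two exponents in turn collapses, because for fixed `z` the
remaining weights add up to `n - a - b - x z`, where `n = a + b + x_X`. -/
theorem hurwitzSum_neg_two_neg_two {X : Finset ι} (hx : ∀ i ∈ X, 0 < x i)
    {a b : ℚ} (ha : 0 < a) (hb : 0 < b) :
    a * b * hurwitzSum (-2) (-2) x X a b =
      (a + b + ∑ i ∈ X, x i) ^ ((X.card : ℤ) - 2) * ((a + b) ^ 2 / (a * b)) -
      (a + b + ∑ i ∈ X, x i) ^ ((X.card : ℤ) - 3) *
        ∑ z ∈ X, x z * (a + b + x z) * (1 / (a + x z) + 1 / (b + x z)) := by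
  have s := hurwitzSum_succ_left (-2) (-2) hx hb a
  set n := a + b + ∑ i ∈ X, x i with hn
  have hn0 : 0 < n := add_sum_pos hx (add_pos ha hb)
  rw [show (-2 : ℤ) + 1 = -1 by norm_num, hurwitzSum_comm (-1), hurwitzSum_comm (-2) (-2)] at s
  have s' : a * b * hurwitzSum (-2) (-2) x X a b = a * hurwitzSum (-2) (-1) x X a b -
      ∑ z ∈ X, x z * (a * hurwitzSum (-2) (-1) x (X.erase z) a (b + x z)) := by
    rw [s, mul_add, Finset.mul_sum]
    simp only [fun z => hurwitzSum_comm (-1) (-2) x (X.erase z) (b + x z) a]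
    rw [← mul_assoc, add_sub_assoc, left_eq_add, ← Finset.sum_sub_distrib]
    exact Finset.sum_eq_zero fun z _ => by ring
  rw [s', hurwitzSum_neg_two_neg_one hx ha hb, ← hn]
  have h2 : ∀ z ∈ X, x z * (a * hurwitzSum (-2) (-1) x (X.erase z) a (b + x z)) =
      n ^ ((X.card : ℤ) - 3) * (x z * (n * (1 / a + 1 / (b + x z))) - x z * (∑ y ∈ X.erase z,
        x y * (1 / (a + x y)) + (∑ y ∈ X.erase z, x y) * (1 / (b + x z)))) := by
    intro z hz
    rw [hurwitzSum_neg_two_neg_one (fun i hi => hx i (Finset.mem_of_mem_erase hi)) ha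
      (add_pos hb (hx z hz)), Finset.card_erase_of_mem hz,
      Nat.cast_sub (Finset.card_pos.2 ⟨z, hz⟩)]
    rw [show a + (b + x z) + ∑ i ∈ X.erase z, x i = n by
      rw [hn, ← Finset.add_sum_erase X x hz]; ring]
    rw [show (X.card : ℤ) - (1 : ℕ) - 1 = (X.card - 3) + 1 by push_cast; ring,
      show (X.card : ℤ) - (1 : ℕ) - 2 = (X.card - 3) by push_cast; ring, zpow_add_one₀ hn0.ne']
    simp only [mul_add, Finset.sum_add_distrib, Finset.sum_mul]
    ring
  have h3 : ∀ z ∈ X, x z * (a * hurwitzSum (-2) (-1) x (X.erase z) a (b + x z)) =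
      n ^ ((X.card : ℤ) - 3) * (n / a * x z + n * (x z * (1 / (b + x z)))
        - x z * (∑ y ∈ X, x y * (1 / (a + x y))) + x z * (x z * (1 / (a + x z)))
        - (n - a - b - x z) * (x z * (1 / (b + x z)))) := by
    intro z hz
    rw [h2 z hz, ← Finset.add_sum_erase X (fun y => x y * (1 / (a + x y))) hz]
    rw [hn, ← Finset.add_sum_erase X x hz]
    ring
  have h4 : ∀ z ∈ X, x z * (a + b + x z) * (1 / (a + x z) + 1 / (b + x z)) =
      (a + b) * (x z * (1 / (a + x z))) + (a + b) * (x z * (1 / (b + x z)))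
      + x z * (x z * (1 / (a + x z))) + x z * (x z * (1 / (b + x z))) := fun z _ => by ring
  have h5 : ∀ z ∈ X, (n - a - b - x z) * (x z * (1 / (b + x z))) =
      (n - a - b) * (x z * (1 / (b + x z))) - x z * (x z * (1 / (b + x z))) := fun z _ => by ring
  rw [Finset.sum_congr rfl h3, ← Finset.mul_sum, Finset.sum_congr rfl h4,
    show (X.card : ℤ) - 1 = (X.card - 3) + 1 + 1 by ring,
    show (X.card : ℤ) - 2 = (X.card - 3) + 1 by ring, zpow_add_one₀ hn0.ne', zpow_add_one₀ hn0.ne']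
  simp only [Finset.sum_add_distrib, Finset.sum_sub_distrib]
  rw [Finset.sum_congr rfl h5]
  simp only [Finset.sum_add_distrib, Finset.sum_sub_distrib, ← Finset.mul_sum, ← Finset.sum_mul,
    mul_add]
  have hX : ∑ i ∈ X, x i = n - a - b := by rw [hn]; ring
  rw [hX]
  generalize ∑ z ∈ X, x z * (1 / (a + x z)) = U
  generalize ∑ z ∈ X, x z * (1 / (b + x z)) = V
  generalize ∑ z ∈ X, x z * (x z * (1 / (a + x z))) = U'
  generalize ∑ z ∈ X, x z * (x z * (1 / (b + x z))) = V'
  generalize n ^ ((X.card : ℤ) - 3) = p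
  field_simp
  ring

end Abel

/-! ### Identities for the numbers `nⁿ / n!` -/

/-- `nⁿ / n!`, the coefficient of `xⁿ` in `x dw/dx` for `n ≥ 1`. The value at `0` is `1`, whereas
`x dw/dx` has no constant term. -/
def treeCoeff (n : ℕ) : ℚ := (n : ℚ) ^ n / n !

theorem treeCoeff_pos (n : ℕ) : 0 < treeCoeff n := by
  rcases n.eq_zero_or_pos with rfl | h
  · simp [treeCoeff]
  · unfold treeCoeff; positivity

/-- Abel's identity for the numbers `r^(r-1) / r!`: Hurwitz's identity for `k - 2` elements of
weight `1` and `a = b = 1`. -/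
theorem abel_tree (k : ℕ) (hk : 1 ≤ k) :
    (k : ℚ) ^ 2 * ∑ r ∈ Finset.Ioo 0 k, treeCoeff r * treeCoeff (k - r) / (r * (k - r : ℕ)) =
      2 * (k - 1) * treeCoeff k := by
  obtain rfl | ⟨N, rfl⟩ : k = 1 ∨ ∃ N, k = N + 2 := by
    rcases k with _ | _ | N
    · omega
    · exact Or.inl rfl
    · exact Or.inr ⟨N, rfl⟩
  · rw [show Finset.Ioo 0 1 = ∅ from rfl]; simp
  have h := hurwitzSum_neg_one_neg_one (x := fun _ : ℕ => (1 : ℚ)) (X := Finset.range N)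
    (fun _ _ => one_pos) one_pos one_pos
  have e : hurwitzSum (-1) (-1) (fun _ : ℕ => (1 : ℚ)) (Finset.range N) 1 1 =
      ∑ i ∈ Finset.range (N + 1), (N.choose i : ℚ) * ((1 + i : ℚ) ^ ((i : ℤ) - 1) *
        (1 + (N - i : ℕ) : ℚ) ^ (((N - i : ℕ) : ℤ) - 1)) := by
    unfold hurwitzSum
    have := Finset.sum_powerset_apply_card (x := Finset.range N)
      (fun i : ℕ => ((1 + i : ℚ) ^ ((i : ℤ) - 1) * (1 + (N - i : ℕ) : ℚ) ^ (((N - i : ℕ) : ℤ) - 1)))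
    rw [Finset.card_range] at this
    simp only [nsmul_eq_mul] at this
    rw [← this]
    refine Finset.sum_congr rfl fun S hS => ?_
    rw [Finset.card_sdiff_of_subset (Finset.mem_powerset.1 hS), Finset.card_range]
    simp only [Finset.sum_const, nsmul_eq_mul, mul_one, Finset.card_range,
      Finset.card_sdiff_of_subset (Finset.mem_powerset.1 hS)]
    rfl
  have e2 : ∑ r ∈ Finset.Ioo 0 (N + 2), treeCoeff r * treeCoeff (N + 2 - r) / (r * (N + 2 - r : ℕ))
      = (∑ i ∈ Finset.range (N + 1), (N.choose i : ℚ) * ((1 + i : ℚ) ^ ((i : ℤ) - 1) *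
        (1 + (N - i : ℕ) : ℚ) ^ (((N - i : ℕ) : ℤ) - 1))) / N ! := by
    rw [Finset.sum_div]
    symm
    refine Finset.sum_bij' (fun i _ => i + 1) (fun r _ => r - 1) ?_ ?_ ?_ ?_ ?_
    · intro i hi; simp at hi ⊢; omega
    · intro i hi; simp at hi ⊢; omega
    · intro i hi; simp
    · intro i hi; simp at hi; omega
    · intro i hi
      obtain ⟨j, rfl⟩ : ∃ j, N = i + j := ⟨N - i, by simp at hi; omega⟩
      rw [show i + j + 2 - (i + 1) = j + 1 by omega, show i + j - i = j by omega]
      have hi0 : (1 + i : ℚ) ≠ 0 := by positivity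
      have hj0 : (1 + j : ℚ) ≠ 0 := by positivity
      rw [zpow_sub_one₀ hi0, zpow_sub_one₀ hj0, zpow_natCast, zpow_natCast,
        Nat.cast_add_choose]
      unfold treeCoeff
      rw [Nat.factorial_succ, Nat.factorial_succ, pow_succ, pow_succ]
      have := Nat.factorial_ne_zero i
      have := Nat.factorial_ne_zero j
      have := Nat.factorial_ne_zero (i + j)
      push_cast
      rw [add_comm (1 : ℚ) i, add_comm (1 : ℚ) j]
      field_simp
  rw [e2, ← e, h]
  unfold treeCoeff
  simp only [Finset.card_range, Finset.sum_const, nsmul_eq_mul, mul_one]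
  have hN : (1 + 1 + N : ℚ) ≠ 0 := by positivity
  have hN' : (N + 2 : ℚ) ≠ 0 := by positivity
  have := Nat.factorial_ne_zero N
  rw [zpow_sub_one₀ hN, zpow_natCast, Nat.factorial_succ, Nat.factorial_succ, pow_succ, pow_succ]
  push_cast
  rw [show (1 + 1 + N : ℚ) = N + 2 by ring]
  field_simp
  ring

/-- The `i`-th difference of `1 / (t + z)` at `t = y` is `(-1)ⁱ i! / ((z + y) ⋯ (z + y + i))`. -/
theorem fwdDiff_iter_inv (z : ℕ) (hz : 0 < z) (i y : ℕ) :
    (fwdDiff (1 : ℚ))^[i] (fun t => 1 / (t + z)) y * (z + y + i)! =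
      (-1) ^ i * i ! * (z + y - 1)! := by
  induction i generalizing y with
  | zero =>
    obtain ⟨n, hn⟩ : ∃ n, z + y = n + 1 := ⟨z + y - 1, by omega⟩
    have : (y + z : ℚ) = n + 1 := by rw [add_comm]; exact_mod_cast hn
    have h0 : (n + 1 : ℚ) ≠ 0 := by positivity
    simp only [Function.iterate_zero, id, this, add_zero, hn, Nat.factorial_succ, pow_zero,
      Nat.factorial_zero]
    push_cast
    field_simp
  | succ i ih =>
    rw [Function.iterate_succ_apply', fwdDiff]
    have h1 := ih (y + 1)
    have h2 := ih y
    obtain ⟨n, hn⟩ : ∃ n, z + y = n + 1 := ⟨z + y - 1, by omega⟩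
    rw [show z + (y + 1) = n + 2 by omega] at h1
    rw [hn] at h2 ⊢
    rw [show n + 1 + (i + 1) = n + i + 1 + 1 by ring]
    rw [show n + 2 + i = n + i + 1 + 1 by ring] at h1
    rw [show n + 1 + i = n + i + 1 by ring] at h2
    simp only [Nat.add_sub_cancel, show n + 2 - 1 = n + 1 by omega, Nat.factorial_succ] at *
    push_cast at *
    rw [sub_mul, h1]
    rw [pow_succ]
    linear_combination (-(n + i + 1 + 1) : ℚ) * h2

/-- Partial fractions of `i! zⁱ / ((z + 1) ⋯ (z + i))`. The left-hand side is `z` times the `i`-th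
difference of `tⁱ / (t + z)` at `0`, and `tⁱ` may be replaced by `(-z)ⁱ`, since
`(tⁱ - (-z)ⁱ) / (t + z)` is a polynomial in `t` of degree less than `i`. -/
theorem partial_fractions (z : ℕ) (hz : 0 < z) (i : ℕ) :
    ∑ a ∈ Finset.range (i + 1), (-1 : ℚ) ^ (i - a) * i.choose a * ((a : ℚ) ^ i * (z / (z + a))) =
      i ! * (z : ℚ) ^ i * z ! / (z + i)! := by
  have h1 : ∀ a ∈ Finset.range (i + 1),
      (-1 : ℚ) ^ (i - a) * i.choose a * ((a : ℚ) ^ i * (z / (z + a))) =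
      (-z : ℚ) ^ i * z * ((-1 : ℚ) ^ (i - a) * i.choose a * (1 / (a + z))) +
      z * ((-1 : ℚ) ^ (i - a) * i.choose a *
        ∑ k ∈ Finset.range i, (-z : ℚ) ^ (i - 1 - k) * (a : ℚ) ^ k) := by
    intro a _
    have h := (Commute.all (a : ℚ) (-z)).geom_sum₂_mul i
    have ha : (a + z : ℚ) ≠ 0 := by positivity
    rw [sub_neg_eq_add] at h
    rw [← eq_div_iff ha] at h
    simp only [fun k => mul_comm ((-z : ℚ) ^ (i - 1 - k)) ((a : ℚ) ^ k)]
    rw [h, add_comm (z : ℚ) a]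
    field_simp
    ring
  rw [Finset.sum_congr rfl h1, Finset.sum_add_distrib, ← Finset.mul_sum, ← Finset.mul_sum]
  have h2 := fwdDiff_iter_eq_sum_shift (1 : ℚ)
    (fun t => ∑ k ∈ Finset.range i, (-z : ℚ) ^ (i - 1 - k) * t ^ k) i 0
  rw [fwdDiff_iter_sum_mul_pow_eq_zero] at h2
  have h3 := fwdDiff_iter_eq_sum_shift (1 : ℚ) (fun t => 1 / (t + z : ℚ)) i 0
  have h4 := fwdDiff_iter_inv z hz i 0
  simp only [zsmul_eq_mul, nsmul_eq_mul, mul_one, zero_add, Pi.zero_apply] at h2 h3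
  push_cast at h2 h3 h4
  rw [← h2, ← h3, mul_zero, add_zero, eq_div_iff (by positivity), mul_assoc,
    show z + i = z + 0 + i by ring, h4]
  obtain ⟨n, rfl⟩ : ∃ n, z = n + 1 := ⟨z - 1, by omega⟩
  rw [neg_pow]
  have : ((-1 : ℚ) ^ i) * (-1) ^ i = 1 := by rw [← mul_pow]; simp
  simp only [add_zero, Nat.add_sub_cancel, Nat.factorial_succ]
  push_cast
  linear_combination ((n + 1 : ℚ)) ^ i * (n + 1) * i ! * n ! * this

/-- The right-hand side is a final part of the expansion of `(z + k)^(z + k) / (z + k)!`. Its terms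
are expanded by `partial_fractions`; the coefficient of `z / (z + a)` is then summed by the binomial
theorem for `(k - a)^(k - a)`. -/
theorem treeCoeff_convolution (k z : ℕ) (hz : 0 < z) :
    treeCoeff z * ∑ a ∈ Finset.range (k + 1), treeCoeff a * treeCoeff (k - a) * (z / (z + a)) =
      ∑ i ∈ Finset.range (k + 1),
        (z : ℚ) ^ (z + i) / (z + i)! * ((k : ℚ) ^ (k - i) / (k - i)!) := by
  have h1 : ∀ i ∈ Finset.range (k + 1),
      (z : ℚ) ^ (z + i) / (z + i)! * ((k : ℚ) ^ (k - i) / (k - i)!) =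
      ∑ a ∈ Finset.range (k + 1), treeCoeff z * (k : ℚ) ^ (k - i) / ((k - i)! * i !) *
        ((-1 : ℚ) ^ (i - a) * i.choose a * ((a : ℚ) ^ i * (z / (z + a)))) := by
    intro i hi
    have hi' : i + 1 ≤ k + 1 := by simpa using hi
    rw [← Finset.mul_sum, ← Finset.sum_subset (Finset.range_subset_range.2 hi'),
      partial_fractions z hz]
    · unfold treeCoeff
      have := Nat.factorial_ne_zero z
      have := Nat.factorial_ne_zero i
      rw [pow_add]
      field_simp
    · intro a _ ha
      rw [Nat.choose_eq_zero_of_lt (by simpa using ha)]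
      simp
  rw [Finset.sum_congr rfl h1, Finset.sum_comm, Finset.mul_sum]
  refine Finset.sum_congr rfl fun a ha => ?_
  obtain ⟨d, rfl⟩ : ∃ d, k = a + d := ⟨k - a, by simp at ha; omega⟩
  rw [← Finset.sum_subset (s₁ := (Finset.range (d + 1)).image (a + ·)), Finset.sum_image]
  · have e : ((a + d : ℕ) - a : ℚ) ^ d = ∑ j ∈ Finset.range (d + 1),
        (-a : ℚ) ^ j * ((a + d : ℕ) : ℚ) ^ (d - j) * d.choose j := by
      rw [← add_pow]; ring
    have e' : ((a + d : ℕ) - a : ℚ) = d := by push_cast; ring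
    rw [e'] at e
    rw [Nat.add_sub_cancel_left]
    conv_lhs => rw [treeCoeff, treeCoeff, treeCoeff, e]
    simp only [Finset.sum_div, Finset.mul_sum, Finset.sum_mul]
    refine Finset.sum_congr rfl fun j hj => ?_
    obtain ⟨l, rfl⟩ : ∃ l, d = j + l := ⟨d - j, by simp at hj; omega⟩
    rw [show a + (j + l) - (a + j) = l by omega, Nat.add_sub_cancel_left, Nat.add_sub_cancel_left,
      Nat.cast_add_choose, Nat.cast_add_choose, treeCoeff, neg_pow, pow_add (a : ℚ) a j]
    have := Nat.factorial_ne_zero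
    field_simp
  · intro x _ y _ h; simpa using h
  · intro x hx; simp at hx ⊢; omega
  · intro i hi hi'
    rw [Nat.choose_eq_zero_of_lt]
    · simp
    · by_contra h
      apply hi'
      simp at hi ⊢
      exact ⟨i - a, by omega, by omega⟩

/-- The final parts of the expansions of `(k + z)^(k + z)` from `z^z k^k` on and, with the roles of
`k` and `z` exchanged, up to this term overlap in this term only. -/
theorem treeCoeff_pair (k z : ℕ) (hk : 0 < k) (hz : 0 < z) :
    treeCoeff (k + z) = 2 * treeCoeff k * treeCoeff z +
      treeCoeff z * z * ∑ r ∈ Finset.Ioo 0 k, treeCoeff r * treeCoeff (k - r) * (1 / (r + z)) +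
      treeCoeff k * k * ∑ r ∈ Finset.Ioo 0 z, treeCoeff r * treeCoeff (z - r) * (1 / (r + k)) := by
  -- The terms `a = 0` and `a = k` are split off.
  have key : ∀ k z : ℕ, 0 < k → 0 < z →
      ∑ a ∈ Finset.range (k + 1), treeCoeff a * treeCoeff (k - a) * (z / (z + a)) =
      treeCoeff k * (z / (z + k)) + treeCoeff k +
        z * ∑ r ∈ Finset.Ioo 0 k, treeCoeff r * treeCoeff (k - r) * (1 / (r + z)) := by
    intro k z hk hz
    have hz0 : (z : ℚ) ≠ 0 := by positivity
    have e : Finset.Ioo 0 k = (Finset.range k).erase 0 := by ext; simp; omega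
    have h0 : treeCoeff 0 = 1 := by simp [treeCoeff]
    rw [Finset.sum_range_succ, ← Finset.add_sum_erase _ _ (Finset.mem_range.2 hk), ← e,
      Finset.mul_sum]
    simp only [Nat.sub_self, Nat.sub_zero, h0, Nat.cast_zero, add_zero, div_self hz0]
    have : ∀ r ∈ Finset.Ioo 0 k, treeCoeff r * treeCoeff (k - r) * (z / (z + r) : ℚ) =
        z * (treeCoeff r * treeCoeff (k - r) * (1 / (r + z))) := by
      intro r _
      rw [add_comm (z : ℚ)]; ring
    rw [Finset.sum_congr rfl this]
    ring
  have h1 := treeCoeff_convolution k z hz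
  have h2 := treeCoeff_convolution z k hk
  rw [key k z hk hz] at h1
  rw [key z k hz hk] at h2
  have h3 : ∑ i ∈ Finset.range (z + 1),
        (k : ℚ) ^ (k + i) / (k + i)! * ((z : ℚ) ^ (z - i) / (z - i)!) =
      ∑ j ∈ Finset.range (z + 1), (z : ℚ) ^ j / j ! * ((k : ℚ) ^ (k + z - j) / (k + z - j)!) := by
    rw [← Finset.sum_range_reflect]
    refine Finset.sum_congr rfl fun j hj => ?_
    have : j ≤ z := by simp at hj; omega
    rw [show z + 1 - 1 - j = z - j by omega, show k + (z - j) = k + z - j by omega,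
      show z - (z - j) = j by omega, mul_comm]
  have h4 : treeCoeff (k + z) = ∑ j ∈ Finset.range (k + z + 1),
      (z : ℚ) ^ j / j ! * ((k : ℚ) ^ (k + z - j) / (k + z - j)!) := by
    unfold treeCoeff
    rw [Nat.cast_add, add_comm (k : ℚ), add_pow, Finset.sum_div]
    refine Finset.sum_congr rfl fun j hj => ?_
    have : j ≤ k + z := by simp at hj; omega
    rw [Nat.cast_choose ℚ this]
    have := Nat.factorial_ne_zero (k + z)
    field_simp
  rw [show k + z + 1 = z + (k + 1) by ring, Finset.sum_range_add] at h4
  have h5 : ∑ i ∈ Finset.range (k + 1),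
        (z : ℚ) ^ (z + i) / (z + i)! * ((k : ℚ) ^ (k - i) / (k - i)!) =
      ∑ i ∈ Finset.range (k + 1), (z : ℚ) ^ (z + i) / (z + i)! *
        ((k : ℚ) ^ (k + z - (z + i)) / (k + z - (z + i))!) := by
    refine Finset.sum_congr rfl fun i _ => ?_
    rw [show k + z - (z + i) = k - i by omega]
  rw [h3, Finset.sum_range_succ, Nat.add_sub_cancel, ← treeCoeff, ← treeCoeff] at h2
  rw [h5] at h1
  have hkz : (k + z : ℚ) ≠ 0 := by positivity
  have h6 : (z / (z + k) + k / (k + z) : ℚ) = 1 := by rw [add_comm (z : ℚ) k]; field_simp; ring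
  linear_combination h4 - h1 - h2 + treeCoeff k * treeCoeff z * h6

/-- The right-hand side of Hurwitz's formula for a permutation with cycles indexed by `D`, the cycle
`i` having length `s i`, divided by the factorial of the number `n + |D| - 2` of factors:
`n ^ (|D| - 3) ∏ s i ^ s i / (s i - 1)!`, where `n` is the sum of the lengths. -/
def hurwitzWeight {ι : Type*} (D : Finset ι) (s : ι → ℕ) : ℚ :=
  (∑ i ∈ D, (s i : ℚ)) ^ ((D.card : ℤ) - 3) * ∏ i ∈ D, s i * treeCoeff (s i)

theorem hurwitzWeight_insert {ι : Type*} [DecidableEq ι] {S : Finset ι} {i : ι} (hi : i ∉ S)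
    (s : ι → ℕ) : hurwitzWeight (insert i S) s =
      (s i + ∑ j ∈ S, (s j : ℚ)) ^ ((S.card : ℤ) - 2) *
        (s i * treeCoeff (s i) * ∏ j ∈ S, s j * treeCoeff (s j)) := by
  unfold hurwitzWeight
  rw [Finset.sum_insert hi, Finset.prod_insert hi, Finset.card_insert_of_notMem hi]
  congr 2
  push_cast; ring

/-- The ways to cut a cycle of length `k` and to distribute the other cycles `X` to the two parts.
Only sums over single cycles of `X` remain, by `hurwitzSum_neg_two_neg_two`. -/
theorem sum_cut_one_cycle {ι : Type*} [DecidableEq ι] (X : Finset ι) (s : ι → ℕ)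
    (hs : ∀ i ∈ X, 0 < s i)
    (k : ℕ) (hk : 0 < k) :
    ∑ r ∈ Finset.Ioo 0 k, r * treeCoeff r * ((k - r : ℕ) * treeCoeff (k - r)) *
      hurwitzSum (-2) (-2) (fun i => (s i : ℚ)) X r (k - r : ℕ) =
    (k + ∑ i ∈ X, (s i : ℚ)) ^ ((X.card : ℤ) - 2) * (2 * (k - 1) * treeCoeff k) -
    2 * (k + ∑ i ∈ X, (s i : ℚ)) ^ ((X.card : ℤ) - 3) * ∑ z ∈ X, s z * (k + s z) *
      ∑ r ∈ Finset.Ioo 0 k, treeCoeff r * treeCoeff (k - r) * (1 / (r + s z)) := by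
  have h : ∀ r ∈ Finset.Ioo 0 k, r * treeCoeff r * ((k - r : ℕ) * treeCoeff (k - r)) *
      hurwitzSum (-2) (-2) (fun i => (s i : ℚ)) X r (k - r : ℕ) =
      (k + ∑ i ∈ X, (s i : ℚ)) ^ ((X.card : ℤ) - 2) *
        (k ^ 2 * (treeCoeff r * treeCoeff (k - r) / (r * (k - r : ℕ)))) -
      (k + ∑ i ∈ X, (s i : ℚ)) ^ ((X.card : ℤ) - 3) * (∑ z ∈ X, s z * (k + s z) *
        (treeCoeff r * treeCoeff (k - r) * (1 / (r + s z))) + ∑ z ∈ X, s z * (k + s z) *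
        (treeCoeff (k - r) * treeCoeff (k - (k - r)) * (1 / ((k - r : ℕ) + s z)))) := by
    intro r hr
    simp only [Finset.mem_Ioo] at hr
    have h1 := hurwitzSum_neg_two_neg_two (x := fun i => (s i : ℚ))
      (X := X) (fun i hi => by exact_mod_cast hs i hi) (a := r) (b := (k - r : ℕ))
      (by exact_mod_cast hr.1) (by exact_mod_cast Nat.sub_pos_of_lt hr.2)
    rw [show (r : ℚ) + (k - r : ℕ) = k by rw [Nat.cast_sub hr.2.le]; ring] at h1
    rw [← Finset.sum_add_distrib, show k - (k - r) = r by omega]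
    calc _ = treeCoeff r * treeCoeff (k - r) * (r * (k - r : ℕ) *
            hurwitzSum (-2) (-2) (fun i => (s i : ℚ)) X r (k - r : ℕ)) := by ring
      _ = _ := by
        rw [h1, mul_sub]
        congr 1
        · ring
        · rw [← mul_assoc, mul_comm (treeCoeff r * treeCoeff (k - r)), mul_assoc, Finset.mul_sum]
          congr 1
          exact Finset.sum_congr rfl fun z _ => by ring
  have refl : ∀ F : ℕ → ℚ, ∑ r ∈ Finset.Ioo 0 k, F (k - r) = ∑ r ∈ Finset.Ioo 0 k, F r := by
    intro F
    refine Finset.sum_bij' (fun r _ => k - r) (fun r _ => k - r) ?_ ?_ ?_ ?_ ?_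
    · intro r hr; simp at hr ⊢; omega
    · intro r hr; simp at hr ⊢; omega
    · intro r hr; simp at hr ⊢; omega
    · intro r hr; simp at hr ⊢; omega
    · intros; rfl
  rw [Finset.sum_congr rfl h, Finset.sum_sub_distrib, ← Finset.mul_sum, ← Finset.mul_sum,
    abel_tree k hk, ← Finset.mul_sum, Finset.sum_add_distrib,
    refl (fun r => ∑ z ∈ X, s z * (k + s z) *
        (treeCoeff r * treeCoeff (k - r) * (1 / (r + s z)))), Finset.sum_comm]
  simp only [← Finset.mul_sum]
  ring

/-- The weights satisfy the recursion that comes from removing one transposition. The first sum on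
the right is over the joins of two cycles, the second over the cuts of one. In both, the terms can
be ordered by pairs of cycles; those with a sum over `r` cancel by `treeCoeff_pair`. -/
theorem hurwitzWeight_cut_join {ι : Type*} [DecidableEq ι] (D : Finset ι) (hD : D.Nonempty)
    (s : ι → ℕ) (hs : ∀ i ∈ D, 0 < s i) :
    2 * ((∑ i ∈ D, (s i : ℚ)) + D.card - 2) * hurwitzWeight D s =
      ∑ p ∈ D.offDiag, s p.1 * s p.2 * ((∑ i ∈ D, (s i : ℚ)) ^ ((D.card : ℤ) - 4) *
        (((s p.1 + s p.2 : ℕ) : ℚ) * treeCoeff (s p.1 + s p.2) *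
          ∏ i ∈ (D.erase p.1).erase p.2, (s i * treeCoeff (s i)))) +
      ∑ i ∈ D, s i * ∑ r ∈ Finset.Ioo 0 (s i), ∑ S ∈ (D.erase i).powerset,
        ((r + ∑ j ∈ S, (s j : ℚ)) ^ ((S.card : ℤ) - 2) *
          (r * treeCoeff r * ∏ j ∈ S, s j * treeCoeff (s j))) *
        (((s i - r : ℕ) + ∑ j ∈ D.erase i \ S, (s j : ℚ)) ^ (((D.erase i \ S).card : ℤ) - 2) *
          ((s i - r : ℕ) * treeCoeff (s i - r) * ∏ j ∈ D.erase i \ S, s j * treeCoeff (s j))) := by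
  set n : ℚ := ∑ i ∈ D, (s i : ℚ) with hn
  have hn0 : n ≠ 0 := by
    have : 0 < n := Finset.sum_pos (fun i hi => by exact_mod_cast hs i hi) hD
    exact this.ne'
  set f : ι → ℚ := fun i => s i * treeCoeff (s i) with hf
  have hcut : ∀ i ∈ D, s i * ∑ r ∈ Finset.Ioo 0 (s i), ∑ S ∈ (D.erase i).powerset,
        ((r + ∑ j ∈ S, (s j : ℚ)) ^ ((S.card : ℤ) - 2) * (r * treeCoeff r * ∏ j ∈ S, f j)) *
        (((s i - r : ℕ) + ∑ j ∈ D.erase i \ S, (s j : ℚ)) ^ (((D.erase i \ S).card : ℤ) - 2) *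
          ((s i - r : ℕ) * treeCoeff (s i - r) * ∏ j ∈ D.erase i \ S, f j)) =
      2 * n ^ ((D.card : ℤ) - 3) * ((s i - 1) * ∏ j ∈ D, f j) -
      2 * n ^ ((D.card : ℤ) - 4) * ∑ z ∈ D.erase i, s i * (∏ j ∈ D.erase i, f j) *
        (s z * (s i + s z) * ∑ r ∈ Finset.Ioo 0 (s i),
          treeCoeff r * treeCoeff (s i - r) * (1 / (r + s z))) := by
    intro i hi
    have e := sum_cut_one_cycle (D.erase i) s (fun j hj => hs j (Finset.mem_of_mem_erase hj))
      (s i) (hs i hi)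
    have hni : (s i : ℚ) + ∑ j ∈ D.erase i, (s j : ℚ) = n :=
      Finset.add_sum_erase D (fun j => (s j : ℚ)) hi
    rw [hni, Finset.card_erase_of_mem hi, Nat.cast_sub (Finset.card_pos.2 hD)] at e
    rw [show (D.card : ℤ) - (1 : ℕ) - 2 = D.card - 3 by push_cast; ring,
      show (D.card : ℤ) - (1 : ℕ) - 3 = D.card - 4 by push_cast; ring] at e
    have h1 : ∀ r ∈ Finset.Ioo 0 (s i), ∑ S ∈ (D.erase i).powerset,
        ((r + ∑ j ∈ S, (s j : ℚ)) ^ ((S.card : ℤ) - 2) * (r * treeCoeff r * ∏ j ∈ S, f j)) *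
        (((s i - r : ℕ) + ∑ j ∈ D.erase i \ S, (s j : ℚ)) ^ (((D.erase i \ S).card : ℤ) - 2) *
          ((s i - r : ℕ) * treeCoeff (s i - r) * ∏ j ∈ D.erase i \ S, f j)) =
        (∏ j ∈ D.erase i, f j) * (r * treeCoeff r * ((s i - r : ℕ) * treeCoeff (s i - r)) *
        hurwitzSum (-2) (-2) (fun j => (s j : ℚ)) (D.erase i) r (s i - r : ℕ)) := by
      intro r _
      unfold hurwitzSum
      simp only [Finset.mul_sum, sub_eq_add_neg]
      refine Finset.sum_congr rfl fun S hS => ?_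
      rw [← Finset.prod_sdiff (Finset.mem_powerset.1 hS)]
      ring
    rw [Finset.sum_congr rfl h1, ← Finset.mul_sum, e, ← Finset.mul_prod_erase D f hi,
      ← Finset.mul_sum]
    simp only [hf]
    ring
  have hjoin : ∀ p ∈ D.offDiag, s p.1 * s p.2 * (n ^ ((D.card : ℤ) - 4) *
        (((s p.1 + s p.2 : ℕ) : ℚ) * treeCoeff (s p.1 + s p.2) *
          ∏ i ∈ (D.erase p.1).erase p.2, f i)) =
      n ^ ((D.card : ℤ) - 4) * (2 * ((s p.1 + s p.2) * ∏ i ∈ D, f i) +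
        s p.1 * (∏ j ∈ D.erase p.1, f j) * (s p.2 * (s p.1 + s p.2) *
          ∑ r ∈ Finset.Ioo 0 (s p.1), treeCoeff r * treeCoeff (s p.1 - r) * (1 / (r + s p.2))) +
        s p.2 * (∏ j ∈ D.erase p.2, f j) * (s p.1 * (s p.2 + s p.1) *
          ∑ r ∈ Finset.Ioo 0 (s p.2),
            treeCoeff r * treeCoeff (s p.2 - r) * (1 / (r + s p.1)))) := by
    rintro ⟨i, j⟩ hij
    simp only [Finset.mem_offDiag] at hij ⊢
    obtain ⟨hi, hj, hne⟩ := hij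
    have e1 : ∏ l ∈ D.erase i, f l = f j * ∏ l ∈ (D.erase i).erase j, f l :=
      (Finset.mul_prod_erase _ f (Finset.mem_erase.2 ⟨hne.symm, hj⟩)).symm
    have e2 : ∏ l ∈ D.erase j, f l = f i * ∏ l ∈ (D.erase i).erase j, f l := by
      rw [Finset.erase_right_comm]
      exact (Finset.mul_prod_erase _ f (Finset.mem_erase.2 ⟨hne, hi⟩)).symm
    have e3 : ∏ l ∈ D, f l = f i * (f j * ∏ l ∈ (D.erase i).erase j, f l) := by
      rw [← e1]; exact (Finset.mul_prod_erase _ f hi).symm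
    rw [treeCoeff_pair _ _ (hs i hi) (hs j hj), e1, e2, e3]
    simp only [hf]
    push_cast
    ring
  rw [Finset.sum_congr rfl hjoin, Finset.sum_congr rfl hcut, ← Finset.mul_sum,
    Finset.sum_sub_distrib, ← Finset.mul_sum, ← Finset.mul_sum, Finset.sum_add_distrib,
    Finset.sum_add_distrib]
  have off : ∀ F : ι → ι → ℚ, ∑ p ∈ D.offDiag, F p.1 p.2 = ∑ i ∈ D, ∑ j ∈ D.erase i, F i j := by
    intro F
    rw [Finset.sum_sigma']
    refine Finset.sum_bij' (fun p _ => ⟨p.1, p.2⟩) (fun p _ => (p.1, p.2)) ?_ ?_ ?_ ?_ ?_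
    · rintro ⟨i, j⟩ h; simp at h ⊢; tauto
    · rintro ⟨i, j⟩ h; simp at h ⊢; tauto
    · intros; rfl
    · intros; rfl
    · intros; rfl
  have swap : ∀ F : ι → ι → ℚ, ∑ p ∈ D.offDiag, F p.2 p.1 = ∑ p ∈ D.offDiag, F p.1 p.2 := by
    intro F
    refine Finset.sum_bij' (fun p _ => p.swap) (fun p _ => p.swap) ?_ ?_ ?_ ?_ ?_
    · rintro ⟨i, j⟩ h; simp at h ⊢; tauto
    · rintro ⟨i, j⟩ h; simp at h ⊢; tauto
    · intros; rfl
    · intros; rfl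
    · intros; rfl
  rw [swap fun i j => s i * (∏ j ∈ D.erase i, f j) * (s j * (s i + s j) *
          ∑ r ∈ Finset.Ioo 0 (s i), treeCoeff r * treeCoeff (s i - r) * (1 / (r + s j))),
    off fun i j => s i * (∏ j ∈ D.erase i, f j) * (s j * (s i + s j) *
          ∑ r ∈ Finset.Ioo 0 (s i), treeCoeff r * treeCoeff (s i - r) * (1 / (r + s j)))]
  -- What remains of the joins is `2 g(sᵢ) g(sⱼ)` for each pair.
  have hpair : ∑ p ∈ D.offDiag, 2 * (((s p.1 : ℚ) + s p.2) * ∏ i ∈ D, f i) =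
      4 * ((D.card - 1) * n) * ∏ i ∈ D, f i := by
    simp only [← mul_assoc, mul_add]
    rw [← Finset.sum_mul, Finset.sum_add_distrib, swap (fun i _ => 2 * (s i : ℚ)),
      off (fun i _ => 2 * (s i : ℚ))]
    have : ∀ i ∈ D, ∑ _j ∈ D.erase i, 2 * (s i : ℚ) = (D.card - 1) * (2 * s i) := by
      intro i hi
      rw [Finset.sum_const, Finset.card_erase_of_mem hi, nsmul_eq_mul,
        Nat.cast_sub (Finset.card_pos.2 hD)]
      simp
    rw [Finset.sum_congr rfl this, ← Finset.mul_sum, ← Finset.mul_sum, ← hn]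
    ring
  rw [hpair, ← Finset.sum_mul, Finset.sum_sub_distrib, ← hn, Finset.sum_const, nsmul_eq_mul]
  unfold hurwitzWeight
  rw [← hn, show (D.card : ℤ) - 3 = D.card - 4 + 1 by ring, zpow_add_one₀ hn0]
  ring

/-! ### Words of transpositions and connected factorisations -/

/-- The sum of the values of `F` at the words of length `j` over the alphabet `E`. It is defined by
recursion on the first letter, so that its properties follow by induction on `j`. -/
def wordSum {α : Type*} (E : Finset α) : ℕ → (List α → ℕ) → ℕ
  | 0, F => F []
  | j + 1, F => ∑ e ∈ E, wordSum E j fun l => F (e :: l)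

section Words

variable {α : Type*}

theorem wordSum_congr {E : Finset α} {j : ℕ} {F G : List α → ℕ}
    (h : ∀ l : List α, l.length = j → (∀ e ∈ l, e ∈ E) → F l = G l) :
    wordSum E j F = wordSum E j G := by
  induction j generalizing F G with
  | zero => exact h [] rfl (by simp)
  | succ j ih =>
    refine Finset.sum_congr rfl fun e he => ih fun l hl hlE => h _ (by simp [hl]) ?_
    simpa [he] using hlE

theorem wordSum_zero (E : Finset α) (j : ℕ) : wordSum E j (fun _ => 0) = 0 := by
  induction j with
  | zero => rfl
  | succ j ih => exact Finset.sum_eq_zero fun e _ => ih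

theorem wordSum_add (E : Finset α) (j : ℕ) (F G : List α → ℕ) :
    wordSum E j (fun l => F l + G l) = wordSum E j F + wordSum E j G := by
  induction j generalizing F G with
  | zero => rfl
  | succ j ih =>
    simp only [wordSum, ← Finset.sum_add_distrib]
    exact Finset.sum_congr rfl fun e _ => ih _ _

theorem wordSum_sum {β : Type*} (E : Finset α) (j : ℕ) (s : Finset β) (F : β → List α → ℕ) :
    wordSum E j (fun l => ∑ b ∈ s, F b l) = ∑ b ∈ s, wordSum E j (F b) := by
  classical
  induction s using Finset.induction_on with
  | empty => simpa using wordSum_zero E j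
  | insert b s hb ih => simp only [Finset.sum_insert hb, wordSum_add, ih]

theorem exists_of_wordSum_ne_zero {E : Finset α} {j : ℕ} {F : List α → ℕ}
    (h : wordSum E j F ≠ 0) : ∃ l : List α, l.length = j ∧ (∀ e ∈ l, e ∈ E) ∧ F l ≠ 0 := by
  by_contra! h'
  exact h ((wordSum_congr h').trans (wordSum_zero E j))

open Classical in
theorem wordSum_subset {E' E : Finset α} (hE : E' ⊆ E) (j : ℕ) (F : List α → ℕ) :
    wordSum E j (fun l => if ∀ e ∈ l, e ∈ E' then F l else 0) = wordSum E' j F := by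
  induction j generalizing F with
  | zero => simp [wordSum]
  | succ j ih =>
    simp only [wordSum]
    rw [← Finset.sum_subset hE]
    · refine Finset.sum_congr rfl fun e he => ?_
      rw [← ih]
      simp [he]
    · intro e _ he
      simpa [he] using wordSum_zero E j

/-- Words over a disjoint union of two alphabets are shuffles of two words, and words of lengths `i`
and `j - i` have `j.choose i` shuffles. -/
theorem wordSum_shuffle [DecidableEq α] {X Y : Finset α} (hXY : Disjoint X Y) (j : ℕ)
    (F G : List α → ℕ) :
    wordSum (X ∪ Y) j (fun l => F (l.filter (· ∈ X)) * G (l.filter (· ∈ Y))) =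
      ∑ p ∈ Finset.HasAntidiagonal.antidiagonal j,
        j.choose p.1 * (wordSum X p.1 F * wordSum Y p.2 G) := by
  induction j generalizing F G with
  | zero => simp [wordSum]
  | succ j ih =>
    have hp := Finset.sum_antidiagonal_choose_succ_mul (R := ℕ)
      (fun i k => wordSum X i F * wordSum Y k G) j
    simp only [Nat.cast_id] at hp
    rw [hp, wordSum, Finset.sum_union hXY, add_comm]
    congr 1
    · have h : ∀ e ∈ Y, wordSum (X ∪ Y) j (fun l => F ((e :: l).filter (· ∈ X)) *
          G ((e :: l).filter (· ∈ Y))) = wordSum (X ∪ Y) j (fun l => F (l.filter (· ∈ X)) *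
          (fun l => G (e :: l)) (l.filter (· ∈ Y))) := by
        intro e he
        have he' : e ∉ X := fun h => Finset.disjoint_left.1 hXY h he
        simp [he, he']
      rw [Finset.sum_congr rfl fun e he => (h e he).trans (ih F fun l => G (e :: l)),
        Finset.sum_comm]
      refine Finset.sum_congr rfl fun p _ => ?_
      rw [← Finset.mul_sum, ← Finset.mul_sum]
      rfl
    · have h : ∀ e ∈ X, wordSum (X ∪ Y) j (fun l => F ((e :: l).filter (· ∈ X)) *
          G ((e :: l).filter (· ∈ Y))) = wordSum (X ∪ Y) j (fun l =>
          (fun l => F (e :: l)) (l.filter (· ∈ X)) * G (l.filter (· ∈ Y))) := by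
        intro e he
        have he' : e ∉ Y := fun h => Finset.disjoint_left.1 hXY he h
        simp [he, he']
      rw [Finset.sum_congr rfl fun e he => (h e he).trans (ih (fun l => F (e :: l)) G),
        Finset.sum_comm]
      refine Finset.sum_congr rfl fun p hp => ?_
      rw [← Finset.mul_sum, ← Finset.sum_mul, ← Nat.choose_symm_of_eq_add
        (Finset.HasAntidiagonal.mem_antidiagonal.1 hp).symm]
      rfl

theorem wordSum_eq_card (E : Finset α) (j : ℕ) (P : List α → Prop) [DecidablePred P] :
    wordSum E j (fun l => if P l then 1 else 0) =
      Nat.card {f : Fin j → α // (∀ i, f i ∈ E) ∧ P (List.ofFn f)} := by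
  classical
  have key : wordSum E j (fun l => if P l then 1 else 0) =
      ((Fintype.piFinset fun _ : Fin j => E).filter fun f => P (List.ofFn f)).card := by
    rw [Finset.card_filter]
    induction j generalizing P with
    | zero => simp [wordSum]
    | succ j ih =>
      simp only [wordSum]
      rw [Finset.sum_congr rfl fun e _ => ih (fun l => P (e :: l)), Finset.sum_sigma']
      refine Finset.sum_bij' (fun p _ => (Fin.cons p.1 p.2 : Fin (j + 1) → α))
        (fun f _ => ⟨f 0, Fin.tail f⟩) ?_ ?_ ?_ ?_ ?_
      · rintro ⟨e, f⟩ h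
        simp only [Finset.mem_sigma, Fintype.mem_piFinset] at h ⊢
        exact fun i => Fin.cases h.1 (fun i => h.2 i) i
      · intro f h
        simp only [Finset.mem_sigma, Fintype.mem_piFinset] at h ⊢
        exact ⟨h 0, fun i => h i.succ⟩
      · rintro ⟨e, f⟩ _; simp
      · intro f _; simp
      · rintro ⟨e, f⟩ _; simp [List.ofFn_succ]
  rw [key, ← Nat.card_eq_finsetCard]
  exact Nat.card_congr (Equiv.subtypeEquivRight fun f => by simp)

end Words

section Linked

variable {V : Type*}

/-- `x` and `y` are in the same component of the graph whose edges are the letters of `l`. -/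
def Linked (l : List (V × V)) : V → V → Prop :=
  Relation.EqvGen fun x y => (x, y) ∈ l

theorem linked_refl (l : List (V × V)) (x : V) : Linked l x x := Relation.EqvGen.refl x

theorem Linked.symm {l : List (V × V)} {x y : V} (h : Linked l x y) : Linked l y x :=
  Relation.EqvGen.symm _ _ h

theorem Linked.trans {l : List (V × V)} {x y z : V} (h : Linked l x y) (h' : Linked l y z) :
    Linked l x z := Relation.EqvGen.trans _ _ _ h h'

theorem Linked.mono {l l' : List (V × V)} (hl : l ⊆ l') {x y : V} (h : Linked l x y) :
    Linked l' x y := Relation.EqvGen.mono (fun _ _ h => hl h) _ _ h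

theorem Linked.mem_iff {l : List (V × V)} {B : Finset V} (hB : ∀ e ∈ l, e.1 ∈ B ↔ e.2 ∈ B)
    {x y : V} (h : Linked l x y) : x ∈ B ↔ y ∈ B := by
  induction h with
  | rel x y h => exact hB _ h
  | refl => rfl
  | symm _ _ _ ih => exact ih.symm
  | trans _ _ _ _ _ h1 h2 => exact h1.trans h2

/-- Adding the edge `{a, b}` joins the components of `a` and `b`. -/
theorem linked_cons {l : List (V × V)} {a b x y : V} (h : Linked ((a, b) :: l) x y) :
    Linked l x y ∨ (Linked l a x ∨ Linked l b x) ∧ (Linked l a y ∨ Linked l b y) := by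
  induction h with
  | rel x y h =>
    rcases List.mem_cons.1 h with h | h
    · obtain ⟨rfl, rfl⟩ := Prod.mk.inj h
      exact Or.inr ⟨Or.inl (linked_refl _ _), Or.inr (linked_refl _ _)⟩
    · exact Or.inl (Relation.EqvGen.rel _ _ h)
  | refl x => exact Or.inl (linked_refl _ _)
  | symm x y _ ih => exact ih.imp Linked.symm And.symm
  | trans x y z _ _ h1 h2 =>
    rcases h1 with h1 | ⟨h1, h1'⟩
    · rcases h2 with h2 | ⟨h2, h2'⟩
      · exact Or.inl (h1.trans h2)
      · exact Or.inr ⟨h2.imp (·.trans h1.symm) (·.trans h1.symm), h2'⟩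
    · rcases h2 with h2 | ⟨h2, h2'⟩
      · exact Or.inr ⟨h1, h1'.imp (·.trans h2) (·.trans h2)⟩
      · exact Or.inr ⟨h1, h2'⟩

variable [DecidableEq V]

/-- If all letters lie in one of two disjoint sets, then components do not leave these sets. -/
theorem Linked.filter {l : List (V × V)} {B C : Finset V} (hBC : Disjoint B C)
    (hl : ∀ e ∈ l, e ∈ B.offDiag ∪ C.offDiag) {x y : V} (h : Linked l x y) :
    (x ∈ B ↔ y ∈ B) ∧ (x ∈ B → Linked (l.filter (· ∈ B.offDiag)) x y) := by
  induction h with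
  | rel x y h =>
    have h1 := hl _ h
    simp only [Finset.mem_union, Finset.mem_offDiag] at h1
    rcases h1 with h1 | h1
    · refine ⟨by tauto, fun _ => Relation.EqvGen.rel _ _ (List.mem_filter.2 ⟨h, ?_⟩)⟩
      simpa using h1
    · have hx : x ∉ B := Finset.disjoint_right.1 hBC h1.1
      have hy : y ∉ B := Finset.disjoint_right.1 hBC h1.2.1
      tauto
  | refl => exact ⟨Iff.rfl, fun _ => linked_refl _ _⟩
  | symm _ _ _ ih => exact ⟨ih.1.symm, fun h => (ih.2 (ih.1.2 h)).symm⟩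
  | trans _ _ _ _ _ h1 h2 =>
    exact ⟨h1.1.trans h2.1, fun h => (h1.2 h).trans (h2.2 (h1.1.1 h))⟩

/-- The product of the transpositions that are the letters of `l`. -/
def wordProd (l : List (V × V)) : Equiv.Perm V := (l.map fun e => Equiv.swap e.1 e.2).prod

theorem wordProd_cons_apply (e : V × V) (l : List (V × V)) (x : V) :
    wordProd (e :: l) x = Equiv.swap e.1 e.2 (wordProd l x) := by
  simp [wordProd]

theorem wordProd_filter {l : List (V × V)} {B C : Finset V} (hBC : Disjoint B C)
    (hl : ∀ e ∈ l, e ∈ B.offDiag ∪ C.offDiag) {x : V} (hx : x ∈ B) :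
    wordProd l x = wordProd (l.filter (· ∈ B.offDiag)) x ∧ wordProd l x ∈ B := by
  induction l with
  | nil => simpa [wordProd] using hx
  | cons e l ih =>
    obtain ⟨h1, h2⟩ := ih fun e he => hl e (List.mem_cons_of_mem _ he)
    rcases Finset.mem_union.1 (hl e List.mem_cons_self) with he | he
    · rw [List.filter_cons_of_pos (by simpa using he), wordProd_cons_apply, wordProd_cons_apply,
        ← h1]
      refine ⟨rfl, ?_⟩
      simp only [Finset.mem_offDiag] at he
      rw [Equiv.swap_apply_def]
      split_ifs <;> tauto
    · have he' : e ∉ B.offDiag := fun h => by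
        simp only [Finset.mem_offDiag] at h he
        exact Finset.disjoint_left.1 hBC h.1 he.1
      rw [List.filter_cons_of_neg (by simpa using he'), wordProd_cons_apply, ← h1,
        Equiv.swap_apply_of_ne_of_ne]
      · exact ⟨rfl, h2⟩
      all_goals
        rintro h
        simp only [Finset.mem_offDiag] at he
        rw [h] at h2
        first
        | exact Finset.disjoint_left.1 hBC h2 he.1
        | exact Finset.disjoint_left.1 hBC h2 he.2.1

/-- The word `l` is a factorisation of the restriction of `π` to `A` whose letters connect `A`. Only
the values of `π` on `A` matter, so a factorisation on a part of `A` needs no restricted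
permutation. For words in the pairs of elements of `A`, the condition forces `π` to preserve `A`. -/
def IsFact (A : Finset V) (π : Equiv.Perm V) (l : List (V × V)) : Prop :=
  (∀ x ∈ A, ∀ y ∈ A, Linked l x y) ∧ ∀ x ∈ A, wordProd l x = π x

/-- `l` splits into a connected factorisation on `B` and one on `A \ B`. -/
def IsSplit (A B : Finset V) (π : Equiv.Perm V) (l : List (V × V)) : Prop :=
  (∀ e ∈ l, e ∈ B.offDiag ∪ (A \ B).offDiag) ∧ IsFact B π (l.filter (· ∈ B.offDiag)) ∧
    IsFact (A \ B) π (l.filter (· ∈ (A \ B).offDiag))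

open Classical in
/-- The component of `a` in the graph on `A` whose edges are the letters of `l`. -/
def component (A : Finset V) (l : List (V × V)) (a : V) : Finset V :=
  A.filter (Linked l a)

theorem isFact_cons_iff {A : Finset V} {π : Equiv.Perm V} {a b : V} {l : List (V × V)}
    (ha : a ∈ A) :
    IsFact A π ((a, b) :: l) ↔ (∀ x ∈ A, Linked l a x ∨ Linked l b x) ∧
      ∀ x ∈ A, wordProd l x = (Equiv.swap a b * π) x := by
  refine and_congr ⟨fun h x hx => ?_, fun h => ?_⟩ ?_
  · rcases linked_cons (h a ha x hx) with h | h
    · exact Or.inl h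
    · exact h.2
  · have hab : Linked ((a, b) :: l) a b := Relation.EqvGen.rel _ _ List.mem_cons_self
    have : ∀ x ∈ A, Linked ((a, b) :: l) a x := fun x hx =>
      (h x hx).elim (·.mono (List.subset_cons_self _ _))
        fun h => hab.trans (h.mono (List.subset_cons_self _ _))
    exact fun x hx y hy => (this x hx).symm.trans (this y hy)
  · refine forall₂_congr fun x _ => ?_
    rw [wordProd_cons_apply, Equiv.Perm.mul_apply]
    constructor
    · rintro h; rw [← h, Equiv.swap_apply_self]
    · rintro h; rw [h, Equiv.swap_apply_self]

/-- If the factorisation `(a b) l` is connected and `l` does not link `a` and `b`, then `l` has the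
two components of `a` and `b`, and it splits accordingly. The component `B` is determined by `l`. -/
theorem isSplit_iff {A B : Finset V} {π : Equiv.Perm V} {a b : V} {l : List (V × V)}
    (hl : ∀ e ∈ l, e ∈ A.offDiag) (ha : a ∈ A) (hb : b ∈ A) (hB : B ⊆ A) :
    (a ∈ B ∧ b ∉ B) ∧ IsSplit A B (Equiv.swap a b * π) l ↔
      IsFact A π ((a, b) :: l) ∧ ¬ Linked l a b ∧ B = component A l a := by
  classical
  rw [isFact_cons_iff ha]
  constructor
  · rintro ⟨⟨haB, hbB⟩, h1, h2, h3⟩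
    have hbC : b ∈ A \ B := Finset.mem_sdiff.2 ⟨hb, hbB⟩
    have hlB : ∀ x ∈ B, Linked l a x := fun x hx =>
      (h2.1 a haB x hx).mono (List.filter_subset_self _)
    have hlC : ∀ x ∈ A \ B, Linked l b x := fun x hx =>
      (h3.1 b hbC x hx).mono (List.filter_subset_self _)
    refine ⟨⟨fun x hx => ?_, fun x hx => ?_⟩, fun h => ?_, ?_⟩
    · by_cases hxB : x ∈ B
      · exact Or.inl (hlB x hxB)
      · exact Or.inr (hlC x (Finset.mem_sdiff.2 ⟨hx, hxB⟩))
    · by_cases hxB : x ∈ B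
      · rw [(wordProd_filter Finset.disjoint_sdiff h1 hxB).1, h2.2 x hxB]
      · have hxC : x ∈ A \ B := Finset.mem_sdiff.2 ⟨hx, hxB⟩
        rw [(wordProd_filter Finset.sdiff_disjoint (by simpa [or_comm] using h1) hxC).1, h3.2 x hxC]
    · exact hbB ((h.filter Finset.disjoint_sdiff h1).1.1 haB)
    · ext x
      rw [component, Finset.mem_filter]
      exact ⟨fun hx => ⟨hB hx, hlB x hx⟩,
        fun hx => (hx.2.filter Finset.disjoint_sdiff h1).1.1 haB⟩
  · rintro ⟨⟨h1, h2⟩, h3, rfl⟩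
    have hBl : ∀ x, x ∈ component A l a ↔ x ∈ A ∧ Linked l a x := fun x => Finset.mem_filter
    have hCl : ∀ x, x ∈ A \ component A l a ↔ x ∈ A ∧ Linked l b x := by
      intro x
      rw [Finset.mem_sdiff, hBl]
      refine and_congr_right fun hx => ⟨fun h => (h1 x hx).resolve_left fun h' => h ⟨hx, h'⟩,
        fun h h' => h3 (h'.2.trans h.symm)⟩
    have hs : ∀ e ∈ l, e ∈ (component A l a).offDiag ∪ (A \ component A l a).offDiag := by
      rintro ⟨x, y⟩ he
      have hA := hl _ he
      have hxy : Linked l x y := Relation.EqvGen.rel _ _ he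
      simp only [Finset.mem_union, Finset.mem_offDiag, hBl, hCl] at hA ⊢
      rcases h1 x hA.1 with h | h
      · exact Or.inl ⟨⟨hA.1, h⟩, ⟨hA.2.1, h.trans hxy⟩, hA.2.2⟩
      · exact Or.inr ⟨⟨hA.1, h⟩, ⟨hA.2.1, h.trans hxy⟩, hA.2.2⟩
    have hs' : ∀ e ∈ l, e ∈ (A \ component A l a).offDiag ∪ (component A l a).offDiag := by
      simpa only [Finset.mem_union, or_comm] using hs
    refine ⟨⟨(hBl a).2 ⟨ha, linked_refl _ _⟩, fun h => h3 ((hBl b).1 h).2⟩, hs,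
      ⟨fun x hx y hy => ?_, fun x hx => ?_⟩, ⟨fun x hx y hy => ?_, fun x hx => ?_⟩⟩
    · exact ((((hBl x).1 hx).2.symm.trans ((hBl y).1 hy).2).filter Finset.disjoint_sdiff hs).2 hx
    · rw [← (wordProd_filter Finset.disjoint_sdiff hs hx).1, h2 x ((hBl x).1 hx).1]
    · exact ((((hCl x).1 hx).2.symm.trans ((hCl y).1 hy).2).filter
        Finset.sdiff_disjoint hs').2 hx
    · rw [← (wordProd_filter Finset.sdiff_disjoint hs' hx).1, h2 x ((hCl x).1 hx).1]

/-- If `l` links `a` and `b`, then the letter `(a, b)` is not needed for connectedness. -/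
theorem isFact_linked_iff {A : Finset V} {π : Equiv.Perm V} {a b : V} {l : List (V × V)}
    (ha : a ∈ A) (hb : b ∈ A) :
    IsFact A π ((a, b) :: l) ∧ Linked l a b ↔ IsFact A (Equiv.swap a b * π) l := by
  rw [isFact_cons_iff ha]
  constructor
  · rintro ⟨⟨h1, h2⟩, h3⟩
    have : ∀ x ∈ A, Linked l a x := fun x hx => (h1 x hx).elim id h3.trans
    exact ⟨fun x hx y hy => (this x hx).symm.trans (this y hy), h2⟩
  · rintro ⟨h1, h2⟩
    exact ⟨⟨fun x hx => Or.inl (h1 a ha x hx), h2⟩, h1 a ha b hb⟩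

open Classical in
/-- The number of words of length `j` in the pairs of distinct elements of `A` that are connected
factorisations of the restriction of `π` to `A`; each transposition is represented by two pairs. -/
def numFact (A : Finset V) (j : ℕ) (π : Equiv.Perm V) : ℕ :=
  wordSum A.offDiag j fun l => if IsFact A π l then 1 else 0

open Classical in
theorem wordSum_isSplit {A B : Finset V} (hB : B ⊆ A) (j : ℕ) (π : Equiv.Perm V) :
    wordSum A.offDiag j (fun l => if IsSplit A B π l then 1 else 0) =
      ∑ p ∈ Finset.HasAntidiagonal.antidiagonal j,
        j.choose p.1 * (numFact B p.1 π * numFact (A \ B) p.2 π) := by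
  have hd : Disjoint B.offDiag (A \ B).offDiag := by
    rw [Finset.disjoint_left]
    intro e h h'
    simp only [Finset.mem_offDiag, Finset.mem_sdiff] at h h'
    exact h'.1.2 h.1
  have hsub : B.offDiag ∪ (A \ B).offDiag ⊆ A.offDiag :=
    Finset.union_subset (Finset.offDiag_mono hB) (Finset.offDiag_mono Finset.sdiff_subset)
  simp only [numFact]
  rw [← wordSum_shuffle hd, ← wordSum_subset hsub]
  refine wordSum_congr fun l _ _ => ?_
  unfold IsSplit
  split_ifs <;> simp_all

open Classical in
/-- Removing the first transposition from a connected factorisation leaves either a connected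
factorisation or a shuffle of two. -/
theorem numFact_succ (A : Finset V) (j : ℕ) (π : Equiv.Perm V) :
    numFact A (j + 1) π = ∑ e ∈ A.offDiag, (numFact A j (Equiv.swap e.1 e.2 * π) +
      ∑ B ∈ A.powerset with e.1 ∈ B ∧ e.2 ∉ B,
        ∑ p ∈ Finset.HasAntidiagonal.antidiagonal j, j.choose p.1 *
        (numFact B p.1 (Equiv.swap e.1 e.2 * π) *
          numFact (A \ B) p.2 (Equiv.swap e.1 e.2 * π))) := by
  rw [numFact, wordSum]
  refine Finset.sum_congr rfl fun ⟨a, b⟩ he => ?_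
  simp only [Finset.mem_offDiag] at he
  obtain ⟨ha, hb, hab⟩ := he
  rw [Finset.sum_congr rfl fun B hB => (wordSum_isSplit
    (Finset.mem_powerset.1 (Finset.mem_filter.1 hB).1) j (Equiv.swap a b * π)).symm,
    ← wordSum_sum, numFact, ← wordSum_add]
  refine wordSum_congr fun l _ hl => ?_
  have hsplit : ∑ B ∈ A.powerset with a ∈ B ∧ b ∉ B,
      (if IsSplit A B (Equiv.swap a b * π) l then 1 else 0) =
      if IsFact A π ((a, b) :: l) ∧ ¬ Linked l a b then 1 else 0 := by
    rw [Finset.sum_filter]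
    have : ∀ B ∈ A.powerset, (if a ∈ B ∧ b ∉ B then
        if IsSplit A B (Equiv.swap a b * π) l then 1 else 0 else 0) =
        if B = component A l a then
          if IsFact A π ((a, b) :: l) ∧ ¬ Linked l a b then 1 else 0 else 0 := by
      intro B hB
      have := isSplit_iff (π := π) hl ha hb (Finset.mem_powerset.1 hB)
      rw [← ite_and, ← ite_and]
      exact if_congr (by rw [this]; tauto) rfl rfl
    rw [Finset.sum_congr rfl this, Finset.sum_ite_eq', if_pos]
    exact Finset.mem_powerset.2 (Finset.filter_subset _ _)
  rw [hsplit, ← if_congr (isFact_linked_iff (π := π) (l := l) ha hb) rfl rfl]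
  by_cases h : IsFact A π ((a, b) :: l) <;> by_cases h' : Linked l a b <;> simp [h, h']

end Linked

/-! ### Cycles and multiplication by a transposition -/

section Cycles

variable {V : Type*} [Fintype V]

open Classical in
/-- The cycle of `π` through `x`, as a set of points; it is `{x}` if `x` is a fixed point. -/
def cyc (π : Equiv.Perm V) (x : V) : Finset V := Finset.univ.filter (π.SameCycle x)

theorem mem_cyc {π : Equiv.Perm V} {x y : V} : y ∈ cyc π x ↔ π.SameCycle x y := by
  simp [cyc]

theorem self_mem_cyc (π : Equiv.Perm V) (x : V) : x ∈ cyc π x :=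
  mem_cyc.2 (Equiv.Perm.SameCycle.refl _ _)

theorem cyc_eq_iff {π : Equiv.Perm V} {x y : V} : cyc π x = cyc π y ↔ π.SameCycle x y := by
  constructor
  · intro h; exact mem_cyc.1 (h ▸ self_mem_cyc π y)
  · intro h; ext z; rw [mem_cyc, mem_cyc]
    exact ⟨h.symm.trans, h.trans⟩

theorem cyc_pos (π : Equiv.Perm V) (x : V) : 0 < (cyc π x).card :=
  Finset.card_pos.2 ⟨x, self_mem_cyc π x⟩

theorem cyc_subset {A : Finset V} {π : Equiv.Perm V} (hA : ∀ x ∈ A, π x ∈ A) {x : V}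
    (hx : x ∈ A) : cyc π x ⊆ A := by
  intro y hy
  obtain ⟨n, rfl⟩ := (mem_cyc.1 hy).exists_nat_pow_eq
  clear hy
  induction n with
  | zero => simpa using hx
  | succ n ih => rw [pow_succ', Equiv.Perm.mul_apply]; exact hA _ ih

theorem cyc_eq_image [DecidableEq V] {π : Equiv.Perm V} {x : V} {k : ℕ} (hk : 0 < k)
    (h : (π ^ k) x = x) : cyc π x = (Finset.range k).image fun i => (π ^ i) x := by
  ext y
  simp only [mem_cyc, Finset.mem_image, Finset.mem_range]
  constructor
  · intro hy
    obtain ⟨n, rfl⟩ := hy.exists_nat_pow_eq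
    refine ⟨n % k, Nat.mod_lt _ hk, ?_⟩
    conv_rhs => rw [← Nat.mod_add_div n k, pow_add, pow_mul, Equiv.Perm.mul_apply]
    rw [Equiv.Perm.pow_apply_eq_self_of_apply_eq_self h]
  · rintro ⟨i, _, rfl⟩
    exact ⟨i, by simp⟩

/-- The length of the cycle of `x` is the least period of `x`. -/
theorem card_cyc_spec (π : Equiv.Perm V) (x : V) :
    (π ^ (cyc π x).card) x = x ∧
      ∀ i < (cyc π x).card, ∀ j < (cyc π x).card, (π ^ i) x = (π ^ j) x → i = j := by
  classical
  have hper : x ∈ Function.periodicPts π := by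
    obtain ⟨n, hn, h⟩ := isOfFinOrder_iff_pow_eq_one.1 (isOfFinOrder_of_finite π)
    refine ⟨n, hn, ?_⟩
    rw [Function.IsPeriodicPt, Function.IsFixedPt, ← Equiv.Perm.coe_pow, h]; rfl
  have hpos := Function.minimalPeriod_pos_of_mem_periodicPts hper
  have h1 : (π ^ Function.minimalPeriod π x) x = x := by
    rw [Equiv.Perm.coe_pow]; exact Function.iterate_minimalPeriod
  have h2 : ∀ i < Function.minimalPeriod π x, ∀ j < Function.minimalPeriod π x,
      (π ^ i) x = (π ^ j) x → i = j := by
    intro i hi j hj h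
    rw [Equiv.Perm.coe_pow, Equiv.Perm.coe_pow] at h
    exact Function.iterate_injOn_Iio_minimalPeriod hi hj h
  have : (cyc π x).card = Function.minimalPeriod π x := by
    rw [cyc_eq_image hpos h1, Finset.card_image_of_injOn, Finset.card_range]
    intro i hi j hj h
    exact h2 i (by simpa using hi) j (by simpa using hj) h
  rw [this]
  exact ⟨h1, h2⟩

variable [DecidableEq V]

omit [Fintype V] in
/-- As long as the orbit of `a` under `π` avoids `a` and `b`, it is not changed by `(a b)`. -/
theorem pow_swap_mul_apply {π : Equiv.Perm V} {a b : V} (s : ℕ)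
    (h : ∀ i, 0 < i → i ≤ s → (π ^ i) a ≠ a ∧ (π ^ i) a ≠ b) :
    ∀ i ≤ s, ((Equiv.swap a b * π) ^ i) a = (π ^ i) a := by
  intro i
  induction i with
  | zero => simp
  | succ i ih =>
    intro hi
    rw [pow_succ', Equiv.Perm.mul_apply, ih (by omega), Equiv.Perm.mul_apply,
      ← Equiv.Perm.mul_apply π, ← pow_succ']
    exact Equiv.swap_apply_of_ne_of_ne (h _ (by omega) hi).1 (h _ (by omega) hi).2

theorem sameCycle_swap_mul {π : Equiv.Perm V} {a b : V} (hab : ¬ π.SameCycle a b) :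
    (Equiv.swap a b * π).SameCycle a b := by
  obtain ⟨h1, h2⟩ := card_cyc_spec π a
  obtain ⟨k, hk⟩ : ∃ k, (cyc π a).card = k + 1 :=
    ⟨(cyc π a).card - 1, by have := cyc_pos π a; omega⟩
  rw [hk] at h1 h2
  have h3 := pow_swap_mul_apply (π := π) (a := a) (b := b) k (fun i hi hik => ⟨fun h => ?_, fun h =>
    hab ⟨i, by simpa using h⟩⟩) k le_rfl
  · refine ⟨(k + 1 : ℕ), ?_⟩
    rw [zpow_natCast, pow_succ', Equiv.Perm.mul_apply, h3, Equiv.Perm.mul_apply,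
      ← Equiv.Perm.mul_apply π, ← pow_succ', h1, Equiv.swap_apply_left]
  · have := h2 i (by omega) 0 (by omega) (by simpa using h)
    omega

/-- Multiplying by a transposition of points in different cycles joins these cycles. -/
theorem sameCycle_join {π : Equiv.Perm V} {a b : V} (hab : ¬ π.SameCycle a b) (x y : V) :
    (Equiv.swap a b * π).SameCycle x y ↔
      π.SameCycle x y ∨ x ∈ cyc π a ∪ cyc π b ∧ y ∈ cyc π a ∪ cyc π b := by
  have hs := sameCycle_swap_mul hab
  have step : ∀ x, (Equiv.swap a b * π).SameCycle x (π x) := by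
    intro x
    have h0 : (Equiv.swap a b * π).SameCycle x ((Equiv.swap a b * π) x) :=
      Equiv.Perm.sameCycle_apply_right.2 (Equiv.Perm.SameCycle.refl _ _)
    rw [Equiv.Perm.mul_apply, Equiv.swap_apply_def] at h0
    split_ifs at h0 with h1 h2
    · rw [h1]; exact h0.trans hs.symm
    · rw [h2]; exact h0.trans hs
    · exact h0
  have mono : ∀ x y, π.SameCycle x y → (Equiv.swap a b * π).SameCycle x y := by
    intro x y h
    obtain ⟨n, rfl⟩ := h.exists_nat_pow_eq
    clear h
    induction n with
    | zero => exact Equiv.Perm.SameCycle.refl _ _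
    | succ n ih => rw [pow_succ', Equiv.Perm.mul_apply]; exact ih.trans (step _)
  have toa : ∀ x ∈ cyc π a ∪ cyc π b, (Equiv.swap a b * π).SameCycle a x := by
    intro x hx
    rcases Finset.mem_union.1 hx with h | h
    · exact mono _ _ (mem_cyc.1 h)
    · exact hs.trans (mono _ _ (mem_cyc.1 h))
  constructor
  · intro h
    obtain ⟨n, rfl⟩ := h.exists_nat_pow_eq
    clear h
    induction n with
    | zero => exact Or.inl (Equiv.Perm.SameCycle.refl _ _)
    | succ n ih =>
      rw [pow_succ', Equiv.Perm.mul_apply, Equiv.Perm.mul_apply]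
      generalize ((Equiv.swap a b * π) ^ n) x = z at ih
      have hz : π.SameCycle z (Equiv.swap a b (π z)) ∨ z ∈ cyc π a ∪ cyc π b ∧
          Equiv.swap a b (π z) ∈ cyc π a ∪ cyc π b := by
        have h0 : π.SameCycle z (π z) :=
          Equiv.Perm.sameCycle_apply_right.2 (Equiv.Perm.SameCycle.refl _ _)
        rw [Equiv.swap_apply_def]
        simp only [Finset.mem_union, mem_cyc]
        split_ifs with h1 h2
        · rw [h1] at h0
          exact Or.inr ⟨Or.inl h0.symm, Or.inr (Equiv.Perm.SameCycle.refl _ _)⟩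
        · rw [h2] at h0
          exact Or.inr ⟨Or.inr h0.symm, Or.inl (Equiv.Perm.SameCycle.refl _ _)⟩
        · exact Or.inl h0
      have tr : ∀ u v, π.SameCycle u v → (u ∈ cyc π a ∪ cyc π b ↔ v ∈ cyc π a ∪ cyc π b) := by
        intro u v h
        simp only [Finset.mem_union, mem_cyc]
        exact ⟨fun h' => h'.imp (·.trans h) (·.trans h),
          fun h' => h'.imp (·.trans h.symm) (·.trans h.symm)⟩
      rcases ih with ih | ih
      · rcases hz with hz | hz
        · exact Or.inl (ih.trans hz)
        · exact Or.inr ⟨(tr _ _ ih).2 hz.1, hz.2⟩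
      · rcases hz with hz | hz
        · exact Or.inr ⟨ih.1, (tr _ _ hz).1 ih.2⟩
        · exact Or.inr ⟨ih.1, hz.2⟩
  · rintro (h | h)
    · exact mono _ _ h
    · exact (toa _ h.1).symm.trans (toa _ h.2)

theorem cyc_join_of_mem {π : Equiv.Perm V} {a b x : V} (hab : ¬ π.SameCycle a b)
    (hx : x ∈ cyc π a ∪ cyc π b) : cyc (Equiv.swap a b * π) x = cyc π a ∪ cyc π b := by
  ext y
  rw [mem_cyc, sameCycle_join hab]
  constructor
  · rintro (h | h)
    · simp only [Finset.mem_union, mem_cyc] at hx ⊢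
      exact hx.imp (·.trans h) (·.trans h)
    · exact h.2
  · exact fun h => Or.inr ⟨hx, h⟩

theorem cyc_join_of_notMem {π : Equiv.Perm V} {a b x : V} (hab : ¬ π.SameCycle a b)
    (hx : x ∉ cyc π a ∪ cyc π b) : cyc (Equiv.swap a b * π) x = cyc π x := by
  ext y
  rw [mem_cyc, sameCycle_join hab, mem_cyc]
  tauto

/-- Multiplying by a transposition of two points `a` and `π ^ r a` of one cycle cuts off a cycle
of length `r` through `a`. -/
theorem card_cyc_cut {π : Equiv.Perm V} {a : V} {r : ℕ} (hr : 0 < r) (hrk : r < (cyc π a).card) :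
    ¬ (Equiv.swap a ((π ^ r) a) * π).SameCycle a ((π ^ r) a) ∧
      (cyc (Equiv.swap a ((π ^ r) a) * π) a).card = r := by
  obtain ⟨h1, h2⟩ := card_cyc_spec π a
  have h3 := pow_swap_mul_apply (π := π) (a := a) (b := (π ^ r) a) (r - 1) (fun i hi hik =>
    ⟨fun h => by have := h2 i (by omega) 0 (by omega) (by simpa using h); omega,
      fun h => by have := h2 i (by omega) r (by omega) h; omega⟩)
  have h4 : ((Equiv.swap a ((π ^ r) a) * π) ^ r) a = a := by
    obtain ⟨s, rfl⟩ : ∃ s, r = s + 1 := ⟨r - 1, by omega⟩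
    rw [pow_succ' (Equiv.swap _ _ * π), Equiv.Perm.mul_apply, h3 s (by omega),
      Equiv.Perm.mul_apply, ← Equiv.Perm.mul_apply π, ← pow_succ', Equiv.swap_apply_right]
  have h5 := cyc_eq_image hr h4
  have h6 : (Finset.range r).image (fun i => ((Equiv.swap a ((π ^ r) a) * π) ^ i) a) =
      (Finset.range r).image (fun i => (π ^ i) a) :=
    Finset.image_congr fun i hi => h3 i (by have : i < r := by simpa using hi
                                            omega)
  rw [h6] at h5
  constructor
  · rw [← mem_cyc, h5]
    intro h
    obtain ⟨i, hi, h⟩ := Finset.mem_image.1 h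
    have hi' := Finset.mem_range.1 hi
    have := h2 i (by omega) r hrk h
    omega
  · rw [h5, Finset.card_image_of_injOn, Finset.card_range]
    intro i hi j hj h
    have hi' : i < r := by simpa using hi
    have hj' : j < r := by simpa using hj
    exact h2 i (by omega) j (by omega) h

/-- The set of cycles of `π` on `A`. It is used for sets `A` that `π` preserves; fixed points count
as cycles. -/
def cycles (A : Finset V) (π : Equiv.Perm V) : Finset (Finset V) := A.image (cyc π)

theorem cyc_mem_cycles {A : Finset V} (π : Equiv.Perm V) {x : V} (hx : x ∈ A) :
    cyc π x ∈ cycles A π := Finset.mem_image_of_mem _ hx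

theorem cyc_eq_of_mem_cycles {A : Finset V} {π : Equiv.Perm V} {C : Finset V}
    (hC : C ∈ cycles A π) {x : V} (hx : x ∈ C) : cyc π x = C := by
  obtain ⟨y, _, rfl⟩ := Finset.mem_image.1 hC
  exact (cyc_eq_iff.2 (mem_cyc.1 hx)).symm

theorem nonempty_of_mem_cycles {A : Finset V} {π : Equiv.Perm V} {C : Finset V}
    (hC : C ∈ cycles A π) : C.Nonempty := by
  obtain ⟨y, _, rfl⟩ := Finset.mem_image.1 hC
  exact ⟨y, self_mem_cyc π y⟩

theorem subset_of_mem_cycles {A : Finset V} {π : Equiv.Perm V} (hA : ∀ x ∈ A, π x ∈ A)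
    {C : Finset V} (hC : C ∈ cycles A π) : C ⊆ A := by
  obtain ⟨y, hy, rfl⟩ := Finset.mem_image.1 hC
  exact cyc_subset hA hy

theorem sum_cycles {M : Type*} [AddCommMonoid M] {A : Finset V} {π : Equiv.Perm V}
    (hA : ∀ x ∈ A, π x ∈ A) (F : V → M) :
    ∑ C ∈ cycles A π, ∑ x ∈ C, F x = ∑ x ∈ A, F x := by
  rw [← Finset.sum_fiberwise_of_maps_to (fun x hx => cyc_mem_cycles π hx) F]
  refine Finset.sum_congr rfl fun C hC => Finset.sum_congr ?_ fun _ _ => rfl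
  ext x
  rw [Finset.mem_filter]
  constructor
  · exact fun h => ⟨subset_of_mem_cycles hA hC h, cyc_eq_of_mem_cycles hC h⟩
  · rintro ⟨_, rfl⟩; exact self_mem_cyc π x

theorem sum_card_cycles {A : Finset V} {π : Equiv.Perm V} (hA : ∀ x ∈ A, π x ∈ A) :
    ∑ C ∈ cycles A π, C.card = A.card := by
  simpa only [Finset.card_eq_sum_ones] using sum_cycles hA (fun _ => 1)

/-- On the level of sets of cycles, the cycles of `a` and `b` are replaced by their union. -/
theorem cycles_join {A : Finset V} {π : Equiv.Perm V} {a b : V}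
    (ha : a ∈ A) (hab : ¬ π.SameCycle a b) :
    cycles A (Equiv.swap a b * π) =
      insert (cyc π a ∪ cyc π b) (((cycles A π).erase (cyc π a)).erase (cyc π b)) := by
  have hm : ∀ x, x ∉ cyc π a ∪ cyc π b ↔ cyc π x ≠ cyc π b ∧ cyc π x ≠ cyc π a := by
    intro x
    simp only [Finset.mem_union, mem_cyc, ne_eq, cyc_eq_iff, not_or, and_comm,
      Equiv.Perm.sameCycle_comm (f := π) (x := x)]
  ext C
  simp only [Finset.mem_insert, Finset.mem_erase, cycles, Finset.mem_image]
  constructor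
  · rintro ⟨x, hx, rfl⟩
    by_cases h : x ∈ cyc π a ∪ cyc π b
    · exact Or.inl (cyc_join_of_mem hab h)
    · rw [cyc_join_of_notMem hab h]
      exact Or.inr ⟨((hm x).1 h).1, ((hm x).1 h).2, x, hx, rfl⟩
  · rintro (rfl | ⟨h1, h2, x, hx, rfl⟩)
    · exact ⟨a, ha, cyc_join_of_mem hab (Finset.mem_union_left _ (self_mem_cyc π a))⟩
    · exact ⟨x, hx, cyc_join_of_notMem hab ((hm x).2 ⟨h1, h2⟩)⟩

theorem union_notMem_cycles {A : Finset V} {π : Equiv.Perm V} {a b : V}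
    (hab : ¬ π.SameCycle a b) : cyc π a ∪ cyc π b ∉ cycles A π := by
  intro h
  have h1 := cyc_eq_of_mem_cycles h (Finset.mem_union_left _ (self_mem_cyc π a))
  have h2 := cyc_eq_of_mem_cycles h (Finset.mem_union_right _ (self_mem_cyc π b))
  exact hab (cyc_eq_iff.1 (h1.trans h2.symm))

theorem card_cycles_join {A : Finset V} {π : Equiv.Perm V} {a b : V}
    (ha : a ∈ A) (hb : b ∈ A) (hab : ¬ π.SameCycle a b) :
    (cycles A (Equiv.swap a b * π)).card + 1 = (cycles A π).card := by
  have hne : cyc π b ≠ cyc π a := fun h => hab (cyc_eq_iff.1 h.symm)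
  have h1 : cyc π b ∈ (cycles A π).erase (cyc π a) :=
    Finset.mem_erase.2 ⟨hne, cyc_mem_cycles π hb⟩
  rw [cycles_join ha hab, Finset.card_insert_of_notMem, Finset.card_erase_add_one h1,
    Finset.card_erase_add_one (cyc_mem_cycles π ha)]
  exact fun h => union_notMem_cycles hab (Finset.mem_of_mem_erase (Finset.mem_of_mem_erase h))

theorem card_union_cyc {π : Equiv.Perm V} {a b : V} (hab : ¬ π.SameCycle a b) :
    (cyc π a ∪ cyc π b).card = (cyc π a).card + (cyc π b).card := by
  refine Finset.card_union_of_disjoint (Finset.disjoint_left.2 fun x h1 h2 => hab ?_)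
  exact (mem_cyc.1 h1).trans (mem_cyc.1 h2).symm

theorem exists_pow_of_mem_cyc {π : Equiv.Perm V} {a b : V} (hb : b ∈ cyc π a) (hab : a ≠ b) :
    ∃ r, 0 < r ∧ r < (cyc π a).card ∧ b = (π ^ r) a := by
  rw [cyc_eq_image (cyc_pos π a) (card_cyc_spec π a).1] at hb
  obtain ⟨r, hr, rfl⟩ := Finset.mem_image.1 hb
  refine ⟨r, Nat.pos_of_ne_zero ?_, Finset.mem_range.1 hr, rfl⟩
  rintro rfl
  exact hab (by simp)

theorem not_sameCycle_swap_mul {π : Equiv.Perm V} {a b : V} (hb : π.SameCycle a b) (hab : a ≠ b) :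
    ¬ (Equiv.swap a b * π).SameCycle a b := by
  obtain ⟨r, hr, hrk, rfl⟩ := exists_pow_of_mem_cyc (mem_cyc.2 hb) hab
  exact (card_cyc_cut hr hrk).1

omit [Fintype V] in
theorem swap_mul_mem {A : Finset V} {π : Equiv.Perm V} (hA : ∀ x ∈ A, π x ∈ A) {a b : V}
    (ha : a ∈ A) (hb : b ∈ A) : ∀ x ∈ A, (Equiv.swap a b * π) x ∈ A := by
  intro x hx
  rw [Equiv.Perm.mul_apply, Equiv.swap_apply_def]
  split_ifs
  exacts [hb, ha, hA x hx]

theorem sdiff_mem {A B : Finset V} {π : Equiv.Perm V} (hA : ∀ x ∈ A, π x ∈ A)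
    (hB : ∀ x ∈ B, π x ∈ B) : ∀ x ∈ A \ B, π x ∈ A \ B := by
  intro x hx
  rw [Finset.mem_sdiff] at hx ⊢
  refine ⟨hA x hx.1, fun h => hx.2 ?_⟩
  refine cyc_subset hB h (mem_cyc.2 ?_)
  exact Equiv.Perm.sameCycle_apply_left.2 (Equiv.Perm.SameCycle.refl _ _)

theorem disjoint_cycles {A B : Finset V} {π : Equiv.Perm V}
    (hB : ∀ x ∈ B, π x ∈ B) : Disjoint (cycles B π) (cycles (A \ B) π) := by
  rw [Finset.disjoint_left]
  intro C h h'
  obtain ⟨x, hx, rfl⟩ := Finset.mem_image.1 h'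
  exact (Finset.mem_sdiff.1 hx).2 (subset_of_mem_cycles hB h (self_mem_cyc π x))

theorem cycles_union {A B : Finset V} (π : Equiv.Perm V) (hBA : B ⊆ A) :
    cycles B π ∪ cycles (A \ B) π = cycles A π := by
  rw [cycles, cycles, cycles, ← Finset.image_union, Finset.union_sdiff_of_subset hBA]

theorem card_cycles_add {A B : Finset V} {π : Equiv.Perm V} (hBA : B ⊆ A)
    (hB : ∀ x ∈ B, π x ∈ B) :
    (cycles B π).card + (cycles (A \ B) π).card = (cycles A π).card := by
  rw [← cycles_union π hBA, Finset.card_union_of_disjoint (disjoint_cycles hB)]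

/-- Invariant sets `B` that contain `a` but not `b` correspond to the sets `S` of cycles other than
those of `a` and `b`: `B` is the union of the cycle of `a` and the cycles in `S`. -/
theorem sum_invariant_subsets {M : Type*} [AddCommMonoid M] {A : Finset V} {π : Equiv.Perm V}
    (hA : ∀ x ∈ A, π x ∈ A) {a b : V} (ha : a ∈ A) (hb : b ∈ A) (hab : ¬ π.SameCycle a b)
    (F : Finset (Finset V) → Finset (Finset V) → M) :
    ∑ B ∈ A.powerset with (a ∈ B ∧ b ∉ B) ∧ ∀ x ∈ B, π x ∈ B,
        F (cycles B π) (cycles (A \ B) π) =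
      ∑ S ∈ (((cycles A π).erase (cyc π a)).erase (cyc π b)).powerset,
        F (insert (cyc π a) S)
          (insert (cyc π b) (((cycles A π).erase (cyc π a)).erase (cyc π b) \ S)) := by
  set R := ((cycles A π).erase (cyc π a)).erase (cyc π b) with hR
  have hRmem : ∀ C, C ∈ R ↔ C ≠ cyc π b ∧ C ≠ cyc π a ∧ C ∈ cycles A π := by
    intro C; rw [hR, Finset.mem_erase, Finset.mem_erase]
  have hmem : ∀ {S : Finset (Finset V)}, S ⊆ R → ∀ x, x ∈ cyc π a ∪ S.biUnion id ↔
      x ∈ A ∧ cyc π x ∈ insert (cyc π a) S := by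
    intro S hS x
    rw [Finset.mem_union, Finset.mem_biUnion, Finset.mem_insert]
    constructor
    · rintro (h | ⟨C, hC, hx⟩)
      · exact ⟨cyc_subset hA ha h, Or.inl (cyc_eq_iff.2 (mem_cyc.1 h).symm)⟩
      · have hC' := ((hRmem C).1 (hS hC)).2.2
        refine ⟨subset_of_mem_cycles hA hC' hx, Or.inr ?_⟩
        rwa [cyc_eq_of_mem_cycles hC' hx]
    · rintro ⟨_, h | h⟩
      · exact Or.inl (h ▸ self_mem_cyc π x)
      · exact Or.inr ⟨_, h, self_mem_cyc π x⟩
  have hba : cyc π b ≠ cyc π a := fun h => hab (cyc_eq_iff.1 h.symm)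
  have hcyc : ∀ {S : Finset (Finset V)}, S ⊆ R →
      cycles (cyc π a ∪ S.biUnion id) π = insert (cyc π a) S := by
    intro S hS
    ext C
    rw [cycles, Finset.mem_image]
    constructor
    · rintro ⟨x, hx, rfl⟩
      exact ((hmem hS x).1 hx).2
    · intro hC
      have hCA : C ∈ cycles A π := by
        rcases Finset.mem_insert.1 hC with rfl | h
        · exact cyc_mem_cycles π ha
        · exact ((hRmem C).1 (hS h)).2.2
      obtain ⟨x, hx, rfl⟩ := Finset.mem_image.1 hCA
      exact ⟨x, (hmem hS x).2 ⟨hx, hC⟩, rfl⟩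
  have hcyc' : ∀ {S : Finset (Finset V)}, S ⊆ R →
      cycles (A \ (cyc π a ∪ S.biUnion id)) π = insert (cyc π b) (R \ S) := by
    intro S hS
    ext C
    simp only [cycles, Finset.mem_image, Finset.mem_sdiff, Finset.mem_insert, hRmem]
    constructor
    · rintro ⟨x, ⟨hxA, hx⟩, rfl⟩
      rw [hmem hS, Finset.mem_insert] at hx
      have := cyc_mem_cycles π hxA
      tauto
    · intro hC
      have hCA : C ∈ cycles A π := by
        rcases hC with rfl | h
        · exact cyc_mem_cycles π hb
        · exact Finset.mem_image.2 h.1.2.2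
      obtain ⟨x, hx, rfl⟩ := Finset.mem_image.1 hCA
      refine ⟨x, ⟨hx, ?_⟩, rfl⟩
      rw [hmem hS, Finset.mem_insert]
      rintro ⟨-, h | h⟩
      · rcases hC with h' | h'
        · exact hba (h'.symm.trans h)
        · exact h'.1.2.1 h
      · rcases hC with h' | h'
        · exact ((hRmem _).1 (hS h)).1 h'
        · exact h'.2 h
  symm
  refine Finset.sum_bij' (fun S _ => cyc π a ∪ S.biUnion id)
    (fun B _ => (cycles B π).erase (cyc π a)) ?_ ?_ ?_ ?_ ?_
  · intro S hS
    rw [Finset.mem_powerset] at hS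
    rw [Finset.mem_filter, Finset.mem_powerset]
    refine ⟨fun x hx => ((hmem hS x).1 hx).1,
      ⟨Finset.mem_union_left _ (self_mem_cyc π a), fun h => ?_⟩, fun x hx => ?_⟩
    · rcases Finset.mem_insert.1 ((hmem hS b).1 h).2 with h | h
      · exact hba h
      · exact ((hRmem _).1 (hS h)).1 rfl
    · rw [hmem hS] at hx ⊢
      have : cyc π (π x) = cyc π x := cyc_eq_iff.2
        (Equiv.Perm.sameCycle_apply_left.2 (Equiv.Perm.SameCycle.refl _ _))
      rw [this]
      exact ⟨hA x hx.1, hx.2⟩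
  · intro B hB
    obtain ⟨hBA, ⟨haB, hbB⟩, hB⟩ := Finset.mem_filter.1 hB
    rw [Finset.mem_powerset] at hBA ⊢
    intro C hC
    rw [Finset.mem_erase] at hC
    rw [hRmem]
    refine ⟨?_, hC.1, Finset.image_subset_image hBA hC.2⟩
    rintro rfl
    exact hbB (subset_of_mem_cycles hB hC.2 (self_mem_cyc π b))
  · intro S hS
    rw [Finset.mem_powerset] at hS
    show (cycles (cyc π a ∪ S.biUnion id) π).erase (cyc π a) = S
    rw [hcyc hS, Finset.erase_insert]
    exact fun h => ((hRmem _).1 (hS h)).2.1 rfl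
  · intro B hB
    obtain ⟨hBA, ⟨haB, hbB⟩, hB⟩ := Finset.mem_filter.1 hB
    ext x
    show x ∈ cyc π a ∪ ((cycles B π).erase (cyc π a)).biUnion id ↔ x ∈ B
    rw [Finset.mem_union, Finset.mem_biUnion]
    constructor
    · rintro (h | ⟨C, hC, hx⟩)
      · exact cyc_subset hB haB h
      · exact subset_of_mem_cycles hB (Finset.mem_of_mem_erase hC) hx
    · intro hx
      by_cases h : cyc π x = cyc π a
      · exact Or.inl (h ▸ self_mem_cyc π x)
      · exact Or.inr ⟨cyc π x, Finset.mem_erase.2 ⟨h, cyc_mem_cycles π hx⟩, self_mem_cyc π x⟩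
  · intro S hS
    rw [Finset.mem_powerset] at hS
    show _ = F (cycles (cyc π a ∪ S.biUnion id) π) (cycles (A \ (cyc π a ∪ S.biUnion id)) π)
    rw [hcyc hS, hcyc' hS]

end Cycles

/-! ### Hurwitz's formula -/

section Count

variable {V : Type*} [Fintype V] [DecidableEq V]

omit [Fintype V] in
theorem mem_of_numFact_ne_zero {A : Finset V} {j : ℕ} {π : Equiv.Perm V}
    (h : numFact A j π ≠ 0) : ∀ x ∈ A, π x ∈ A := by
  obtain ⟨l, -, hl, h⟩ := exists_of_wordSum_ne_zero h
  have h' : IsFact A π l := by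
    by_contra h'
    exact h (if_neg h')
  intro x hx
  rw [← h'.2 x hx]
  exact (wordProd_filter (Finset.disjoint_empty_right A)
    (fun e he => Finset.mem_union_left _ (hl e he)) hx).2

omit [DecidableEq V] in
theorem not_sameCycle_of_invariant {B : Finset V} {π : Equiv.Perm V} (hB : ∀ x ∈ B, π x ∈ B)
    {a b : V} (ha : a ∈ B) (hb : b ∉ B) : ¬ π.SameCycle a b :=
  fun h => hb (cyc_subset hB ha (mem_cyc.2 h))

omit [Fintype V] in
theorem swap_mul_swap_mul (π : Equiv.Perm V) (a b : V) :
    Equiv.swap a b * (Equiv.swap a b * π) = π := by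
  rw [← mul_assoc, Equiv.swap_mul_self, one_mul]

/-- The converse of `card_cycles_join`: if `a` and `b` are in different cycles of `(a b) π`, then
they are in one cycle of `π`, which `(a b)` cuts. -/
theorem card_cycles_cut {A : Finset V} {π : Equiv.Perm V} {a b : V} (ha : a ∈ A) (hb : b ∈ A)
    (hab : ¬ (Equiv.swap a b * π).SameCycle a b) :
    (cycles A π).card + 1 = (cycles A (Equiv.swap a b * π)).card := by
  have := card_cycles_join ha hb hab
  rwa [swap_mul_swap_mul] at this

/-- A connected factorisation has at least `n + m - 2` factors (its genus is nonnegative). By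
induction: a transposition changes the number of cycles by one, and it cuts a cycle if the rest of
the factorisation is not connected. -/
theorem card_add_card_cycles_le (j : ℕ) : ∀ (A : Finset V) (π : Equiv.Perm V),
    numFact A j π ≠ 0 → A.card + (cycles A π).card ≤ j + 2 := by
  induction j using Nat.strong_induction_on with
  | _ j ih =>
    intro A π h
    have hcA : (cycles A π).card ≤ A.card := Finset.card_image_le
    rcases j with _ | j
    · obtain ⟨l, hl, -, h⟩ := exists_of_wordSum_ne_zero h
      rw [List.length_eq_zero_iff] at hl
      subst hl
      have h' : IsFact A π [] := by
        by_contra h'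
        exact h (if_neg h')
      have hA : A.card ≤ 1 := by
        rw [Finset.card_le_one]
        intro x hx y hy
        have hB : ∀ e ∈ ([] : List (V × V)), e.1 ∈ ({x} : Finset V) ↔ e.2 ∈ ({x} : Finset V) := by
          simp
        have := (h'.1 x hx y hy).mem_iff hB
        simpa [eq_comm] using this
      omega
    · rw [numFact_succ] at h
      obtain ⟨⟨a, b⟩, he, h⟩ := Finset.exists_ne_zero_of_sum_ne_zero h
      obtain ⟨ha, hb, hab⟩ := Finset.mem_offDiag.1 he
      dsimp only at h ha hb hab
      by_cases h1 : numFact A j (Equiv.swap a b * π) = 0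
      · rw [h1, zero_add] at h
        obtain ⟨B, hB, h⟩ := Finset.exists_ne_zero_of_sum_ne_zero h
        obtain ⟨hBA, haB, hbB⟩ := Finset.mem_filter.1 hB
        rw [Finset.mem_powerset] at hBA
        obtain ⟨p, hp, h⟩ := Finset.exists_ne_zero_of_sum_ne_zero h
        have hp' := Finset.HasAntidiagonal.mem_antidiagonal.1 hp
        have h2 := right_ne_zero_of_mul h
        have h3 := left_ne_zero_of_mul h2
        have h4 := right_ne_zero_of_mul h2
        have hinv := mem_of_numFact_ne_zero h3
        have i1 := ih p.1 (by omega) _ _ h3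
        have i2 := ih p.2 (by omega) _ _ h4
        have e1 := card_cycles_add hBA hinv
        have e2 := Finset.card_sdiff_add_card_eq_card hBA
        have e3 := card_cycles_cut ha hb (not_sameCycle_of_invariant hinv haB hbB)
        omega
      · have i := ih j (by omega) _ _ h1
        by_cases hs : π.SameCycle a b
        · have := card_cycles_cut ha hb (not_sameCycle_swap_mul hs hab)
          omega
        · have := card_cycles_join ha hb hs
          omega

/-- The weight of the restriction of `π` to `A`. -/
def cycleWeight (A : Finset V) (π : Equiv.Perm V) : ℚ :=
  hurwitzWeight (cycles A π) Finset.card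

theorem sum_card_cycles_cast {A : Finset V} {π : Equiv.Perm V} (hA : ∀ x ∈ A, π x ∈ A) :
    ∑ C ∈ cycles A π, (C.card : ℚ) = A.card := by
  rw [← sum_card_cycles hA]; push_cast; rfl

theorem sum_comp_cyc {A : Finset V} {π : Equiv.Perm V} (hA : ∀ x ∈ A, π x ∈ A)
    (F : Finset V → ℚ) : ∑ x ∈ A, F (cyc π x) = ∑ C ∈ cycles A π, C.card * F C := by
  rw [← sum_cycles hA]
  refine Finset.sum_congr rfl fun C hC => ?_
  rw [Finset.sum_congr rfl fun x hx => congrArg F (cyc_eq_of_mem_cycles hC hx), Finset.sum_const,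
    nsmul_eq_mul]

/-- The contribution of the pairs `(a, b)` whose transposition joins two cycles, as the first sum in
`hurwitzWeight_cut_join`. -/
theorem sum_join {A : Finset V} {π : Equiv.Perm V} (hA : ∀ x ∈ A, π x ∈ A) :
    ∑ e ∈ A.offDiag with ¬ π.SameCycle e.1 e.2, cycleWeight A (Equiv.swap e.1 e.2 * π) =
      ∑ p ∈ (cycles A π).offDiag, p.1.card * p.2.card *
        ((∑ C ∈ cycles A π, (C.card : ℚ)) ^ (((cycles A π).card : ℤ) - 4) *
        (((p.1.card + p.2.card : ℕ) : ℚ) * treeCoeff (p.1.card + p.2.card) *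
          ∏ C ∈ ((cycles A π).erase p.1).erase p.2, (C.card * treeCoeff C.card))) := by
  set D := cycles A π with hD
  set H : Finset V → Finset V → ℚ := fun C C' =>
    (∑ C ∈ D, (C.card : ℚ)) ^ ((D.card : ℤ) - 4) *
        (((C.card + C'.card : ℕ) : ℚ) * treeCoeff (C.card + C'.card) *
          ∏ C ∈ (D.erase C).erase C', (C.card * treeCoeff C.card)) with hH
  have h1 : ∀ a ∈ A, ∀ b ∈ A, ¬ π.SameCycle a b →
      cycleWeight A (Equiv.swap a b * π) = H (cyc π a) (cyc π b) := by
    intro a ha b hb hab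
    have hsum := sum_card_cycles_cast (swap_mul_mem hA ha hb)
    have hcard := card_cycles_join ha hb hab
    unfold cycleWeight hurwitzWeight
    simp only [hH]
    rw [hsum, sum_card_cycles_cast hA, hD, ← hcard, cycles_join ha hab, Finset.prod_insert,
      card_union_cyc hab]
    · congr 2
      push_cast; ring
    · exact fun h => union_notMem_cycles hab (Finset.mem_of_mem_erase (Finset.mem_of_mem_erase h))
  rw [Finset.sum_finset_product (s := A) (t := fun a => A.filter fun b => ¬ π.SameCycle a b)]
  · have h2 : ∀ a ∈ A, ∑ b ∈ A with ¬ π.SameCycle a b, cycleWeight A (Equiv.swap a b * π) =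
        ∑ C' ∈ D, C'.card * if cyc π a = C' then 0 else H (cyc π a) C' := by
      intro a ha
      rw [← sum_comp_cyc hA (fun C' => if cyc π a = C' then 0 else H (cyc π a) C'),
        Finset.sum_filter]
      refine Finset.sum_congr rfl fun b hb => ?_
      simp only [cyc_eq_iff, ite_not]
      split_ifs with h
      · rfl
      · exact h1 a ha b hb h
    rw [Finset.sum_congr rfl h2, sum_comp_cyc hA
      (fun C => ∑ C' ∈ D, C'.card * if C = C' then 0 else H C C')]
    rw [Finset.sum_finset_product (s := D) (t := fun C => D.filter fun C' => ¬ C = C')]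
    · refine Finset.sum_congr rfl fun C _ => ?_
      rw [Finset.sum_filter, Finset.mul_sum]
      refine Finset.sum_congr rfl fun C' _ => ?_
      simp only [ite_not, hH]
      split_ifs <;> ring
    · rintro ⟨C, C'⟩
      simp only [Finset.mem_offDiag, Finset.mem_filter, ne_eq]
  · rintro ⟨a, b⟩
    simp only [Finset.mem_offDiag, Finset.mem_filter, ne_eq]
    constructor
    · tauto
    · rintro ⟨h1, h2, h3⟩
      exact ⟨⟨h1, h2, fun h => h3 (h ▸ Equiv.Perm.SameCycle.refl _ _)⟩, h3⟩

/-- The contribution of the pairs `(a, b)` whose transposition cuts a cycle, as the second sum in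
`hurwitzWeight_cut_join`. For given `a`, the point `b = π ^ r a` is determined by the length `r` of
the new cycle of `a`. -/
theorem sum_cut {A : Finset V} {π : Equiv.Perm V} (hA : ∀ x ∈ A, π x ∈ A) :
    ∑ e ∈ A.offDiag with π.SameCycle e.1 e.2, ∑ S ∈ ((cycles A π).erase (cyc π e.1)).powerset,
      hurwitzWeight (insert (cyc (Equiv.swap e.1 e.2 * π) e.1) S) Finset.card *
      hurwitzWeight (insert (cyc (Equiv.swap e.1 e.2 * π) e.2)
        ((cycles A π).erase (cyc π e.1) \ S)) Finset.card =
      ∑ C ∈ cycles A π, C.card * ∑ r ∈ Finset.Ioo 0 C.card, ∑ S ∈ ((cycles A π).erase C).powerset,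
        ((r + ∑ j ∈ S, (j.card : ℚ)) ^ ((S.card : ℤ) - 2) *
          (r * treeCoeff r * ∏ j ∈ S, j.card * treeCoeff j.card)) *
        (((C.card - r : ℕ) + ∑ j ∈ (cycles A π).erase C \ S, (j.card : ℚ)) ^
          ((((cycles A π).erase C \ S).card : ℤ) - 2) *
          ((C.card - r : ℕ) * treeCoeff (C.card - r) *
            ∏ j ∈ (cycles A π).erase C \ S, j.card * treeCoeff j.card)) := by
  rw [Finset.sum_finset_product (s := A) (t := fun a => (cyc π a).erase a), ← sum_comp_cyc hA]
  · refine Finset.sum_congr rfl fun a ha => ?_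
    have himg : (cyc π a).erase a = (Finset.Ioo 0 (cyc π a).card).image fun r => (π ^ r) a := by
      ext b
      rw [Finset.mem_erase, Finset.mem_image]
      constructor
      · rintro ⟨h1, h2⟩
        obtain ⟨r, h3, h4, rfl⟩ := exists_pow_of_mem_cyc h2 h1.symm
        exact ⟨r, Finset.mem_Ioo.2 ⟨h3, h4⟩, rfl⟩
      · rintro ⟨r, hr, rfl⟩
        rw [Finset.mem_Ioo] at hr
        refine ⟨fun h => ?_, mem_cyc.2 ⟨r, by simp⟩⟩
        have := (card_cyc_spec π a).2 r hr.2 0 (cyc_pos π a) (by simpa using h)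
        omega
    rw [himg, Finset.sum_image]
    · refine Finset.sum_congr rfl fun r hr => Finset.sum_congr rfl fun S hS => ?_
      rw [Finset.mem_Ioo] at hr
      rw [Finset.mem_powerset] at hS
      obtain ⟨hcut, hcard⟩ := card_cyc_cut hr.1 hr.2
      set b := (π ^ r) a with hb
      have hu : cyc (Equiv.swap a b * π) a ∪ cyc (Equiv.swap a b * π) b = cyc π a := by
        have := cyc_join_of_mem hcut (Finset.mem_union_left _ (self_mem_cyc _ a))
        rwa [swap_mul_swap_mul, eq_comm] at this
      have hcard' : (cyc (Equiv.swap a b * π) b).card = (cyc π a).card - r := by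
        rw [← hu, card_union_cyc hcut, hcard, Nat.add_sub_cancel_left]
      have hnot : ∀ x ∈ cyc π a, ∀ T ⊆ (cycles A π).erase (cyc π a),
          cyc (Equiv.swap a b * π) x ∉ T := by
        intro x hx T hT h
        have h' := Finset.mem_erase.1 (hT h)
        have := cyc_eq_of_mem_cycles h'.2 (self_mem_cyc _ x)
        exact h'.1 (this ▸ (cyc_eq_iff.2 (mem_cyc.1 hx).symm))
      rw [hurwitzWeight_insert (hnot a (self_mem_cyc π a) S hS),
        hurwitzWeight_insert (hnot b (mem_cyc.2 ⟨r, by simp [hb]⟩) _ Finset.sdiff_subset),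
        hcard, hcard']
    · intro r hr s hs h
      simp only [Finset.coe_Ioo, Set.mem_Ioo] at hr hs
      exact (card_cyc_spec π a).2 r hr.2 s hs.2 h
  · rintro ⟨a, b⟩
    simp only [Finset.mem_offDiag, Finset.mem_filter, Finset.mem_erase, mem_cyc, ne_eq]
    constructor
    · rintro ⟨⟨h1, h2, h3⟩, h4⟩
      exact ⟨h1, fun h => h3 h.symm, h4⟩
    · rintro ⟨h1, h2, h3⟩
      exact ⟨⟨h1, cyc_subset hA h1 (mem_cyc.2 h3), fun h => h2 h.symm⟩, h3⟩

omit [Fintype V] in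
theorem numFact_singleton {A : Finset V} {π : Equiv.Perm V} (hA : ∀ x ∈ A, π x ∈ A)
    (h1 : A.card = 1) : numFact A 0 π = 1 := by
  obtain ⟨x, rfl⟩ := Finset.card_eq_one.1 h1
  have : IsFact {x} π [] := by
    refine ⟨?_, ?_⟩
    · simp only [Finset.mem_singleton]
      rintro _ rfl _ rfl
      exact linked_refl _ _
    · simp only [Finset.mem_singleton]
      rintro _ rfl
      simpa [wordProd, eq_comm] using hA
  exact if_pos this

/-- If `j` is the total of the least possible numbers of factors on `B` and `A \ B`, then only words
that attain both bounds contribute, and `j.choose i` cancels against the factorials. -/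
theorem sum_shuffle_eq {A B : Finset V} {π : Equiv.Perm V} {j : ℕ} (hBA : B ⊆ A)
    (hB : ∀ x ∈ B, π x ∈ B) (hA : ∀ x ∈ A, π x ∈ A)
    (hBne : B.Nonempty) (hABne : (A \ B).Nonempty)
    (hj : j + 4 = A.card + (cycles A π).card)
    (ih : ∀ i ≤ j, ∀ (A : Finset V) (π : Equiv.Perm V), A.Nonempty → (∀ x ∈ A, π x ∈ A) →
      i + 2 = A.card + (cycles A π).card → (numFact A i π : ℚ) = 2 ^ i * i ! * cycleWeight A π) :
    ((∑ p ∈ Finset.HasAntidiagonal.antidiagonal j, j.choose p.1 *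
      (numFact B p.1 π * numFact (A \ B) p.2 π) : ℕ) : ℚ) =
      2 ^ j * j ! * (cycleWeight B π * cycleWeight (A \ B) π) := by
  have e1 := card_cycles_add hBA hB
  have e2 := Finset.card_sdiff_add_card_eq_card hBA
  have hpos : ∀ {B : Finset V}, B.Nonempty → 2 ≤ B.card + (cycles B π).card := by
    intro B hB
    have h1 := Finset.card_pos.2 hB
    have h2 : 0 < (cycles B π).card := Finset.card_pos.2 (hB.image _)
    omega
  obtain ⟨i, hi⟩ := Nat.exists_eq_add_of_le (hpos hBne)
  obtain ⟨k, hk⟩ := Nat.exists_eq_add_of_le (hpos hABne)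
  obtain rfl : j = i + k := by omega
  rw [Finset.sum_eq_single (i, k)]
  · push_cast
    rw [ih i (by omega) B π hBne hB (by omega), ih k (by omega) (A \ B) π hABne
      (sdiff_mem hA hB) (by omega), Nat.cast_add_choose]
    have := Nat.factorial_ne_zero
    field_simp
    ring
  · rintro ⟨i', k'⟩ hp hne
    have hp' := Finset.HasAntidiagonal.mem_antidiagonal.1 hp
    dsimp only at hp' ⊢
    by_contra h
    have h2 := right_ne_zero_of_mul h
    have i1 := card_add_card_cycles_le _ _ _ (left_ne_zero_of_mul h2)
    have i2 := card_add_card_cycles_le _ _ _ (right_ne_zero_of_mul h2)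
    apply hne
    rw [Prod.mk.injEq]
    omega
  · intro h
    exact (h (Finset.HasAntidiagonal.mem_antidiagonal.2 rfl)).elim

/-- Hurwitz's formula for the number of minimal transitive factorisations into transpositions. The
power of `2` comes from representing each transposition by two pairs. -/
theorem numFact_eq (j : ℕ) : ∀ (A : Finset V) (π : Equiv.Perm V), A.Nonempty →
    (∀ x ∈ A, π x ∈ A) → j + 2 = A.card + (cycles A π).card →
    (numFact A j π : ℚ) = 2 ^ j * j ! * cycleWeight A π := by
  induction j using Nat.strong_induction_on with
  | _ j ih =>
    intro A π hne hA hj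
    have hDne : (cycles A π).Nonempty := hne.image _
    have hApos := Finset.card_pos.2 hne
    have hDpos := Finset.card_pos.2 hDne
    rcases j with _ | j
    · obtain ⟨C, hC⟩ := Finset.card_eq_one.1 (show (cycles A π).card = 1 by omega)
      have hs := sum_card_cycles hA
      rw [hC, Finset.sum_singleton] at hs
      have hC1 : C.card = 1 := by omega
      rw [numFact_singleton hA (by omega), cycleWeight, hC, hurwitzWeight]
      simp [hC1, treeCoeff]
    · have hlt : ∀ i ≤ j, ∀ (A : Finset V) (π : Equiv.Perm V), A.Nonempty →
          (∀ x ∈ A, π x ∈ A) → i + 2 = A.card + (cycles A π).card →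
          (numFact A i π : ℚ) = 2 ^ i * i ! * cycleWeight A π := fun i hi => ih i (by omega)
      have hjoin : ∀ e ∈ A.offDiag.filter (fun e => ¬ π.SameCycle e.1 e.2),
          ((numFact A j (Equiv.swap e.1 e.2 * π) +
          ∑ B ∈ A.powerset with e.1 ∈ B ∧ e.2 ∉ B, ∑ p ∈ Finset.HasAntidiagonal.antidiagonal j,
            j.choose p.1 * (numFact B p.1 (Equiv.swap e.1 e.2 * π) *
              numFact (A \ B) p.2 (Equiv.swap e.1 e.2 * π)) : ℕ) : ℚ) =
          2 ^ j * j ! * cycleWeight A (Equiv.swap e.1 e.2 * π) := by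
        rintro ⟨a, b⟩ he
        obtain ⟨he, hab⟩ := Finset.mem_filter.1 he
        obtain ⟨ha, hb, hne'⟩ := Finset.mem_offDiag.1 he
        dsimp only at *
        have hc := card_cycles_join ha hb hab
        -- The transposition joins two cycles: `a` and `b` are in one cycle of the remaining product,
        -- which therefore cannot split between them.
        rw [Finset.sum_eq_zero, add_zero, hlt j le_rfl A _ hne (swap_mul_mem hA ha hb) (by omega)]
        intro B hB
        obtain ⟨hBA, haB, hbB⟩ := Finset.mem_filter.1 hB
        refine Finset.sum_eq_zero fun p _ => ?_
        by_contra h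
        have hinv := mem_of_numFact_ne_zero (left_ne_zero_of_mul (right_ne_zero_of_mul h))
        exact not_sameCycle_of_invariant hinv haB hbB (sameCycle_swap_mul hab)
      have hcut : ∀ e ∈ A.offDiag.filter (fun e => π.SameCycle e.1 e.2),
          ((numFact A j (Equiv.swap e.1 e.2 * π) +
          ∑ B ∈ A.powerset with e.1 ∈ B ∧ e.2 ∉ B, ∑ p ∈ Finset.HasAntidiagonal.antidiagonal j,
            j.choose p.1 * (numFact B p.1 (Equiv.swap e.1 e.2 * π) *
              numFact (A \ B) p.2 (Equiv.swap e.1 e.2 * π)) : ℕ) : ℚ) =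
          2 ^ j * j ! * ∑ S ∈ ((cycles A π).erase (cyc π e.1)).powerset,
            hurwitzWeight (insert (cyc (Equiv.swap e.1 e.2 * π) e.1) S) Finset.card *
            hurwitzWeight (insert (cyc (Equiv.swap e.1 e.2 * π) e.2)
              ((cycles A π).erase (cyc π e.1) \ S)) Finset.card := by
        rintro ⟨a, b⟩ he
        obtain ⟨he, hab⟩ := Finset.mem_filter.1 he
        obtain ⟨ha, hb, hne'⟩ := Finset.mem_offDiag.1 he
        dsimp only at *
        have hab' := not_sameCycle_swap_mul hab hne'
        have hc := card_cycles_cut ha hb hab'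
        have hinvA := swap_mul_mem hA ha hb
        have hR : ((cycles A (Equiv.swap a b * π)).erase (cyc (Equiv.swap a b * π) a)).erase
            (cyc (Equiv.swap a b * π) b) = (cycles A π).erase (cyc π a) := by
          have h1 := cyc_join_of_mem hab' (Finset.mem_union_left _ (self_mem_cyc _ a))
          have h2 := cycles_join ha hab'
          rw [swap_mul_swap_mul] at h1 h2
          rw [h2, h1, Finset.erase_insert]
          exact fun h => union_notMem_cycles hab'
            (Finset.mem_of_mem_erase (Finset.mem_of_mem_erase h))
        -- The remaining product has one cycle more, and `j` factors are too few to connect `A`.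
        have h0 : numFact A j (Equiv.swap a b * π) = 0 := by
          by_contra h
          have := card_add_card_cycles_le _ _ _ h
          omega
        rw [h0, zero_add, ← hR, ← sum_invariant_subsets hinvA ha hb hab'
          (fun D D' => hurwitzWeight D Finset.card * hurwitzWeight D' Finset.card), Nat.cast_sum,
          Finset.mul_sum, ← Finset.filter_filter (fun B => a ∈ B ∧ b ∉ B),
          Finset.sum_filter (fun B => ∀ x ∈ B, (Equiv.swap a b * π) x ∈ B)]
        refine Finset.sum_congr rfl fun B hB => ?_
        obtain ⟨hBA, haB, hbB⟩ := Finset.mem_filter.1 hB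
        rw [Finset.mem_powerset] at hBA
        split_ifs with hinv
        · exact sum_shuffle_eq hBA hinv hinvA ⟨a, haB⟩ ⟨b, Finset.mem_sdiff.2 ⟨hb, hbB⟩⟩
            (by omega) hlt
        · rw [Finset.sum_eq_zero, Nat.cast_zero]
          intro p _
          by_contra h
          exact hinv (mem_of_numFact_ne_zero (left_ne_zero_of_mul (right_ne_zero_of_mul h)))
      have hw := hurwitzWeight_cut_join (cycles A π) hDne Finset.card
        (fun C hC => Finset.card_pos.2 (nonempty_of_mem_cycles hC))
      rw [← sum_join hA, ← sum_cut hA, sum_card_cycles_cast hA] at hw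
      have hj' : (A.card : ℚ) + (cycles A π).card - 2 = j + 1 := by
        have : ((j + 1 + 2 : ℕ) : ℚ) = A.card + (cycles A π).card := by rw [hj]; push_cast; rfl
        push_cast at this
        linarith
      rw [numFact_succ, Nat.cast_sum, ← Finset.sum_filter_add_sum_filter_not A.offDiag
        (fun e => π.SameCycle e.1 e.2), Finset.sum_congr rfl hjoin, Finset.sum_congr rfl hcut,
        ← Finset.mul_sum, ← Finset.mul_sum, ← mul_add, add_comm (Finset.sum _ _), ← hw, hj',
        Nat.factorial_succ, cycleWeight]
      push_cast
      ring

end Count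

/-! ### From words to transitive factorisations -/

section Transfer

variable {n : ℕ}

theorem swap_eq_swap {V : Type*} [DecidableEq V] {a b x y : V} (hab : a ≠ b) :
    x ≠ y ∧ Equiv.swap x y = Equiv.swap a b ↔ (x, y) = (a, b) ∨ (x, y) = (b, a) := by
  rw [Prod.mk.injEq, Prod.mk.injEq]
  constructor
  · rintro ⟨hxy, h⟩
    have h1 : Equiv.swap a b x = y := by rw [← h, Equiv.swap_apply_left]
    rw [Equiv.swap_apply_def] at h1
    split_ifs at h1 with h2 h3
    · exact Or.inl ⟨h2, h1.symm⟩
    · exact Or.inr ⟨h3, h1.symm⟩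
    · exact absurd h1 hxy
  · rintro (⟨rfl, rfl⟩ | ⟨rfl, rfl⟩)
    · exact ⟨hab, rfl⟩
    · exact ⟨hab.symm, Equiv.swap_comm _ _⟩

/-- Connectedness of the graph of the transpositions is transitivity of the group they generate. -/
theorem isFact_univ_iff {j : ℕ} {π : Equiv.Perm (Fin n)} (f : Fin j → Fin n × Fin n)
    (hf : ∀ i, (f i).1 ≠ (f i).2) :
    IsFact Finset.univ π (List.ofFn f) ↔
      IsTransFactorisation 2 π (fun i => Equiv.swap (f i).1 (f i).2) := by
  have hprod : wordProd (List.ofFn f) = (List.ofFn fun i => Equiv.swap (f i).1 (f i).2).prod := by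
    rw [wordProd, List.map_ofFn]; rfl
  constructor
  · rintro ⟨h1, h2⟩
    refine ⟨fun i => Equiv.Perm.isCycle_swap (hf i),
      fun i => Equiv.Perm.card_support_swap (hf i), ?_, ⟨fun x y => ?_⟩⟩
    · rw [← hprod]; ext x; rw [h2 x (Finset.mem_univ x)]
    · have h := h1 x (Finset.mem_univ x) y (Finset.mem_univ y)
      induction h with
      | rel x y h =>
        obtain ⟨i, hi⟩ := (List.mem_ofFn' f _).1 h
        refine ⟨⟨Equiv.swap x y, Subgroup.subset_closure ⟨i, ?_⟩⟩, Equiv.swap_apply_left _ _⟩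
        simp only [hi]
      | refl x => exact ⟨1, one_smul _ _⟩
      | symm x y _ ih =>
        obtain ⟨g, hg⟩ := ih
        exact ⟨g⁻¹, inv_smul_eq_iff.2 hg.symm⟩
      | trans x y z _ _ ih1 ih2 =>
        obtain ⟨g, hg⟩ := ih1
        obtain ⟨g', hg'⟩ := ih2
        exact ⟨g' * g, by rw [mul_smul, hg, hg']⟩
  · intro h
    refine ⟨fun x _ y _ => ?_, fun x _ => by rw [hprod, h.prod_eq]⟩
    obtain ⟨⟨g, hg⟩, hxy⟩ := h.transitive.exists_smul_eq x y
    have hxy' : g x = y := hxy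
    have key : ∀ x, Linked (List.ofFn f) x (g x) := by
      clear hxy hxy'
      induction hg using Subgroup.closure_induction with
      | mem g hg =>
        intro x
        obtain ⟨i, rfl⟩ := hg
        have hi : Linked (List.ofFn f) (f i).1 (f i).2 :=
          Relation.EqvGen.rel _ _ ((List.mem_ofFn' f _).2 ⟨i, rfl⟩)
        simp only [Equiv.swap_apply_def]
        split_ifs with h1 h2
        · rw [h1]; exact hi
        · rw [h2]; exact hi.symm
        · exact linked_refl _ _
      | one => exact fun x => linked_refl _ _
      | mul g g' _ _ ih ih' => exact fun x => (ih' x).trans (ih (g' x))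
      | inv g _ ih => exact fun x => by simpa using (ih (g⁻¹ x)).symm
    exact hxy' ▸ key x

/-- Each transposition is represented by two ordered pairs. -/
theorem numFact_univ (j : ℕ) (π : Equiv.Perm (Fin n)) :
    numFact Finset.univ j π =
      2 ^ j * Nat.card {σ : Fin j → Equiv.Perm (Fin n) // IsTransFactorisation 2 π σ} := by
  classical
  rw [numFact, wordSum_eq_card]
  let e : {f : Fin j → Fin n × Fin n //
      (∀ i, f i ∈ (Finset.univ : Finset (Fin n)).offDiag) ∧ IsFact Finset.univ π (List.ofFn f)} ≃
      Σ σ : {σ : Fin j → Equiv.Perm (Fin n) // IsTransFactorisation 2 π σ},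
        ∀ i, {e : Fin n × Fin n // e.1 ≠ e.2 ∧ Equiv.swap e.1 e.2 = σ.1 i} :=
    { toFun := fun f => ⟨⟨fun i => Equiv.swap (f.1 i).1 (f.1 i).2,
          (isFact_univ_iff f.1 fun i => by simpa using f.2.1 i).1 f.2.2⟩,
        fun i => ⟨f.1 i, by simpa using f.2.1 i, rfl⟩⟩
      invFun := fun p => ⟨fun i => (p.2 i).1, fun i => by simpa using (p.2 i).2.1, by
        rw [isFact_univ_iff _ fun i => (p.2 i).2.1]
        have : (fun i => Equiv.swap (p.2 i).1.1 (p.2 i).1.2) = p.1.1 := by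
          funext i; exact (p.2 i).2.2
        rw [this]; exact p.1.2⟩
      left_inv := fun f => rfl
      right_inv := by
        rintro ⟨⟨σ, hσ⟩, p⟩
        obtain ⟨q, hq, rfl⟩ : ∃ (q : Fin j → Fin n × Fin n)
            (hq : ∀ i, (q i).1 ≠ (q i).2 ∧ Equiv.swap (q i).1 (q i).2 = σ i),
            p = fun i => ⟨q i, hq i⟩ := ⟨fun i => (p i).1, fun i => (p i).2, rfl⟩
        obtain rfl : σ = fun i => Equiv.swap (q i).1 (q i).2 := funext fun i => (hq i).2.symm
        rfl }
  rw [Nat.card_congr e, Nat.card_sigma]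
  have hfib : ∀ σ : {σ : Fin j → Equiv.Perm (Fin n) // IsTransFactorisation 2 π σ},
      Nat.card (∀ i, {e : Fin n × Fin n // e.1 ≠ e.2 ∧ Equiv.swap e.1 e.2 = σ.1 i}) = 2 ^ j := by
    rintro ⟨σ, hσ⟩
    rw [Nat.card_pi, Finset.prod_congr rfl (g := fun _ => 2)]
    · simp
    · intro i _
      obtain ⟨a, b, hab, h⟩ := Equiv.Perm.card_support_eq_two.1 (hσ.card_support i)
      have : ∀ e : Fin n × Fin n, (e.1 ≠ e.2 ∧ Equiv.swap e.1 e.2 = σ i) ↔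
          e ∈ ({(a, b), (b, a)} : Finset (Fin n × Fin n)) := by
        rintro ⟨x, y⟩
        rw [h, swap_eq_swap hab, Finset.mem_insert, Finset.mem_singleton]
      rw [Nat.card_congr (Equiv.subtypeEquivRight this), Nat.card_eq_finsetCard,
        Finset.card_pair]
      simp [hab]
  rw [Finset.sum_congr rfl fun σ _ => hfib σ, Finset.sum_const, smul_eq_mul, mul_comm,
    Finset.card_univ, Nat.card_eq_fintype_card]

theorem cycleWeight_pos {V : Type*} [Fintype V] [DecidableEq V] {A : Finset V}
    (hA : A.Nonempty) (π : Equiv.Perm V) : 0 < cycleWeight A π := by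
  unfold cycleWeight hurwitzWeight
  have hpos : ∀ C ∈ cycles A π, (0 : ℚ) < C.card := fun C hC => by
    exact_mod_cast Finset.card_pos.2 (nonempty_of_mem_cycles hC)
  exact mul_pos (zpow_pos (Finset.sum_pos hpos (hA.image _)) _)
    (Finset.prod_pos fun C hC => mul_pos (hpos C hC) (treeCoeff_pos _))

theorem numMinFactorisations_eq (hn : 1 ≤ n) (π : Equiv.Perm (Fin n)) :
    (numMinFactorisations 2 π : ℚ) =
      (n + (cycles Finset.univ π).card - 2)! * cycleWeight Finset.univ π := by
  have hne : (Finset.univ : Finset (Fin n)).Nonempty := ⟨⟨0, hn⟩, Finset.mem_univ _⟩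
  have hDpos : 0 < (cycles Finset.univ π).card := Finset.card_pos.2 (hne.image _)
  have hcard : (Finset.univ : Finset (Fin n)).card = n := by simp
  set j := n + (cycles Finset.univ π).card - 2 with hj
  have hval : (numFact Finset.univ j π : ℚ) = 2 ^ j * j ! * cycleWeight Finset.univ π :=
    numFact_eq j _ π hne (fun _ _ => Finset.mem_univ _) (by rw [hcard]; omega)
  have hex : ∀ i, (∃ σ : Fin i → Equiv.Perm (Fin n), IsTransFactorisation 2 π σ) ↔
      numFact Finset.univ i π ≠ 0 := by
    intro i
    rw [numFact_univ, mul_ne_zero_iff, and_iff_right (by positivity), Nat.card_ne_zero,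
      nonempty_subtype]
    exact ⟨fun h => ⟨h, inferInstance⟩, fun h => h.1⟩
  have hmin : minFactors 2 π = j := by
    have hmem : j ∈ {i | ∃ σ : Fin i → Equiv.Perm (Fin n), IsTransFactorisation 2 π σ} := by
      refine (hex j).2 fun h => ?_
      have := cycleWeight_pos hne π
      have h2 : (0 : ℚ) < 2 ^ j * j ! * cycleWeight Finset.univ π := by positivity
      rw [← hval, h] at h2
      simp at h2
    refine le_antisymm (Nat.sInf_le hmem) (le_csInf ⟨j, hmem⟩ fun i hi => ?_)
    have := card_add_card_cycles_le i _ π ((hex i).1 hi)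
    rw [hcard] at this
    omega
  rw [numFact_univ] at hval
  unfold numMinFactorisations
  rw [hmin]
  push_cast at hval
  have h2 : (2 : ℚ) ^ j ≠ 0 := by positivity
  rw [mul_assoc] at hval
  exact mul_left_cancel₀ h2 hval

end Transfer

section Partition

theorem cyc_eq_support_cycleOf {V : Type*} [Fintype V] [DecidableEq V] {π : Equiv.Perm V} {x : V}
    (hx : x ∈ π.support) : cyc π x = (π.cycleOf x).support := by
  ext y
  rw [mem_cyc, Equiv.Perm.mem_support_cycleOf_iff, and_iff_left hx]

theorem cyc_of_notMem_support {V : Type*} [Fintype V] [DecidableEq V] {π : Equiv.Perm V} {x : V}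
    (hx : x ∉ π.support) : cyc π x = {x} := by
  ext y
  rw [mem_cyc, Finset.mem_singleton]
  refine ⟨fun h => (h.eq_of_left (Equiv.Perm.notMem_support.1 hx)).symm, ?_⟩
  rintro rfl; exact Equiv.Perm.SameCycle.refl _ _

/-- The parts of the partition of a permutation are the sizes of its cycles. -/
theorem map_card_cycles {V : Type*} [Fintype V] [DecidableEq V] (π : Equiv.Perm V) :
    (cycles Finset.univ π).val.map Finset.card = π.partition.parts := by
  have h1 : cycles Finset.univ π = π.cycleFactorsFinset.image Equiv.Perm.support ∪
      π.supportᶜ.image (fun x => ({x} : Finset V)) := by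
    ext C
    simp only [cycles, Finset.mem_image, Finset.mem_univ, true_and, Finset.mem_union,
      Finset.mem_compl]
    constructor
    · rintro ⟨x, rfl⟩
      by_cases hx : x ∈ π.support
      · exact Or.inl ⟨π.cycleOf x, Equiv.Perm.cycleOf_mem_cycleFactorsFinset_iff.2 hx,
          (cyc_eq_support_cycleOf hx).symm⟩
      · exact Or.inr ⟨x, hx, (cyc_of_notMem_support hx).symm⟩
    · rintro (⟨c, hc, rfl⟩ | ⟨x, hx, rfl⟩)
      · obtain ⟨x, hx⟩ := (Equiv.Perm.mem_cycleFactorsFinset_iff.1 hc).1.nonempty_support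
        refine ⟨x, ?_⟩
        rw [cyc_eq_support_cycleOf (Equiv.Perm.mem_cycleFactorsFinset_support_le hc hx),
          ← Equiv.Perm.cycle_is_cycleOf hx hc]
      · exact ⟨x, cyc_of_notMem_support hx⟩
  have hinj : Set.InjOn Equiv.Perm.support (π.cycleFactorsFinset : Set (Equiv.Perm V)) := by
    intro c hc d hd h
    obtain ⟨x, hx⟩ := (Equiv.Perm.mem_cycleFactorsFinset_iff.1 hc).1.nonempty_support
    rw [Equiv.Perm.cycle_is_cycleOf hx hc, Equiv.Perm.cycle_is_cycleOf (h ▸ hx) hd]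
  have hdisj : Disjoint (π.cycleFactorsFinset.image Equiv.Perm.support)
      (π.supportᶜ.image (fun x => ({x} : Finset V))) := by
    rw [Finset.disjoint_left]
    intro C h h'
    obtain ⟨c, hc, rfl⟩ := Finset.mem_image.1 h
    obtain ⟨x, hx, h⟩ := Finset.mem_image.1 h'
    have := Equiv.Perm.mem_cycleFactorsFinset_support_le hc
      (show x ∈ c.support by rw [← h]; exact Finset.mem_singleton_self x)
    exact Finset.mem_compl.1 hx this
  rw [h1, ← Finset.disjUnion_eq_union _ _ hdisj, Finset.disjUnion_val, Multiset.map_add,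
    Finset.image_val_of_injOn hinj, Finset.image_val_of_injOn Finset.singleton_injective.injOn,
    Multiset.map_map, Multiset.map_map, Equiv.Perm.parts_partition, Equiv.Perm.cycleType_def]
  congr 1
  have : Finset.card ∘ (fun x => ({x} : Finset V)) = fun _ => 1 := by
    funext x; simp
  rw [this, Multiset.map_const', Finset.card_val, Finset.card_compl]

theorem cycleWeight_univ {n : ℕ} {α : n.Partition} {π : Equiv.Perm (Fin n)}
    (hπ : π ∈ conjClass α) : cycleWeight Finset.univ π =
      (n : ℚ) ^ ((α.parts.card : ℤ) - 3) *
        (α.parts.map fun a : ℕ => (a : ℚ) * treeCoeff a).prod := by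
  have h : (cycles Finset.univ π).val.map Finset.card = α.parts := (map_card_cycles π).trans hπ
  rw [cycleWeight, hurwitzWeight, sum_card_cycles_cast (fun _ _ => Finset.mem_univ _), ← h,
    Multiset.card_map, Finset.card_val, Finset.card_univ, Fintype.card_fin, Multiset.map_map]
  rfl

/-- Hurwitz's formula for `c_2(α)`. -/
theorem c_two_eq {n : ℕ} (hn : 1 ≤ n) (α : n.Partition) :
    (c 2 α : ℚ) = (mu 2 α)! * ((n : ℚ) ^ ((α.parts.card : ℤ) - 3) *
      (α.parts.map fun a : ℕ => (a : ℚ) * treeCoeff a).prod) := by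
  have hπ := (conjClass_nonempty α).some_mem
  set π := (conjClass_nonempty α).some with hπ'
  have h : (cycles Finset.univ π).val.map Finset.card = α.parts := (map_card_cycles π).trans hπ
  have hcard : (cycles Finset.univ π).card = α.parts.card := by
    rw [← h, Multiset.card_map, Finset.card_val]
  rw [← c_eq 2 α hπ, numMinFactorisations_eq hn, cycleWeight_univ hπ, hcard, mu]
  simp

/-- The number of permutations of the positions that fix a given listing of the multiset `s`. -/
def symmetryFactor (s : Multiset ℕ) : ℕ := ∏ a ∈ s.toFinset, (s.count a)!

/-- The size of a conjugacy class in terms of all parts of `α`, those equal to `1` included. -/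
theorem conjClass_ncard {n : ℕ} (α : n.Partition) :
    (conjClass α).ncard * (α.parts.prod * symmetryFactor α.parts) = n ! := by
  have hg := (conjClass_nonempty α).some_mem
  set g := (conjClass_nonempty α).some
  have hparts : α.parts = g.cycleType + Multiset.replicate (n - g.support.card) 1 := by
    have : g.partition.parts = α.parts := hg
    rw [← this, Equiv.Perm.parts_partition, Fintype.card_fin]
  have hset : conjClass α = {h | IsConj g h} := by
    ext h
    rw [Set.mem_ofPred_eq, Equiv.Perm.partition_eq_of_isConj, Nat.Partition.ext_iff]
    have : g.partition.parts = α.parts := hg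
    rw [this, eq_comm]
    rfl
  have h1 := Equiv.Perm.card_isConj_mul_eq g
  rw [Fintype.card_fin, Equiv.Perm.sum_cycleType] at h1
  have hone : 1 ∉ g.cycleType := fun h => by
    have := Equiv.Perm.two_le_of_mem_cycleType h
    omega
  have hprod : α.parts.prod = g.cycleType.prod := by rw [hparts]; simp
  have hsym : symmetryFactor α.parts = (n - g.support.card)! *
      ∏ a ∈ g.cycleType.toFinset, (g.cycleType.count a)! := by
    have h2 : ∀ s : Multiset ℕ, ∀ T : Finset ℕ, s.toFinset ⊆ T →
        ∏ a ∈ s.toFinset, (s.count a)! = ∏ a ∈ T, (s.count a)! := by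
      intro s T hT
      refine Finset.prod_subset hT fun a _ ha => ?_
      rw [Multiset.count_eq_zero_of_notMem (by simpa using ha), Nat.factorial_zero]
    have hT : α.parts.toFinset ⊆ insert 1 g.cycleType.toFinset := by
      intro a ha
      rw [hparts, Multiset.mem_toFinset, Multiset.mem_add] at ha
      rw [Finset.mem_insert, Multiset.mem_toFinset]
      exact ha.symm.imp (fun h => Multiset.eq_of_mem_replicate h) id
    rw [symmetryFactor, h2 _ _ hT, Finset.prod_insert (by simpa using hone), hparts]
    congr 1
    · rw [Multiset.count_add, Multiset.count_eq_zero_of_notMem hone, zero_add,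
        Multiset.count_replicate_self]
    · refine Finset.prod_congr rfl fun a ha => ?_
      have : a ≠ 1 := fun h => hone (h ▸ Multiset.mem_toFinset.1 ha)
      rw [Multiset.count_add, Multiset.count_replicate, if_neg this.symm, add_zero]
  rw [hprod, hsym, hset, ← Nat.card_coe_set_eq, ← h1]
  ring

end Partition

/-! ### The generating series -/

section Series

theorem hasSubst_w : PowerSeries.HasSubst (w 2) :=
  PowerSeries.HasSubst.of_constantCoeff_zero' (by rw [w_eq le_rfl]; exact constantCoeff_rhs _ _)

theorem w_eq_X_mul : w 2 = PowerSeries.X * (PowerSeries.exp ℚ).subst (w 2) := by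
  conv_lhs => rw [w_eq le_rfl, rhs, show 2 - 1 = 1 from rfl, pow_one]

/-- Differentiating `w = x exp w`. -/
theorem X_mul_derivative_w :
    PowerSeries.X * PowerSeries.derivative ℚ (w 2) =
      w 2 + w 2 * (PowerSeries.X * PowerSeries.derivative ℚ (w 2)) := by
  have hd := congrArg (PowerSeries.derivative ℚ) w_eq_X_mul
  rw [Derivation.leibniz, PowerSeries.derivative_X, PowerSeries.derivative_subst hasSubst_w,
    PowerSeries.derivative_exp, smul_eq_mul, smul_eq_mul, mul_one] at hd
  set E := (PowerSeries.exp ℚ).subst (w 2) with hE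
  conv_lhs => rw [hd]
  linear_combination (-1 - PowerSeries.X * PowerSeries.derivative ℚ (w 2)) * w_eq_X_mul

theorem coeff_X_mul_derivative (f : PowerSeries ℚ) (n : ℕ) :
    PowerSeries.coeff n (PowerSeries.X * PowerSeries.derivative ℚ f) =
      n * PowerSeries.coeff n f := by
  cases n with
  | zero => simp
  | succ n =>
    rw [PowerSeries.coeff_succ_X_mul, PowerSeries.coeff_derivative]
    push_cast; ring

theorem coeff_zero_w : PowerSeries.coeff 0 (w 2) = 0 := by
  rw [PowerSeries.coeff_zero_eq_constantCoeff_apply, w_eq le_rfl, constantCoeff_rhs]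

theorem constantCoeff_exp_w :
    PowerSeries.constantCoeff ((PowerSeries.exp ℚ).subst (w 2)) = 1 := by
  rw [← PowerSeries.coeff_zero_eq_constantCoeff_apply, PowerSeries.coeff_subst' hasSubst_w,
    finsum_eq_single _ 0]
  · simp
  · intro d hd
    rw [PowerSeries.coeff_zero_eq_constantCoeff_apply, map_pow, w_eq le_rfl, constantCoeff_rhs,
      zero_pow hd, smul_zero]

/-- The coefficients of `x dw/dx`. The recursion obtained from `X_mul_derivative_w` is satisfied by
`nⁿ⁻¹ / n!` by Abel's identity. -/
theorem coeff_w (n : ℕ) (hn : 1 ≤ n) : n * PowerSeries.coeff n (w 2) = treeCoeff n := by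
  induction n using Nat.strong_induction_on with
  | _ n ih =>
    obtain rfl | hn2 : n = 1 ∨ 2 ≤ n := by omega
    · rw [w_eq_X_mul, PowerSeries.coeff_succ_X_mul, PowerSeries.coeff_zero_eq_constantCoeff_apply,
        constantCoeff_exp_w]
      simp [treeCoeff]
    · have h := congrArg (PowerSeries.coeff n) X_mul_derivative_w
      rw [map_add, coeff_X_mul_derivative, PowerSeries.coeff_mul,
        Finset.Nat.sum_antidiagonal_eq_sum_range_succ (fun i j => PowerSeries.coeff i (w 2) *
          PowerSeries.coeff j (PowerSeries.X * PowerSeries.derivative ℚ (w 2))),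
        Finset.sum_range_succ, Nat.sub_self, coeff_X_mul_derivative, Nat.cast_zero, zero_mul,
        mul_zero, add_zero] at h
      have e : Finset.Ioo 0 n = (Finset.range n).erase 0 := by ext; simp; omega
      rw [← Finset.add_sum_erase _ _ (Finset.mem_range.2 (show 0 < n by omega)), coeff_zero_w,
        zero_mul, zero_add, ← e] at h
      have h1 : ∀ r ∈ Finset.Ioo 0 n, PowerSeries.coeff r (w 2) *
          PowerSeries.coeff (n - r) (PowerSeries.X * PowerSeries.derivative ℚ (w 2)) =
          treeCoeff r * treeCoeff (n - r) / r := by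
        intro r hr
        rw [Finset.mem_Ioo] at hr
        have hr0 : (r : ℚ) ≠ 0 := by exact_mod_cast (by omega : r ≠ 0)
        rw [coeff_X_mul_derivative, ih (n - r) (by omega) (by omega), ← ih r (by omega) (by omega)]
        field_simp
      rw [Finset.sum_congr rfl h1] at h
      have h2 : ∑ r ∈ Finset.Ioo 0 n, treeCoeff r * treeCoeff (n - r) / r =
          ∑ r ∈ Finset.Ioo 0 n, treeCoeff r * treeCoeff (n - r) / (n - r : ℕ) := by
        refine Finset.sum_bij' (fun r _ => n - r) (fun r _ => n - r) ?_ ?_ ?_ ?_ ?_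
        · intro r hr; simp at hr ⊢; omega
        · intro r hr; simp at hr ⊢; omega
        · intro r hr; simp at hr ⊢; omega
        · intro r hr; simp at hr ⊢; omega
        · intro r hr
          have : n - (n - r) = r := by simp at hr; omega
          rw [this, mul_comm (treeCoeff r)]
      have h3 : ∑ r ∈ Finset.Ioo 0 n, treeCoeff r * treeCoeff (n - r) / r +
          ∑ r ∈ Finset.Ioo 0 n, treeCoeff r * treeCoeff (n - r) / (n - r : ℕ) =
          n * ∑ r ∈ Finset.Ioo 0 n, treeCoeff r * treeCoeff (n - r) / (r * (n - r : ℕ)) := by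
        rw [← Finset.sum_add_distrib, Finset.mul_sum]
        refine Finset.sum_congr rfl fun r hr => ?_
        rw [Finset.mem_Ioo] at hr
        have hr0 : (r : ℚ) ≠ 0 := by exact_mod_cast (by omega : r ≠ 0)
        have hr1 : ((n - r : ℕ) : ℚ) ≠ 0 := by exact_mod_cast (by omega : n - r ≠ 0)
        have hn' : (n : ℚ) = r + (n - r : ℕ) := by rw [Nat.cast_sub hr.2.le]; ring
        rw [hn']
        field_simp
        ring
      have h4 := abel_tree n hn
      have hn0 : (n : ℚ) - 1 ≠ 0 := by
        have : (2 : ℚ) ≤ n := by exact_mod_cast hn2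
        linarith
      apply mul_left_cancel₀ hn0
      linear_combination (n : ℚ) * h + (n : ℚ) / 2 * h3 + (n : ℚ) / 2 * h2 + h4 / 2

variable {m : ℕ}

theorem coeff_X_mul_pderiv (i : Fin m) (f : MvPowerSeries (Fin m) ℚ) (β : Fin m →₀ ℕ) :
    MvPowerSeries.coeff β (MvPowerSeries.X i * MvPowerSeries.pderiv ℚ i f) =
      β i * MvPowerSeries.coeff β f := by
  rw [MvPowerSeries.X, MvPowerSeries.coeff_monomial_mul]
  split_ifs with h
  · rw [MvPowerSeries.coeff_pderiv, tsub_add_cancel_of_le h, one_mul, mul_comm]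
    have h1 : 1 ≤ β i := by simpa using h i
    simp [Nat.cast_sub h1]
  · have : β i = 0 := by
      by_contra h0
      exact h (by simpa [Finsupp.single_le_iff] using Nat.one_le_iff_ne_zero.2 h0)
    simp [this]

/-- The coefficients of a product of series in separate variables. -/
theorem coeff_prod_separate (F : Fin m → MvPowerSeries (Fin m) ℚ)
    (hF : ∀ i (β : Fin m →₀ ℕ), β ≠ Finsupp.single i (β i) → MvPowerSeries.coeff β (F i) = 0)
    (β : Fin m →₀ ℕ) :
    MvPowerSeries.coeff β (∏ i, F i) =
      ∏ i, MvPowerSeries.coeff (Finsupp.single i (β i)) (F i) := by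
  rw [MvPowerSeries.coeff_prod, Finset.sum_eq_single
    (Finsupp.equivFunOnFinite.symm fun i => Finsupp.single i (β i))]
  · simp
  · intro l hl hne
    rw [Finset.mem_finsuppAntidiag] at hl
    by_contra h
    apply hne
    have h1 : ∀ i, l i = Finsupp.single i (l i i) := by
      intro i
      by_contra h'
      exact h (Finset.prod_eq_zero (Finset.mem_univ i) (hF i _ h'))
    have h2 : ∀ i, β i = l i i := by
      intro i
      rw [← hl.1, Finsupp.finsetSum_apply, Finset.sum_eq_single i]
      · intro k _ hk
        rw [h1 k, Finsupp.single_eq_of_ne hk.symm]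
      · simp
    ext1 i
    rw [Finsupp.equivFunOnFinite_symm_apply_apply, h2 i]
    exact h1 i
  · intro h
    exfalso
    apply h
    rw [Finset.mem_finsuppAntidiag]
    refine ⟨?_, Finset.subset_univ _⟩
    ext k
    simp

theorem coeff_prod_wAt (β : Fin m →₀ ℕ) :
    MvPowerSeries.coeff β (∏ i : Fin m,
      (MvPowerSeries.X i * MvPowerSeries.pderiv ℚ i (wAt 2 i))) =
      ∏ i, if β i = 0 then 0 else treeCoeff (β i) := by
  rw [coeff_prod_separate]
  · refine Finset.prod_congr rfl fun i _ => ?_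
    rw [coeff_X_mul_pderiv, wAt, PowerSeries.coeff_subst_single]
    simp only [Finsupp.single_eq_same, if_true]
    split_ifs with h
    · simp [h]
    · exact coeff_w _ (Nat.one_le_iff_ne_zero.2 h)
  · intro i β h
    rw [coeff_X_mul_pderiv, wAt, PowerSeries.coeff_subst_single, if_neg h, mul_zero]

/-- The series `w(x₁), …, w(x_m)` are algebraically independent: as `wᵢ` is `xᵢ` times a series with
constant term `1`, a monomial of least degree in `Q` has the same coefficient in `Q(w₁, …, w_m)`. -/
theorem aeval_wAt_ne_zero {Q : MvPolynomial (Fin m) ℚ} (hQ : Q ≠ 0) :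
    MvPolynomial.aeval (fun i => (wAt 2 i : MvPowerSeries (Fin m) ℚ)) Q ≠ 0 := by
  obtain ⟨γ, hγ, hmin⟩ := Finset.exists_min_image Q.support Finsupp.degree
    (MvPolynomial.support_nonempty.2 hQ)
  set h : Fin m → MvPowerSeries (Fin m) ℚ := fun i =>
    PowerSeries.subst (MvPowerSeries.X i : MvPowerSeries (Fin m) ℚ)
      ((PowerSeries.exp ℚ).subst (w 2) : PowerSeries ℚ) with hh
  have hw : ∀ i, (wAt 2 i : MvPowerSeries (Fin m) ℚ) = MvPowerSeries.X i * h i := by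
    intro i
    rw [wAt]
    conv_lhs => rw [w_eq_X_mul]
    rw [PowerSeries.subst_mul (PowerSeries.HasSubst.X i), PowerSeries.subst_X
      (PowerSeries.HasSubst.X i)]
  have hc : ∀ i, MvPowerSeries.constantCoeff (h i) = 1 := by
    intro i
    rw [← MvPowerSeries.coeff_zero_eq_constantCoeff_apply, hh, PowerSeries.coeff_subst_single]
    simp [constantCoeff_exp_w]
  have hterm : ∀ δ : Fin m →₀ ℕ, ∏ i, (wAt 2 i : MvPowerSeries (Fin m) ℚ) ^ δ i =
      MvPowerSeries.monomial δ 1 * ∏ i, h i ^ δ i := by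
    intro δ
    rw [MvPowerSeries.monomial_one_eq, Finsupp.prod_fintype _ _ (fun i => pow_zero _),
      ← Finset.prod_mul_distrib]
    exact Finset.prod_congr rfl fun i _ => by rw [hw, mul_pow]
  intro h0
  have h1 := congrArg (MvPowerSeries.coeff γ) h0
  rw [MvPolynomial.aeval_def, MvPolynomial.eval₂_eq', map_sum, Finset.sum_eq_single γ, hterm,
    MvPowerSeries.algebraMap_apply, MvPowerSeries.coeff_C_mul, MvPowerSeries.coeff_monomial_mul,
    if_pos le_rfl, tsub_self, MvPowerSeries.coeff_zero_eq_constantCoeff_apply, map_prod] at h1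
  · simp only [map_pow, hc, one_pow, Finset.prod_const_one, mul_one, map_zero] at h1
    exact MvPolynomial.mem_support_iff.1 hγ (by simpa using h1)
  · intro δ hδ hne
    rw [hterm, MvPowerSeries.algebraMap_apply, MvPowerSeries.coeff_C_mul,
      MvPowerSeries.coeff_monomial_mul, if_neg, mul_zero]
    intro hle
    apply hne
    have hdeg := hmin δ hδ
    have e : γ = δ + (γ - δ) := (add_tsub_cancel_of_le hle).symm
    rw [e, map_add] at hdeg
    have : γ - δ = 0 := by
      rw [← Finsupp.degree_eq_zero_iff]; omega
    rw [e, this, add_zero]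
  · exact fun h => absurd hγ h

end Series

section Coefficients

variable {m : ℕ}

theorem exists_perm_of_map_eq {f g : Fin m → ℕ}
    (h : Finset.univ.val.map f = Finset.univ.val.map g) : ∃ σ : Equiv.Perm (Fin m), f = g ∘ σ := by
  have hc : ∀ (f : Fin m → ℕ) c, Fintype.card {a // f a = c} = (Finset.univ.val.map f).count c := by
    intro f c
    rw [Multiset.count_map, Fintype.card_subtype, Finset.card_def, Finset.filter_val]
    congr 1
    exact Multiset.filter_congr fun _ _ => eq_comm
  have e : ∀ c, Nonempty ({a // f a = c} ≃ {a // g a = c}) := fun c =>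
    Fintype.card_eq.1 (by rw [hc, hc, h])
  exact ⟨Equiv.ofFiberEquiv fun c => (e c).some, funext fun a =>
    (Equiv.ofFiberEquiv_map (fun c => (e c).some) a).symm⟩

/-- The permutations that carry one tuple to another form a coset of the stabiliser. -/
theorem card_perm_eq (f g : Fin m → ℕ) :
    (Finset.univ.filter fun σ : Equiv.Perm (Fin m) => f = g ∘ σ).card =
      if Finset.univ.val.map f = Finset.univ.val.map g then
        symmetryFactor (Finset.univ.val.map f) else 0 := by
  split_ifs with h
  · obtain ⟨τ, hτ⟩ := exists_perm_of_map_eq h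
    have h1 : (Finset.univ.filter fun σ : Equiv.Perm (Fin m) => f = g ∘ σ).card =
        Fintype.card {σ : Equiv.Perm (Fin m) // f ∘ σ = f} := by
      rw [Fintype.card_subtype]
      refine Finset.card_bij' (fun σ _ => τ⁻¹ * σ) (fun σ _ => τ * σ) ?_ ?_ ?_ ?_
      · intro σ hσ
        rw [Finset.mem_filter] at hσ ⊢
        refine ⟨Finset.mem_univ _, ?_⟩
        conv_rhs => rw [hσ.2]
        rw [hτ]
        funext x
        simp
      · intro σ hσ
        rw [Finset.mem_filter] at hσ ⊢
        refine ⟨Finset.mem_univ _, ?_⟩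
        conv_lhs => rw [← hσ.2, hτ]
        rfl
      · intro σ _; simp
      · intro σ _; simp
    rw [h1, DomMulAct.stabilizer_card', symmetryFactor]
    refine Finset.prod_congr ?_ fun c _ => ?_
    · ext c; simp
    · rw [Multiset.count_map, Fintype.card_subtype, Finset.card_def, Finset.filter_val]
      congr 2
      exact Multiset.filter_congr fun _ _ => eq_comm
  · rw [Finset.card_eq_zero, Finset.filter_eq_empty_iff]
    intro σ _ hσ
    apply h
    rw [hσ, ← Multiset.map_map, Multiset.map_univ_val_equiv]

theorem coeff_symSum (β : Fin m →₀ ℕ) {s : Multiset ℕ} (hs : s.card = m) :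
    MvPowerSeries.coeff β (symSum m s) =
      if Finset.univ.val.map β = s then (symmetryFactor s : ℚ) else 0 := by
  set l := s.sort (· ≥ ·) with hl
  have hlen : l.length = m := by rw [hl, Multiset.length_sort, hs]
  set g : Fin m → ℕ := fun i => l.getD i 0 with hg
  have hgs : Finset.univ.val.map g = s := by
    have : s = (l : Multiset ℕ) := by rw [hl, Multiset.sort_eq]
    rw [this]
    have h2 : l = List.ofFn g := by
      apply List.ext_getElem
      · simp [hlen]
      · intro i h1 h2
        simp [hg, h1]
    rw [h2, Fin.univ_val_map]
  have h1 := card_perm_eq β g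
  rw [hgs] at h1
  have h2 : MvPowerSeries.coeff β (symSum m s) =
      ((Finset.univ.filter fun σ : Equiv.Perm (Fin m) => (β : Fin m → ℕ) = g ∘ σ).card : ℚ) := by
    rw [symSum, map_sum, Finset.card_filter, Nat.cast_sum]
    refine Finset.sum_congr rfl fun σ _ => ?_
    have e : (∏ i : Fin m, (MvPowerSeries.X i : MvPowerSeries (Fin m) ℚ) ^ l.getD (σ i : ℕ) 0) =
        MvPowerSeries.monomial (Finsupp.equivFunOnFinite.symm (g ∘ σ)) 1 := by
      rw [MvPowerSeries.monomial_one_eq, Finsupp.prod_fintype _ _ (fun i => pow_zero _)]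
      rfl
    rw [← hl, e, MvPowerSeries.coeff_monomial]
    have : β = Finsupp.equivFunOnFinite.symm (g ∘ σ) ↔ (β : Fin m → ℕ) = g ∘ σ := by
      rw [Equiv.eq_symm_apply]; rfl
    simp only [this]
    split_ifs <;> simp
  rw [h2, h1]
  split_ifs with h
  · rw [h]
  · simp

/-- Monomials in which some variable is missing do not occur in `P`. -/
theorem coeff_P (β : Fin m →₀ ℕ) (hm : 1 ≤ m) : MvPowerSeries.coeff β (P 2 m) =
    (β.degree : ℚ) ^ ((m : ℤ) - 3) * ∏ i, if β i = 0 then 0 else treeCoeff (β i) := by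
  have h1 : MvPowerSeries.coeff β (P 2 m) =
      MvPowerSeries.coeff β (psiCoeff m (PowerSeries.coeff β.degree (F 2 m))) := by
    show ∑ᶠ j : ℕ, MvPowerSeries.coeff β (psiCoeff m (PowerSeries.coeff j (F 2 m))) = _
    refine finsum_eq_single _ _ fun j hj => ?_
    by_contra h
    exact hj (psi_F_support 2 m j β h)
  have hdeg : β.degree = (Finset.univ.val.map β).sum := by
    rw [Finsupp.degree_eq_sum]; rfl
  rw [h1, F, PowerSeries.coeff_mk]
  by_cases hpos : ∀ i, β i ≠ 0
  · have hn : 1 ≤ β.degree := by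
      have : β ⟨0, hm⟩ ≤ β.degree := Finsupp.le_degree _ _
      have := hpos ⟨0, hm⟩
      omega
    set n := β.degree with hnβ
    let α : n.Partition := ⟨Finset.univ.val.map β, by
      intro i hi
      obtain ⟨k, _, rfl⟩ := Multiset.mem_map.1 hi
      exact Nat.pos_of_ne_zero (hpos k), hdeg.symm⟩
    have hcard : α.parts.card = m := by simp [α]
    rw [if_pos ⟨hn, by simp⟩, map_sum, map_sum, Finset.sum_eq_single α]
    · rw [map_smul, psiCoeff_pMonomial α hcard, map_smul, coeff_symSum β hcard, if_pos rfl,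
        smul_eq_mul, c_two_eq hn, hcard]
      have hN := congrArg (Nat.cast (R := ℚ)) (conjClass_ncard α)
      push_cast at hN
      have hprod : (α.parts.map fun a : ℕ => (a : ℚ) * treeCoeff a).prod =
          (α.parts.prod : ℚ) * ∏ i, treeCoeff (β i) := by
        rw [Multiset.prod_map_mul]
        congr 1
        · rw [Nat.cast_multiset_prod]
        · show ((Finset.univ.val.map β).map treeCoeff).prod = _
          rw [Multiset.map_map]; rfl
      have hif : ∏ i, (if β i = 0 then 0 else treeCoeff (β i)) = ∏ i, treeCoeff (β i) :=
        Finset.prod_congr rfl fun i _ => if_neg (hpos i)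
      rw [hprod, hif]
      have h2 : ((mu 2 α)! : ℚ) ≠ 0 := by positivity
      have h3 : (n ! : ℚ) ≠ 0 := by positivity
      field_simp
      rw [← hN]
      push_cast
      ring
    · intro α' hα' hne
      have hm' : α'.parts.card = m := (Finset.mem_filter.1 hα').2
      rw [map_smul, psiCoeff_pMonomial α' hm', map_smul, coeff_symSum β hm', if_neg, smul_zero]
      intro h
      exact hne (Nat.Partition.ext h.symm)
    · intro h
      exact (h (Finset.mem_filter.2 ⟨Finset.mem_univ _, hcard⟩)).elim
  · push Not at hpos
    obtain ⟨i, hi⟩ := hpos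
    have hzero : ∏ i, (if β i = 0 then 0 else treeCoeff (β i)) = 0 :=
      Finset.prod_eq_zero (Finset.mem_univ i) (by rw [if_pos hi])
    rw [hzero, mul_zero]
    split_ifs
    · rw [map_sum, map_sum]
      refine Finset.sum_eq_zero fun α hα => ?_
      have hm' : α.parts.card = m := (Finset.mem_filter.1 hα).2
      rw [map_smul, psiCoeff_pMonomial α hm', map_smul, coeff_symSum β hm', if_neg, smul_zero]
      intro h
      have : 0 ∈ α.parts := by
        rw [← h]; exact Multiset.mem_map.2 ⟨i, Finset.mem_univ i, hi⟩
      exact (α.parts_pos this).ne' rfl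
    · simp

/-- Hurwitz's formula in terms of generating series. -/
theorem eulerPow_P (hm : 1 ≤ m) : eulerPow (3 - (m : ℤ)) (P 2 m) =
    ∏ i : Fin m, (MvPowerSeries.X i * MvPowerSeries.pderiv ℚ i (wAt 2 i)) := by
  ext β
  rw [coeff_eulerPow, coeff_P β hm, coeff_prod_wAt, ← mul_assoc]
  by_cases hpos : ∀ i, β i ≠ 0
  · have hn : 1 ≤ β.degree := by
      have : β ⟨0, hm⟩ ≤ β.degree := Finsupp.le_degree _ _
      have := hpos ⟨0, hm⟩
      omega
    have h0 : (β.degree : ℚ) ≠ 0 := by exact_mod_cast (by omega : β.degree ≠ 0)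
    rw [← zpow_add₀ h0]
    simp
  · push Not at hpos
    obtain ⟨i, hi⟩ := hpos
    have hzero : ∏ i, (if β i = 0 then 0 else treeCoeff (β i)) = 0 :=
      Finset.prod_eq_zero (Finset.mem_univ i) (by rw [if_pos hi])
    rw [hzero, mul_zero]

end Coefficients

end TransFact

end

theorem lemma1p6 (m : ℕ) (hm : 1 ≤ m) (S : MvPolynomial (Fin m) ℚ) :
    TransFact.IsS 2 m S ↔ S = 1 := by
  constructor
  · intro hS
    have h := hS.equation
    rw [TransFact.eulerPow_P hm] at h
    by_contra hne
    have hprod : ∏ i : Fin m, (MvPowerSeries.X i * MvPowerSeries.pderiv ℚ i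
        (TransFact.wAt 2 i : MvPowerSeries (Fin m) ℚ)) ≠ 0 := by
      intro h0
      have h1 := congrArg (MvPowerSeries.coeff (Finsupp.equivFunOnFinite.symm fun _ => 1)) h0
      rw [TransFact.coeff_prod_wAt] at h1
      simp [TransFact.treeCoeff] at h1
    have h2 := TransFact.aeval_wAt_ne_zero (sub_ne_zero.2 hne)
    rw [map_sub, map_one] at h2
    apply mul_ne_zero h2 hprod
    rw [sub_mul, one_mul, ← h, sub_self]
  · rintro rfl
    refine ⟨MvPolynomial.IsSymmetric.one, ?_⟩
    rw [map_one, one_mul, TransFact.eulerPow_P hm]
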